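/- Let $L\ge 0$, $n_1,\dots,n_{L+1}\ge 1$, $N_i=n_1+\dots+n_i$, $N=N_{L+1}$, and $k_1,\dots,k_L\ge 0$ be integers. **Lumps.** Moduli matrices are families $q=(q_1(z),\dots,q_L(z))$ of polynomial matrices, $q_i$ of size $N_i\times N_{i+1}$. Put $\xi_i=q_iq_{i+1}\cdots q_L=(\mathfrak D_i,\widetilde{\mathfrak D}_i)$ with $\mathfrak D_i$ of size $N_i\times N_i$. They are *vortex* moduli matrices of charge $(k_i)$ if $\deg\det\mathfrak D_i=k_i$ and $\mathfrak D_i^{-1}\widetilde{\mathfrak D}_i=O(z^{-1})$ as $|z|\to\infty$ for all $i$, and a *non-singular lump* if moreover $\det\xi_i(z)\xi_i(z)^\dagger\neq0$ for all $z\in\mathbb C$ and all $i$. Two families are $V$-equivalent if $q_i'=V_iq_iV_{i+1}^{-1}$ with $V_i\in GL(N_i,\mathbb C[z])$, $V_{L+1}=1$. The flag at $z$ consists of the row spaces of the $\xi_i(z)$, $1\le i\le L$. **Half-ADHM data.** These are complex matrices $d=(Z_i,\Upsilon_i,\widetilde\Upsilon_i,W_j)$, $1\le i\le L$, $1\le j\le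 L-1$, of sizes $k_i\times k_i$, $n_i\times k_i$, $k_i\times n_{i+1}$, $k_j\times k_{j+1}$, with $Z_jW_j-W_jZ_{j+1}=\widetilde\Upsilon_j\Upsilon_{j+1}$. The group $\prod_iGL(k_i,\mathbb C)$ acts by $(g_i^{-1}Z_ig_i,\Upsilon_ig_i,g_i^{-1}\widetilde\Upsilon_i,g_j^{-1}W_jg_{j+1})$. Let $\mathcal A=\mathcal A^{n_1,\dots,n_{L+1}}_{k_1,\dots,k_L}$ be the set of orbits. Let $\Psi_i$ have block rows $\Upsilon_aW_a\cdots W_{i-1}$ ($1\le a\le i$) and $\widetilde\Psi_i$ have block columns $W_i\cdots W_{b-2}\widetilde\Upsilon_{b-1}$ ($i<b\le L+1$). Condition $\mathcal C_i$ (resp. $\widetilde{\mathcal C}_i$) says that $GL(k_i,\mathbb C)$ acts freely on $\{Z_i,\Psi_i\}$ (resp. on $\{Z_i,\widetilde\Psi_i\}$), that is, only $g=1$ fixes the pair. The data $d$ *correspond* to $q$ if there are polynomial matrices $\mathfrak J_i(z)$ whose columns form a basis of the space of polynomial vectors $v$ with $\mathfrak D_i^{-1}v=O(z^{-1})$, such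 that $\mathfrak D_i\Psi_i=\mathfrak J_i(z-Z_i)$, $\widetilde{\mathfrak D}_i=\mathfrak J_i\widetilde\Psi_i$ and $q_j\mathfrak J_{j+1}=\mathfrak J_jW_j$. **Moduli spaces.** $\mathcal M_{\rm vtx}\subset\mathcal A$ is the set of orbits of data satisfying all $\mathcal C_i$, and $\mathcal M_{\rm lump}\subset\mathcal A$ is the set of orbits of data corresponding to non-singular lumps of charge $(k_i)$. **Coordinates.** For blocks $f_{ab}$ of size $n_a\times n_b$, $1\le a<b\le L+1$, let $\mathcal U(f)$ be the upper block-unitriangular $N\times N$ matrix with blocks $f_{ab}$. The flag of an $N\times N$ matrix consists of the spans of its first $N_i$ rows, $1\le i\le L$. Put $$\varphi_{ij}(z)=\Upsilon_i(z-Z_i)^{-1}W_iW_{i+1}\cdots W_{j-2}\widetilde\Upsilon_{j-1}\qquad(1\le i<j\le L+1).$$ **Duality.** The dual of $d$ is $$(Z_i,\Upsilon_i,\widetilde\Upsilon_i,W_j)^{\rm dual}=(Z_{L+1-i}^{T},\ \widetilde\Upsilon_{L+1-i}^{T},\ -\Upsilon_{L+1-i}^{T},\ W_{L-j}^{T}),$$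 which are half-ADHM data for $(n_{L+1},\dots,n_1)$ and $(k_L,\dots,k_1)$. Let $\delta$ be the induced map of orbit sets $\mathcal A^{n_1,\dots,n_{L+1}}_{k_1,\dots,k_L}\to\mathcal A^{n_{L+1},\dots,n_1}_{k_L,\dots,k_1}$. For $\mathcal G\in GL(N,\mathbb C)$ let $\mathcal G_{\rm dual}=R(\mathcal G^T)^{-1}R^\dagger$, where $R$ is the block anti-diagonal permutation matrix with blocks $1_{n_{L+1}},\dots,1_{n_1}$ from top to bottom. Then the following hold. 1. Correspondence induces a bijection from $V$-classes of vortex moduli matrices of charge $(k_i)$ onto $\mathcal M_{\rm vtx}$ ($q$ and $d$ correspond if and only if the class of $q$ goes to the class of $d$), and it restricts to a bijection from $V$-classes of non-singular lumps onto $\mathcal M_{\rm lump}$. Two non-singular lumps of charge $(k_i)$ are $V$-equivalent if and only if they have the same flag at every $z\in\mathbb C$. 2. If $q$ is a vortex moduli matrix of charge $(k_i)$ with corresponding data $d$, then for each $i$: $\det\xi_i(z)\xi_i(z)^\dagger\ne0$ for all $z$ if and only if $\mathcal C_i$ and $\widetilde{\mathcal C}_i$ hold. Moreover $\mathcal M_{\rm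 lump}$ is exactly the set of orbits of data satisfying $\mathcal C_i$ and $\widetilde{\mathcal C}_i$ for all $i$. 3. For all half-ADHM data, $\mathcal C_i$ is equivalent to: $\Psi_i(z-Z_i)^{-1}v=0$ for all $z$ outside the spectrum of $Z_i$ implies $v=0$; and $\widetilde{\mathcal C}_i$ is equivalent to: $v(z-Z_i)^{-1}\widetilde\Psi_i=0$ for all such $z$ implies $v=0$. 4. If $q$ is a vortex moduli matrix of charge $(k_i)$ with corresponding data $d$, then $\det\mathfrak D_i(z)\ne0$ if and only if $\det(z-Z_i)\neq0$, and whenever this holds for all $i$, the flag at $z$ equals the flag of $\mathcal U(f)$ if and only if $f=\varphi(z)$. 5. The map $\delta$ is bijective. The dual data satisfy $\mathcal C_i$ (resp. $\widetilde{\mathcal C}_i$) if and only if $d$ satisfies $\widetilde{\mathcal C}_{L+1-i}$ (resp. $\mathcal C_{L+1-i}$), and $\mathcal U(\varphi^{\rm dual}(z))=R\,(\mathcal U(\varphi(z))^{T})^{-1}R^\dagger$ for all $z$ with $\det(z-Z_i)\ne0$ for all $i$, where $\varphi^{\rm dual}$ is computed from the dual data. 6. If $d$ corresponds to a non-singular lump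 $q$ of charge $(k_i)$, then the dual data correspond to some vortex moduli matrix $q'$ for the reversed sequences, and each such $q'$ is a non-singular lump giving the same solution: for every $z\in\mathbb C$, the flag of $q$ at $z$ is the flag of some $\mathcal G\in GL(N,\mathbb C)$, and for every such $\mathcal G$ the flag of $q'$ at $z$ is the flag of $\mathcal G_{\rm dual}$. The map $\delta$ restricts to a bijection from $\mathcal M_{\rm lump}$ onto the lump moduli space for the reversed sequences. 7. Identifying orbits through $\delta$, $$\mathcal M_{\rm lump}{}^{n_1,\dots,n_{L+1}}_{k_1,\dots,k_L}=\mathcal M_{\rm vtx}{}^{n_1,\dots,n_{L+1}}_{k_1,\dots,k_L}\cap\delta^{-1}\Big(\mathcal M_{\rm vtx}{}^{n_{L+1},\dots,n_1}_{k_L,\dots,k_1}\Big).$$ -/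

import Mathlib

open scoped Polynomial Matrix

namespace FlagLump

noncomputable section

/-! ### Index sets

`n a` (`a = 0, …, L`) are the block sizes of the flag manifold and `k i` (`i = 0, …, L - 1`) are the
topological charges; the usual labels `1, …, L + 1` and `1, …, L` are shifted by one. The gauge node
`i : Fin L` sits between the blocks `i.castSucc` and `i.succ`. -/

/-- The sequence in reversed order. -/
abbrev rev {m : ℕ} (f : Fin m → ℕ) : Fin m → ℕ := fun a => f a.rev

/-- Index set of `ℂ^N`, `N = ∑ a, n a`: a block and a position in that block. -/
abbrev FlavorIdx {L : ℕ} (n : Fin (L + 1) → ℕ) : Type := Σ a : Fin (L + 1), Fin (n a)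

/-- Indices in the blocks up to and including `m`. -/
abbrev ColorIdx {L : ℕ} (n : Fin (L + 1) → ℕ) (m : Fin (L + 1)) : Type :=
  {t : FlavorIdx n // t.1 ≤ m}

/-- Indices in the blocks after `m`. -/
abbrev ColorCoIdx {L : ℕ} (n : Fin (L + 1) → ℕ) (m : Fin (L + 1)) : Type :=
  {t : FlavorIdx n // m < t.1}

/-- The node with label `a`, just after the block `a`. -/
def nodeFrom {L : ℕ} (a : Fin (L + 1)) (h : a < Fin.last L) : Fin L := a.castLT h

/-- The node with label `b - 1`, just before the block `b`. -/
def nodeTo {L : ℕ} (b : Fin (L + 1)) (h : 0 < b) : Fin L := b.pred h.ne'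

theorem castSucc_nodeFrom {L : ℕ} (a : Fin (L + 1)) (h : a < Fin.last L) :
    (nodeFrom a h).castSucc = a := rfl

theorem succ_nodeTo {L : ℕ} (b : Fin (L + 1)) (h : 0 < b) : (nodeTo b h).succ = b :=
  Fin.succ_pred b h.ne'

theorem le_nodeTo {L : ℕ} {i : Fin L} {b : Fin (L + 1)} (h : i.castSucc < b) :
    i ≤ nodeTo b (lt_of_le_of_lt (Fin.zero_le _) h) :=
  Nat.le_sub_one_of_lt h

theorem nodeFrom_le_nodeTo {L : ℕ} {a b : Fin (L + 1)} (h : a < b) :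
    nodeFrom a (lt_of_lt_of_le h (Fin.le_last b)) ≤
      nodeTo b (lt_of_le_of_lt (Fin.zero_le a) h) :=
  Nat.le_sub_one_of_lt h

/-! ### Moduli matrices -/

/-- Value at `z` of a matrix of polynomials. -/
def evalAt {r c : Type} (M : Matrix r c ℂ[X]) (z : ℂ) : Matrix r c ℂ := M.map (Polynomial.eval z)

/-- Moduli matrices `q_i(z)`, of size `N_i × N_{i+1}`, with polynomial entries. -/
abbrev ModuliMatrix {L : ℕ} (n : Fin (L + 1) → ℕ) : Type :=
  ∀ i : Fin L, Matrix (ColorIdx n i.castSucc) (ColorIdx n i.succ) ℂ[X]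

/-- `ξ_m = q_m q_{m+1} ⋯ q_L`, with `ξ = 1` at the last label. -/
def xi {L : ℕ} {n : Fin (L + 1) → ℕ} (q : ModuliMatrix n) (m : Fin (L + 1)) :
    Matrix (ColorIdx n m) (FlavorIdx n) ℂ[X] :=
  Fin.reverseInduction (motive := fun m => Matrix (ColorIdx n m) (FlavorIdx n) ℂ[X])
    ((1 : Matrix (FlavorIdx n) (FlavorIdx n) ℂ[X]).submatrix Subtype.val id)
    (fun i x => q i * x) m

/-- The left square part `𝔇_i` of `ξ_i = (𝔇_i, 𝔇̃_i)`. -/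
def Dmat {L : ℕ} {n : Fin (L + 1) → ℕ} (q : ModuliMatrix n) (i : Fin L) :
    Matrix (ColorIdx n i.castSucc) (ColorIdx n i.castSucc) ℂ[X] :=
  (xi q i.castSucc).submatrix id Subtype.val

/-- The right part `𝔇̃_i` of `ξ_i = (𝔇_i, 𝔇̃_i)`. -/
def Dtil {L : ℕ} {n : Fin (L + 1) → ℕ} (q : ModuliMatrix n) (i : Fin L) :
    Matrix (ColorIdx n i.castSucc) (ColorCoIdx n i.castSucc) ℂ[X] :=
  (xi q i.castSucc).submatrix id Subtype.val

/-- `D(z)⁻¹ v(z) = O(z⁻¹)` as `|z| → ∞`. -/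
def Decays {r : Type} [Fintype r] [DecidableEq r] (D : Matrix r r ℂ[X]) (v : r → ℂ[X]) : Prop :=
  ∀ s : r, (fun z : ℂ => ((evalAt D z)⁻¹ *ᵥ fun t => (v t).eval z) s)
    =O[Bornology.cobounded ℂ] fun z : ℂ => z⁻¹

/-- Vortex moduli matrices of charges `k`: `det 𝔇_i` has degree `k_i` and `𝔇_i⁻¹ 𝔇̃_i = O(z⁻¹)`. -/
def IsVortex {L : ℕ} {n : Fin (L + 1) → ℕ} (q : ModuliMatrix n) (k : Fin L → ℕ) : Prop :=
  ∀ i : Fin L, (Dmat q i).det.degree = (k i : WithBot ℕ) ∧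
    ∀ c, Decays (Dmat q i) (fun r => Dtil q i r c)

/-- `det ξ_i(z) ξ_i(z)† ≠ 0` for all `z`, at the node `i`. -/
def NonsingularAt {L : ℕ} {n : Fin (L + 1) → ℕ} (q : ModuliMatrix n) (i : Fin L) : Prop :=
  ∀ z : ℂ, (evalAt (xi q i.castSucc) z * (evalAt (xi q i.castSucc) z)ᴴ).det ≠ 0

/-- A non-singular lump of charges `k`: all `ξ_i(z)` have full rank at every point `z`. -/
def IsLump {L : ℕ} {n : Fin (L + 1) → ℕ} (q : ModuliMatrix n) (k : Fin L → ℕ) : Prop :=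
  IsVortex q k ∧ ∀ i : Fin L, NonsingularAt q i

/-- `V`-transformations `q_i ↦ V_i q_i V_{i+1}⁻¹`, where the `V_i` are invertible over `ℂ[z]` and the
last one is `1`. -/
def VEquiv {L : ℕ} {n : Fin (L + 1) → ℕ} (q q' : ModuliMatrix n) : Prop :=
  ∃ V : ∀ m : Fin (L + 1), (Matrix (ColorIdx n m) (ColorIdx n m) ℂ[X])ˣ,
    V (Fin.last L) = 1 ∧
    ∀ i : Fin L, q' i = (V i.castSucc).val * q i * ((V i.succ)⁻¹).val

theorem VEquiv.refl {L : ℕ} {n : Fin (L + 1) → ℕ} (q : ModuliMatrix n) : VEquiv q q :=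
  ⟨fun _ => 1, rfl, fun i => by simp⟩

theorem VEquiv.symm {L : ℕ} {n : Fin (L + 1) → ℕ} {q q' : ModuliMatrix n} (h : VEquiv q q') :
    VEquiv q' q := by
  obtain ⟨V, hV, h⟩ := h
  refine ⟨fun m => (V m)⁻¹, by simp [hV], fun i => ?_⟩
  rw [h i]
  simp only [inv_inv, Matrix.mul_assoc, Units.inv_mul, Matrix.mul_one]
  rw [← Matrix.mul_assoc, Units.inv_mul, Matrix.one_mul]

theorem VEquiv.trans {L : ℕ} {n : Fin (L + 1) → ℕ} {q q' q'' : ModuliMatrix n}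
    (h : VEquiv q q') (h' : VEquiv q' q'') : VEquiv q q'' := by
  obtain ⟨V, hV, h⟩ := h
  obtain ⟨V', hV', h'⟩ := h'
  refine ⟨fun m => V' m * V m, by simp [hV, hV'], fun i => ?_⟩
  rw [h' i, h i]
  simp only [mul_inv_rev, Units.val_mul, Matrix.mul_assoc]

/-- `V`-equivalence of moduli matrices. -/
def vSetoid {L : ℕ} (n : Fin (L + 1) → ℕ) : Setoid (ModuliMatrix n) :=
  ⟨VEquiv, VEquiv.refl, VEquiv.symm, VEquiv.trans⟩

/-- The `V`-equivalence class of moduli matrices. -/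
def vClass {L : ℕ} {n : Fin (L + 1) → ℕ} (q : ModuliMatrix n) : Quotient (vSetoid n) :=
  Quotient.mk _ q

/-- Vortex moduli matrices up to `V`-transformations. -/
def matrixVtxModuli {L : ℕ} (n : Fin (L + 1) → ℕ) (k : Fin L → ℕ) : Set (Quotient (vSetoid n)) :=
  vClass '' {q | IsVortex q k}

/-- Non-singular lumps up to `V`-transformations. -/
def matrixLumpModuli {L : ℕ} (n : Fin (L + 1) → ℕ) (k : Fin L → ℕ) : Set (Quotient (vSetoid n)) :=
  vClass '' {q | IsLump q k}

/-! ### Flags and inhomogeneous coordinates -/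

/-- The value at `z` of the map to the flag manifold: the row spaces of the `ξ_i(z)`. -/
def lumpFlag {L : ℕ} {n : Fin (L + 1) → ℕ} (q : ModuliMatrix n) (z : ℂ) (i : Fin L) :
    Submodule ℂ (FlavorIdx n → ℂ) :=
  Submodule.span ℂ (Set.range fun r : ColorIdx n i.castSucc => evalAt (xi q i.castSucc) z r)

/-- The flag of `𝒢`: its `i`-th space is spanned by the rows of `𝒢` in the first blocks. -/
def flagOf {L : ℕ} {n : Fin (L + 1) → ℕ} (G : Matrix (FlavorIdx n) (FlavorIdx n) ℂ) (i : Fin L) :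
    Submodule ℂ (FlavorIdx n → ℂ) :=
  Submodule.span ℂ (Set.range fun r : ColorIdx n i.castSucc => G r.val)

/-- Blocks `φ_{ab}`, `a < b`, of size `n_a × n_b`. -/
abbrev Blocks {L : ℕ} (n : Fin (L + 1) → ℕ) : Type :=
  ∀ a b : Fin (L + 1), a < b → Matrix (Fin (n a)) (Fin (n b)) ℂ

/-- The upper block unitriangular matrix with blocks `φ_{ab}` above the diagonal. -/
def unitriangular {L : ℕ} {n : Fin (L + 1) → ℕ} (φ : Blocks n) :
    Matrix (FlavorIdx n) (FlavorIdx n) ℂ :=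
  Matrix.of fun s t => if h : s.1 < t.1 then φ s.1 t.1 h s.2 t.2 else if s = t then 1 else 0

/-- The block anti-diagonal permutation matrix `R`. -/
def Rmat {L : ℕ} (n : Fin (L + 1) → ℕ) : Matrix (FlavorIdx (rev n)) (FlavorIdx n) ℂ :=
  Matrix.of fun s t => if (⟨s.1.rev, s.2⟩ : FlavorIdx n) = t then 1 else 0

/-- `𝒢_dual = R (𝒢ᵀ)⁻¹ R†`. -/
def dualG {L : ℕ} {n : Fin (L + 1) → ℕ} (G : Matrix (FlavorIdx n) (FlavorIdx n) ℂ) :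
    Matrix (FlavorIdx (rev n)) (FlavorIdx (rev n)) ℂ :=
  Rmat n * Gᵀ⁻¹ * (Rmat n)ᴴ

/-! ### Half-ADHM data -/

/-- Half-ADHM data `(Z_i, Υ_i, Υ̃_i, W_i)` with `Z_i W_i - W_i Z_{i+1} = Υ̃_i Υ_{i+1}`. The label of
the block next to a node is carried together with a proof of that, so that no casts are needed:
`Υ i.castSucc i rfl` is `Υ_i`, `Υt i i.succ rfl` is `Υ̃_i`, and `W i j h` is `W_i`, where `j` is the
node after `i`. -/
structure HalfADHM {L : ℕ} (n : Fin (L + 1) → ℕ) (k : Fin L → ℕ) where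
  Z : ∀ i : Fin L, Matrix (Fin (k i)) (Fin (k i)) ℂ
  Υ : ∀ (a : Fin (L + 1)) (i : Fin L), a = i.castSucc → Matrix (Fin (n a)) (Fin (k i)) ℂ
  Υt : ∀ (i : Fin L) (a : Fin (L + 1)), a = i.succ → Matrix (Fin (k i)) (Fin (n a)) ℂ
  W : ∀ i j : Fin L, i.succ = j.castSucc → Matrix (Fin (k i)) (Fin (k j)) ℂ
  constraint : ∀ (i j : Fin L) (h : i.succ = j.castSucc),
    Z i * W i j h - W i j h * Z j = Υt i i.succ rfl * Υ i.succ j h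

namespace HalfADHM

variable {L : ℕ} {n : Fin (L + 1) → ℕ} {k : Fin L → ℕ}

/-- The product of `m` consecutive matrices `W`, from the node `i` to the node `j = i + m`. -/
def Wpath (d : HalfADHM n k) :
    (m : ℕ) → (i j : Fin L) → i.val + m = j.val → Matrix (Fin (k i)) (Fin (k j)) ℂ
  | 0, i, j, h => (1 : Matrix (Fin (k i)) (Fin (k i)) ℂ).submatrix id
      (Fin.cast (congrArg k (Fin.ext h.symm)))
  | m + 1, i, j, h =>
      have hi : i.val + 1 < L := by omega
      d.W i ⟨i.val + 1, hi⟩ (Fin.ext rfl) *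
        Wpath d m ⟨i.val + 1, hi⟩ j ((Nat.succ_add_eq_add_succ i.val m).trans h)

/-- `W_i W_{i+1} ⋯ W_{j-1}` for `i ≤ j` (the identity if `i = j`). -/
def Wprod (d : HalfADHM n k) (i j : Fin L) (h : i ≤ j) : Matrix (Fin (k i)) (Fin (k j)) ℂ :=
  d.Wpath (j.val - i.val) i j (Nat.add_sub_cancel' h)

/-- The matrix `z 1 - Z_i`. -/
def res (d : HalfADHM n k) (i : Fin L) (z : ℂ) : Matrix (Fin (k i)) (Fin (k i)) ℂ :=
  Matrix.scalar (Fin (k i)) z - d.Z i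

/-- `Ψ_i`, with block rows `Υ_a W_a ⋯ W_{i-1}`, one for each block `a` up to `i`. -/
def Ψ (d : HalfADHM n k) (i : Fin L) : Matrix (ColorIdx n i.castSucc) (Fin (k i)) ℂ :=
  Matrix.of fun t c =>
    (d.Υ t.val.1 (nodeFrom t.val.1 (lt_of_le_of_lt t.property i.castSucc_lt_last))
        (castSucc_nodeFrom _ _).symm *
      d.Wprod (nodeFrom t.val.1 (lt_of_le_of_lt t.property i.castSucc_lt_last)) i
        t.property) t.val.2 c

/-- `Ψ̃_i`, with block columns `W_i ⋯ W_{b-2} Υ̃_{b-1}`, one for each block `b` after `i`. -/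
def Ψt (d : HalfADHM n k) (i : Fin L) : Matrix (Fin (k i)) (ColorCoIdx n i.castSucc) ℂ :=
  Matrix.of fun r t =>
    (d.Wprod i (nodeTo t.val.1 (lt_of_le_of_lt (Fin.zero_le _) t.property))
        (le_nodeTo t.property) *
      d.Υt (nodeTo t.val.1 (lt_of_le_of_lt (Fin.zero_le _) t.property)) t.val.1
        (succ_nodeTo _ _).symm) r t.val.2

/-- `φ_{ab}(z) = Υ_a (z 1 - Z_a)⁻¹ W_a ⋯ W_{b-2} Υ̃_{b-1}` for `a < b`. -/
def φ (d : HalfADHM n k) (z : ℂ) : Blocks n := fun a b h =>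
  d.Υ a (nodeFrom a (lt_of_lt_of_le h (Fin.le_last b))) (castSucc_nodeFrom _ _).symm *
    (d.res (nodeFrom a (lt_of_lt_of_le h (Fin.le_last b))) z)⁻¹ *
    d.Wprod (nodeFrom a (lt_of_lt_of_le h (Fin.le_last b)))
      (nodeTo b (lt_of_le_of_lt (Fin.zero_le a) h)) (nodeFrom_le_nodeTo h) *
    d.Υt (nodeTo b (lt_of_le_of_lt (Fin.zero_le a) h)) b (succ_nodeTo _ _).symm

/-- `GL(k_i, ℂ)` acts freely on `{Z_i, Ψ_i}`: only `g = 1` fixes this pair. -/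
def FreeΨ (d : HalfADHM n k) (i : Fin L) : Prop :=
  ∀ g : GL (Fin (k i)) ℂ,
    (g⁻¹).val * d.Z i * g.val = d.Z i → d.Ψ i * g.val = d.Ψ i → g = 1

/-- `GL(k_i, ℂ)` acts freely on `{Z_i, Ψ̃_i}`: only `g = 1` fixes this pair. -/
def FreeΨt (d : HalfADHM n k) (i : Fin L) : Prop :=
  ∀ g : GL (Fin (k i)) ℂ,
    (g⁻¹).val * d.Z i * g.val = d.Z i → (g⁻¹).val * d.Ψt i = d.Ψt i → g = 1

/-- The action of `∏ i, GL(k_i, ℂ)` on half-ADHM data, as an equivalence relation. -/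
def GaugeEquiv (d d' : HalfADHM n k) : Prop :=
  ∃ g : ∀ i : Fin L, GL (Fin (k i)) ℂ,
    (∀ i, d'.Z i = ((g i)⁻¹).val * d.Z i * (g i).val) ∧
    (∀ a i h, d'.Υ a i h = d.Υ a i h * (g i).val) ∧
    (∀ i a h, d'.Υt i a h = ((g i)⁻¹).val * d.Υt i a h) ∧
    (∀ i j h, d'.W i j h = ((g i)⁻¹).val * d.W i j h * (g j).val)

theorem GaugeEquiv.refl (d : HalfADHM n k) : GaugeEquiv d d :=
  ⟨fun _ => 1, by simp, by simp, by simp, by simp⟩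

theorem GaugeEquiv.symm {d d' : HalfADHM n k} (h : GaugeEquiv d d') : GaugeEquiv d' d := by
  obtain ⟨g, hZ, hU, hV, hW⟩ := h
  have hg : ∀ i, (g i).val * ((g i)⁻¹).val = 1 := fun i => Units.mul_inv _
  refine ⟨fun i => (g i)⁻¹, fun i => ?_, fun a i h => ?_, fun i a h => ?_, fun i j h => ?_⟩
  · rw [hZ i, inv_inv, Matrix.mul_assoc _ _ (g i).val, ← Matrix.mul_assoc (g i).val,
      hg, Matrix.one_mul, Matrix.mul_assoc, hg, Matrix.mul_one]
  · rw [hU, Matrix.mul_assoc, hg, Matrix.mul_one]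
  · rw [hV, inv_inv, ← Matrix.mul_assoc, hg, Matrix.one_mul]
  · rw [hW, inv_inv, Matrix.mul_assoc _ _ (g j).val, ← Matrix.mul_assoc (g i).val,
      hg, Matrix.one_mul, Matrix.mul_assoc, hg, Matrix.mul_one]

theorem GaugeEquiv.trans {d d' d'' : HalfADHM n k} (h : GaugeEquiv d d')
    (h' : GaugeEquiv d' d'') : GaugeEquiv d d'' := by
  obtain ⟨g, hZ, hU, hV, hW⟩ := h
  obtain ⟨g', hZ', hU', hV', hW'⟩ := h'
  refine ⟨fun i => g i * g' i, fun i => ?_, fun a i h => ?_, fun i a h => ?_, fun i j h => ?_⟩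
  · rw [hZ', hZ]; simp only [mul_inv_rev, Units.val_mul, Matrix.mul_assoc]
  · rw [hU', hU]; simp only [Units.val_mul, Matrix.mul_assoc]
  · rw [hV', hV]; simp only [mul_inv_rev, Units.val_mul, Matrix.mul_assoc]
  · rw [hW', hW]; simp only [mul_inv_rev, Units.val_mul, Matrix.mul_assoc]

end HalfADHM

open HalfADHM

/-- Gauge equivalence of half-ADHM data. -/
def gaugeSetoid {L : ℕ} (n : Fin (L + 1) → ℕ) (k : Fin L → ℕ) : Setoid (HalfADHM n k) :=
  ⟨GaugeEquiv, GaugeEquiv.refl, GaugeEquiv.symm, GaugeEquiv.trans⟩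

/-- Half-ADHM data modulo `∏ i, GL(k_i, ℂ)`, without any freeness condition. -/
abbrev DataSpace {L : ℕ} (n : Fin (L + 1) → ℕ) (k : Fin L → ℕ) : Type :=
  Quotient (gaugeSetoid n k)

/-- The gauge equivalence class of half-ADHM data. -/
def dClass {L : ℕ} {n : Fin (L + 1) → ℕ} {k : Fin L → ℕ} (d : HalfADHM n k) : DataSpace n k :=
  Quotient.mk _ d

/-- The half-ADHM mapping relation: for matrices `𝔍_i(z)` whose columns are a basis of the space of
polynomial vectors `v` with `𝔇_i⁻¹ v = O(z⁻¹)`,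
`𝔇_i Ψ_i = 𝔍_i (z 1 - Z_i)`, `𝔇̃_i = 𝔍_i Ψ̃_i` and `q_i 𝔍_{i+1} = 𝔍_i W_i`. -/
def Corresponds {L : ℕ} {n : Fin (L + 1) → ℕ} {k : Fin L → ℕ} (q : ModuliMatrix n)
    (d : HalfADHM n k) : Prop :=
  ∃ J : ∀ (a : Fin (L + 1)) (i : Fin L), a = i.castSucc →
      Matrix (ColorIdx n a) (Fin (k i)) ℂ[X],
    (∀ i : Fin L,
      LinearIndependent ℂ (fun c => fun r => J i.castSucc i rfl r c) ∧
      ∀ v : ColorIdx n i.castSucc → ℂ[X],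
        v ∈ Submodule.span ℂ (Set.range fun c => fun r => J i.castSucc i rfl r c) ↔
          Decays (Dmat q i) v) ∧
    (∀ i : Fin L, Dmat q i * (d.Ψ i).map Polynomial.C =
      J i.castSucc i rfl * (Matrix.scalar (Fin (k i)) Polynomial.X - (d.Z i).map Polynomial.C)) ∧
    (∀ i : Fin L, Dtil q i = J i.castSucc i rfl * (d.Ψt i).map Polynomial.C) ∧
    (∀ (i j : Fin L) (h : i.succ = j.castSucc),
      q i * J i.succ j h = J i.castSucc i rfl * (d.W i j h).map Polynomial.C)

/-- The vortex moduli space `𝓜_vtx`. -/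
def vtxModuli {L : ℕ} (n : Fin (L + 1) → ℕ) (k : Fin L → ℕ) : Set (DataSpace n k) :=
  dClass '' {d | ∀ i, d.FreeΨ i}

/-- The lump moduli space `𝓜_lump`: the classes of the data of non-singular lumps. -/
def lumpModuli {L : ℕ} (n : Fin (L + 1) → ℕ) (k : Fin L → ℕ) : Set (DataSpace n k) :=
  dClass '' {d | ∃ q : ModuliMatrix n, IsLump q k ∧ Corresponds q d}

/-! ### Duality -/

/-- The duality map `(Z_i, Υ_i, Υ̃_i, W_j) ↦ (Zᵀ, Υ̃ᵀ, -Υᵀ, Wᵀ)` with reversed labels. -/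
def HalfADHM.dual {L : ℕ} {n : Fin (L + 1) → ℕ} {k : Fin L → ℕ} (d : HalfADHM n k) :
    HalfADHM (rev n) (rev k) where
  Z i := (d.Z i.rev)ᵀ
  Υ a i h := (d.Υt i.rev a.rev (by rw [h, Fin.rev_castSucc]))ᵀ
  Υt i a h := -(d.Υ a.rev i.rev (by rw [h, Fin.rev_succ]))ᵀ
  W i j h := (d.W j.rev i.rev (by rw [← Fin.rev_castSucc, ← h, Fin.rev_succ]))ᵀ
  constraint i j h := by
    have h' : j.rev.succ = i.rev.castSucc := by rw [← Fin.rev_castSucc, ← h, Fin.rev_succ]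
    have e : ∀ (b c : Fin (L + 1)) (_ : b = c) (hb : b = j.rev.succ) (hb' : b = i.rev.castSucc)
        (hc : c = j.rev.succ) (hc' : c = i.rev.castSucc),
        d.Υt j.rev b hb * d.Υ b i.rev hb' = d.Υt j.rev c hc * d.Υ c i.rev hc' := by
      rintro b c rfl _ _ _ _; rfl
    rw [Matrix.neg_mul, ← Matrix.transpose_mul, ← Matrix.transpose_mul, ← Matrix.transpose_mul,
      ← Matrix.transpose_sub, ← Matrix.transpose_neg]
    congr 1
    rw [← neg_sub, d.constraint j.rev i.rev h']
    congr 1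
    exact e _ _ (by rw [Fin.rev_succ, h']) _ _ _ _

theorem HalfADHM.GaugeEquiv.dual {L : ℕ} {n : Fin (L + 1) → ℕ} {k : Fin L → ℕ}
    {d d' : HalfADHM n k} (h : GaugeEquiv d d') : GaugeEquiv d.dual d'.dual := by
  obtain ⟨g, hZ, hU, hV, hW⟩ := h
  have h1 : ∀ i, ((g i)⁻¹).valᵀ * (g i).valᵀ = 1 := fun i => by
    rw [← Matrix.transpose_mul, Units.mul_inv, Matrix.transpose_one]
  have h2 : ∀ i, (g i).valᵀ * ((g i)⁻¹).valᵀ = 1 := fun i => by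
    rw [← Matrix.transpose_mul, Units.inv_mul, Matrix.transpose_one]
  refine ⟨fun i => ⟨((g i.rev)⁻¹).valᵀ, (g i.rev).valᵀ, h1 _, h2 _⟩,
    fun i => ?_, fun a i h => ?_, fun i a h => ?_, fun i j h => ?_⟩
  · simp [HalfADHM.dual, hZ, Matrix.transpose_mul, Matrix.mul_assoc]
  · simp [HalfADHM.dual, hV, Matrix.transpose_mul]
  · simp [HalfADHM.dual, hU, Matrix.transpose_mul]
  · simp [HalfADHM.dual, hW, Matrix.transpose_mul, Matrix.mul_assoc]

/-- The duality map on classes of half-ADHM data. -/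
def dualMap {L : ℕ} (n : Fin (L + 1) → ℕ) (k : Fin L → ℕ) :
    DataSpace n k → DataSpace (rev n) (rev k) :=
  Quotient.map HalfADHM.dual fun _ _ h => HalfADHM.GaugeEquiv.dual h

end

end FlagLump

open FlagLump

/-! The proof is realization theory for polynomial matrices, carried out node by node. Let `D` be a
square polynomial matrix with nonzero determinant. Division with remainder splits every polynomial
vector uniquely as `D w + v` with `D⁻¹ v` strictly proper, so the space `decaying D` of such `v` is
isomorphic to the cokernel of `D` and has dimension `deg det D`. Multiplying a basis `J` of it by
`X` and projecting back defines `Z`. The overflow is `D` times a constant matrix `Ψ`, so `D Ψ = J (X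
- Z)`; this is the structure `Realizes`.

The pair `(Ψ, Z)` is then observable: no eigenvector of `Z` is killed by `Ψ`. Observability is
equivalent to freeness of the `GL` action (`free_iff_observable`) and yields a Bezout identity `P Ψ
+ Q (X - Z) = 1` (`Observable.exists_bezout`). Conversely an observable pair is realized by a matrix
`D` whose rows generate the lattice of all `u` with `u Ψ` divisible by `X - Z`
(`Observable.exists_realizes`). This `D` is universal, hence unique up to unimodular factors
(`Realizes.exists_unit`).

For a whole chain, `𝔇̃_i` decays relative to `𝔇_i`, which gives `Ψ̃_i`, and `q_i 𝔍_{i+1}` decays as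
well, which gives `W_i`. Since the image of `𝔇_i` meets the span of `𝔍_i` only in zero, one
polynomial identity splits into the recursion for `Ψ` and the half-ADHM constraint
(`exists_corrVia_of_isVortex`). In the other direction the constraint is exactly what lets `ξ_i`
factor through `ξ_{i+1}` (`exists_corrVia_of_observable`). Changes of the basis `𝔍` are gauge
transformations, and changes of `𝔇` are `V`-transformations.

The map `u ↦ u 𝔍_i(z)` identifies the left kernel of `𝔇_i(z)` with the left kernel of `z - Z_i`. As
`𝔇̃_i = 𝔍_i Ψ̃_i`, the matrix `ξ_i(z)` loses rank exactly when a left eigenvector of `Z_i` is killed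
by `Ψ̃_i`; so non-singularity is the second freeness condition (`CorrVia.nonsingularAt_iff`). Two
Bezout identities then give `ξ_i` a polynomial right inverse, which promotes pointwise equality of
flags to `V`-equivalence.

Transposition exchanges the two freeness conditions. On coordinates, all constraints together say
that `A = z - Z` and `M = 1 - W` satisfy `A M - M A = Υ̃ Υ`, whence `1 + Υ A⁻¹ M⁻¹ Υ̃` has inverse
`1 - Υ M⁻¹ A⁻¹ Υ̃` (`one_add_mul_one_sub_eq_one`). On flags, the `ξ` matrices of dual data
annihilate each other (`CorrVia.xi_mul_transpose_eq_zero`), and a dimension count finishes. -/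

namespace FlagLump

/-! ### Full-rank submodules of `K[X]^r` and degrees of determinants -/

section Lattice

variable {K : Type*} [Field K] {r : Type*} [Fintype r]

/-- Scaling by `p` embeds the whole free module into `N`, so the rank cannot drop. -/
theorem finrank_eq_of_smul_mem {N : Submodule K[X] (r → K[X])} {p : K[X]} (hp : p ≠ 0)
    (h : ∀ v, p • v ∈ N) : Module.finrank K[X] N = Module.finrank K[X] (r → K[X]) := by
  refine le_antisymm (Submodule.finrank_le N) ?_
  refine LinearMap.finrank_le_finrank_of_injective
    (f := (LinearMap.lsmul K[X] (r → K[X]) p).codRestrict N h) ?_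
  intro v w hvw
  have : p • v = p • w := congrArg Subtype.val hvw
  exact smul_right_injective _ hp this

variable [DecidableEq r]

theorem smul_det_mem_range_vecMulLinear (D : Matrix r r K[X]) (v : r → K[X]) :
    D.det • v ∈ LinearMap.range D.vecMulLinear :=
  ⟨v ᵥ* D.adjugate, by simp [Matrix.vecMul_vecMul, Matrix.adjugate_mul, Matrix.vecMul_smul]⟩

/-- A lattice containing a multiple of the standard one is generated by the rows of a square
matrix. -/
theorem exists_range_vecMulLinear_eq {N : Submodule K[X] (r → K[X])} {p : K[X]} (hp : p ≠ 0)
    (h : ∀ v, p • v ∈ N) :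
    ∃ D : Matrix r r K[X], D.det ≠ 0 ∧ LinearMap.range D.vecMulLinear = N := by
  have hr := finrank_eq_of_smul_mem hp h
  set b := Submodule.smithNormalFormBotBasis (Pi.basisFun K[X] r) hr
  have hrange : LinearMap.range (Matrix.of fun i => (b i : r → K[X])).vecMulLinear = N := by
    rw [range_vecMulLinear]
    change Submodule.span K[X] (Set.range fun i => N.subtype (b i)) = N
    rw [Set.range_comp', Submodule.span_image, b.span_eq, Submodule.map_top, N.range_subtype]
  refine ⟨Matrix.of fun i => (b i : r → K[X]), fun h0 => ?_, hrange⟩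
  -- Every `p • e_i` is a combination of the rows, so `p • 1` is a left multiple of this matrix, and
  -- its determinant divides a power of `p`.
  have : ∀ i, ∃ u, u ᵥ* (Matrix.of fun i => (b i : r → K[X])) = p • Pi.single i 1 := by
    intro i
    have := h (Pi.single i 1)
    rw [← hrange] at this
    exact this
  choose U hU using this
  have hUD : Matrix.of U * (Matrix.of fun i => (b i : r → K[X])) = p • 1 := by
    refine Matrix.ext_row fun i => ?_
    change U i ᵥ* _ = _
    rw [hU]
    funext j
    simp [Matrix.one_eq_pi_single]
  have := congrArg Matrix.det hUD
  rw [Matrix.det_mul, h0, Matrix.det_smul, Matrix.det_one, mul_zero, mul_one] at this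
  exact pow_ne_zero _ hp this.symm

theorem finite_quotient_span_singleton {a : K[X]} (ha : a ≠ 0) :
    Module.Finite K (K[X] ⧸ Ideal.span {a}) :=
  PowerBasis.finite (AdjoinRoot.powerBasis ha)

/-- Smith normal form makes the quotient a product of the `K[X] ⧸ (a i)`, of total dimension the
degree of `∏ a i`. The adapted generators form `diagonal a * P` with `P` invertible. They generate
the same lattice as the rows of `D`, so the two determinants divide each other. -/
theorem finrank_quotient_range_vecMulLinear {D : Matrix r r K[X]} (hD : D.det ≠ 0) :
    Module.Finite K ((r → K[X]) ⧸ LinearMap.range D.vecMulLinear) ∧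
      Module.finrank K ((r → K[X]) ⧸ LinearMap.range D.vecMulLinear) = D.det.natDegree := by
  set N := LinearMap.range D.vecMulLinear with hN
  set b := Pi.basisFun K[X] r
  have h := finrank_eq_of_smul_mem (N := N) hD (smul_det_mem_range_vecMulLinear D)
  set top := Submodule.smithNormalFormTopBasis b h
  set bot := Submodule.smithNormalFormBotBasis b h
  set a := Submodule.smithNormalFormCoeffs b h
  have ha : ∀ i, a i ≠ 0 := Submodule.smithNormalFormCoeffs_ne_zero b h
  have hbot : ∀ i, (bot i : r → K[X]) = a i • top i := Submodule.smithNormalFormBotBasis_def b h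
  have e := (N.quotientEquivPiSpan b h).restrictScalars K
  have hfin : ∀ i, Module.Finite K (K[X] ⧸ Ideal.span {a i}) :=
    fun i => finite_quotient_span_singleton (ha i)
  refine ⟨Module.Finite.equiv e.symm, ?_⟩
  rw [e.finrank_eq, Module.finrank_pi_fintype]
  simp_rw [finrank_quotient_span_eq_natDegree]
  rw [← Polynomial.natDegree_prod _ _ fun i _ => ha i]
  have hmemD : ∀ i, D i ∈ N := fun i => ⟨Pi.single i 1, by simp; rfl⟩
  set S : Matrix r r K[X] := Matrix.of fun i => (bot i : r → K[X])
  set P : Matrix r r K[X] := Matrix.of fun i => top i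
  have hS : S = Matrix.diagonal a * P := by
    ext i j
    simp [S, P, hbot, Matrix.diagonal_mul]
  have h1 : D = Matrix.of (fun i => ⇑(bot.repr ⟨D i, hmemD i⟩)) * S := by
    refine Matrix.ext_row fun i => ?_
    have := congrArg (Subtype.val : N → r → K[X]) (bot.sum_repr ⟨D i, hmemD i⟩)
    funext j
    refine (congrFun this.symm j).trans ?_
    rw [AddSubmonoidClass.coe_finsetSum, Finset.sum_apply]
    rfl
  have h2 : ∃ T, S = T * D := by
    have : ∀ i, ∃ u, u ᵥ* D = (bot i : r → K[X]) := fun i => (bot i).2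
    choose T hT using this
    exact ⟨Matrix.of T, by ext i j; simp [S, ← hT]; rfl⟩
  have h3 : 1 = Matrix.of (fun i => ⇑(top.repr (Pi.single i 1))) * P := by
    ext i j
    have := congrFun (top.sum_repr (Pi.single i 1)) j
    simp only [Matrix.mul_apply, P, Matrix.of_apply, Matrix.one_eq_pi_single, ← this]
    simp
  obtain ⟨T, h2⟩ := h2
  have hPu : IsUnit P.det := by
    have := congrArg Matrix.det h3
    rw [Matrix.det_one, Matrix.det_mul] at this
    exact IsUnit.of_mul_eq_one_right _ this.symm
  have hass : Associated S.det D.det :=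
    associated_of_dvd_dvd ⟨_, (congrArg Matrix.det h1).trans ((Matrix.det_mul _ _).trans (mul_comm _ _))⟩
      (by rw [h2, Matrix.det_mul]; exact Dvd.intro_left _ rfl)
  rw [hS, Matrix.det_mul, Matrix.det_diagonal] at hass
  have := (associated_mul_unit_right (∏ i, a i) _ hPu).trans hass
  exact Polynomial.natDegree_eq_of_degree_eq (Polynomial.degree_eq_degree_of_associated this)

end Lattice

/-! ### Vectors `v` with `D⁻¹ v` strictly proper -/

noncomputable section Decay

variable {K : Type*} [Field K] {r κ : Type*} [Fintype r] [DecidableEq r] [Fintype κ]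
  [DecidableEq κ]

/-- Polynomial vectors `v` such that the entries of `adj(D) v` have degree less than `m`. -/
def adjBounded (D : Matrix r r K[X]) (m : ℕ) : Submodule K (r → K[X]) where
  carrier := {v | ∀ s l, m ≤ l → ((D.adjugate *ᵥ v) s).coeff l = 0}
  zero_mem' := by simp
  add_mem' {v w} hv hw s l h := by simp [Matrix.mulVec_add, hv s l h, hw s l h]
  smul_mem' c v hv s l h := by simp [Matrix.mulVec_smul, hv s l h]

theorem mem_adjBounded {D : Matrix r r K[X]} {m : ℕ} {v : r → K[X]} :
    v ∈ adjBounded D m ↔ ∀ s l, m ≤ l → ((D.adjugate *ᵥ v) s).coeff l = 0 := Iff.rfl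

theorem adjBounded_mono {D : Matrix r r K[X]} {m l : ℕ} (h : m ≤ l) :
    adjBounded D m ≤ adjBounded D l := fun _ hv s t ht => hv s t (h.trans ht)

theorem X_smul_mem_adjBounded {D : Matrix r r K[X]} {m : ℕ} {v : r → K[X]}
    (h : v ∈ adjBounded D m) : (Polynomial.X : K[X]) • v ∈ adjBounded D (m + 1) := by
  intro s l hl
  obtain ⟨l, rfl⟩ : ∃ l', l = l' + 1 := ⟨l - 1, by omega⟩
  rw [Matrix.mulVec_smul, Pi.smul_apply, smul_eq_mul, Polynomial.coeff_X_mul]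
  exact h s l (by omega)

/-- Polynomial vectors `v` such that `D⁻¹ v` is strictly proper. -/
abbrev decaying (D : Matrix r r K[X]) : Submodule K (r → K[X]) := adjBounded D D.det.natDegree

/-- By Cramer's rule `D⁻¹ v` is `adj(D) v` over `det D`; the entrywise Euclidean quotient is its
polynomial part, and the remainder is strictly proper. -/
theorem exists_sub_mulVec_mem_decaying {D : Matrix r r K[X]} (hD : D.det ≠ 0) (v : r → K[X]) :
    ∃ w, v - D *ᵥ w ∈ decaying D := by
  refine ⟨fun s => (D.adjugate *ᵥ v) s / D.det, fun s l hl => ?_⟩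
  have : (D.adjugate *ᵥ (v - D *ᵥ fun s => (D.adjugate *ᵥ v) s / D.det)) s =
      (D.adjugate *ᵥ v) s % D.det := by
    rw [Matrix.mulVec_sub, Matrix.mulVec_mulVec, Matrix.adjugate_mul, Matrix.smul_mulVec,
      Matrix.one_mulVec, Pi.sub_apply, Pi.smul_apply, smul_eq_mul, EuclideanDomain.mod_eq_sub_mul_div]
  rw [this]
  refine Polynomial.coeff_eq_zero_of_degree_lt ((EuclideanDomain.mod_lt _ hD).trans_le ?_)
  rw [Polynomial.degree_eq_natDegree hD]
  exact_mod_cast hl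

/-- Since `adj(D) D w = det D • w`, the degrees of `det D` and of each entry of `w` add up. -/
theorem natDegree_add_le_of_mulVec_mem {D : Matrix r r K[X]} (hD : D.det ≠ 0) {m : ℕ}
    {w : r → K[X]} (h : D *ᵥ w ∈ adjBounded D m) (s : r) (hs : w s ≠ 0) :
    D.det.natDegree + (w s).natDegree < m := by
  by_contra hlt
  have := h s _ (not_lt.1 hlt)
  rw [Matrix.mulVec_mulVec, Matrix.adjugate_mul, Matrix.smul_mulVec, Matrix.one_mulVec,
    Pi.smul_apply, smul_eq_mul, Polynomial.coeff_mul_degree_add_degree] at this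
  simp_all

theorem eq_zero_of_mulVec_mem_decaying {D : Matrix r r K[X]} (hD : D.det ≠ 0) {w : r → K[X]}
    (h : D *ᵥ w ∈ decaying D) : w = 0 := by
  funext s
  by_contra hs
  have := natDegree_add_le_of_mulVec_mem hD h s hs
  omega

/-- One degree beyond strict properness leaves room only for constants. This is why multiplying a
decaying vector by `X` overflows by `D` times a constant vector. -/
theorem exists_eq_C_of_mulVec_mem {D : Matrix r r K[X]} (hD : D.det ≠ 0) {w : r → K[X]}
    (h : D *ᵥ w ∈ adjBounded D (D.det.natDegree + 1)) (s : r) :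
    w s = Polynomial.C ((w s).coeff 0) := by
  refine Polynomial.eq_C_of_natDegree_eq_zero ?_
  by_cases hs : w s = 0
  · simp [hs]
  · have := natDegree_add_le_of_mulVec_mem hD h s hs
    omega

/-- The decaying vectors are a complement of the column lattice of `D`, hence isomorphic to the
quotient by it. The transpose appears because the quotient dimension was computed for row lattices.
-/
theorem finrank_decaying {D : Matrix r r K[X]} (hD : D.det ≠ 0) :
    Module.Finite K (decaying D) ∧ Module.finrank K (decaying D) = D.det.natDegree := by
  have hT : Dᵀ.det ≠ 0 := by rwa [Matrix.det_transpose]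
  obtain ⟨h1, h2⟩ := finrank_quotient_range_vecMulLinear hT
  set N := LinearMap.range (Dᵀ).vecMulLinear
  have hN : ∀ v, v ∈ N ↔ ∃ w, D *ᵥ w = v := fun v => by
    simp [N]
  let f : decaying D →ₗ[K] (r → K[X]) ⧸ N :=
    (N.mkQ.restrictScalars K).comp (decaying D).subtype
  have hf : Function.Bijective f := by
    constructor
    · rw [← LinearMap.ker_eq_bot, LinearMap.ker_eq_bot']
      rintro ⟨v, hv⟩ h0
      obtain ⟨w, rfl⟩ := (hN v).1 ((Submodule.Quotient.mk_eq_zero N).1 h0)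
      exact Subtype.ext (by simp [eq_zero_of_mulVec_mem_decaying hD hv])
    · intro x
      obtain ⟨v, rfl⟩ := N.mkQ_surjective x
      obtain ⟨w, hw⟩ := exists_sub_mulVec_mem_decaying hD v
      refine ⟨⟨_, hw⟩, (Submodule.Quotient.eq N).2 ?_⟩
      exact (hN _).2 ⟨-w, by simp [Matrix.mulVec_neg]⟩
  let e := LinearEquiv.ofBijective f hf
  exact ⟨Module.Finite.equiv e.symm, by rw [e.finrank_eq, h2, Matrix.det_transpose]⟩

omit [DecidableEq r] in
-- If `w (X - Z)` is constant, comparing coefficients gives `w_m = w_{m+1} Z`. Descending from a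
-- degree `M` above all entries, every coefficient vanishes.
theorem eq_zero_of_mul_charmatrix {w : Matrix r κ K[X]} {Z : Matrix κ κ K}
    (h : ∀ i j m, ((w * Z.charmatrix) i j).coeff (m + 1) = 0) : w = 0 := by
  have hrec : ∀ i j m, (w i j).coeff m = ∑ l, (w i l).coeff (m + 1) * Z l j := by
    intro i j m
    have := h i j m
    rw [Matrix.charmatrix, Matrix.mul_sub, Matrix.sub_apply, Polynomial.coeff_sub, sub_eq_zero]
      at this
    simpa [Matrix.mul_apply, Matrix.diagonal_apply, Polynomial.finsetSum_coeff] using this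
  obtain ⟨M, hM⟩ : ∃ M, ∀ i j, (w i j).natDegree < M := by
    refine ⟨∑ i, ∑ j, (w i j).natDegree + 1, fun i j => Nat.lt_succ_of_le ?_⟩
    refine le_trans ?_ (Finset.single_le_sum (f := fun i => ∑ j, (w i j).natDegree)
      (fun _ _ => Nat.zero_le _) (Finset.mem_univ i))
    exact Finset.single_le_sum (f := fun j => (w i j).natDegree)
      (fun _ _ => Nat.zero_le _) (Finset.mem_univ j)
  have hdown : ∀ t m, M ≤ m + t → ∀ i j, (w i j).coeff m = 0 := by
    intro t
    induction t with
    | zero => exact fun m hm i j => Polynomial.coeff_eq_zero_of_natDegree_lt ((hM i j).trans_le hm)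
    | succ t ih =>
      intro m hm i j
      rw [hrec]
      exact Finset.sum_eq_zero fun l _ => by rw [ih (m + 1) (by omega), zero_mul]
  ext i j m
  rw [hdown M m (by omega)]
  simp

theorem col_mul_charmatrix_mem {D : Matrix r r K[X]} {m : ℕ} {Y : Matrix r κ K[X]}
    (hY : ∀ c, Y.col c ∈ adjBounded D m) (Z : Matrix κ κ K) (c : κ) :
    (Y * Z.charmatrix).col c ∈ adjBounded D (m + 1) := by
  have : (Y * Z.charmatrix).col c =
      (Polynomial.X : K[X]) • Y.col c - ∑ l, Z l c • Y.col l := by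
    funext s
    simp [Matrix.charmatrix, Matrix.mul_sub, Matrix.mul_apply, Matrix.diagonal_apply,
      Polynomial.smul_eq_C_mul, mul_comm]
  rw [this]
  refine Submodule.sub_mem _ (X_smul_mem_adjBounded (hY c)) (Submodule.sum_mem _ fun l _ => ?_)
  exact Submodule.smul_mem _ _ (adjBounded_mono (Nat.le_succ m) (hY l))

omit [DecidableEq κ] in
theorem col_mul_map_C_mem {D : Matrix r r K[X]} {m : ℕ} {ι : Type*} {Y : Matrix r κ K[X]}
    (hY : ∀ c, Y.col c ∈ adjBounded D m) (B : Matrix κ ι K) (c : ι) :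
    (Y * B.map Polynomial.C).col c ∈ adjBounded D m := by
  have : (Y * B.map Polynomial.C).col c = ∑ l, B l c • Y.col l := by
    funext s
    simp [Matrix.mul_apply, Polynomial.smul_eq_C_mul, mul_comm]
  rw [this]
  exact Submodule.sum_mem _ fun l _ => Submodule.smul_mem _ _ (hY l)

/-- Subtract from `Y` its polynomial part `D * W`. What remains, times `X - Z`, overflows by at most
one degree, so `Ψ - W (X - Z)` is constant; then `W (X - Z)` is constant and `W = 0`. -/
theorem col_mem_decaying_of_mul_charmatrix {D : Matrix r r K[X]} (hD : D.det ≠ 0)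
    {Y P : Matrix r κ K[X]} {Ψ : Matrix r κ K} {Z : Matrix κ κ K}
    (hP : ∀ c, P.col c ∈ decaying D)
    (h : D * Ψ.map Polynomial.C + P = Y * Z.charmatrix) (c : κ) : Y.col c ∈ decaying D := by
  choose w hw using fun c => exists_sub_mulVec_mem_decaying hD (Y.col c)
  set W : Matrix r κ K[X] := Matrix.of fun s c => w c s
  have hY0 : ∀ c, (Y - D * W).col c ∈ decaying D := hw
  have h1 : D * (Ψ.map Polynomial.C - W * Z.charmatrix) = (Y - D * W) * Z.charmatrix - P := by
    rw [Matrix.mul_sub, Matrix.sub_mul, ← h, Matrix.mul_assoc]; abel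
  have hW : W = 0 := by
    refine eq_zero_of_mul_charmatrix (Z := Z) fun i j m => ?_
    have h2 : D *ᵥ (Ψ.map Polynomial.C - W * Z.charmatrix).col j ∈
        adjBounded D (D.det.natDegree + 1) := by
      have : D *ᵥ (Ψ.map Polynomial.C - W * Z.charmatrix).col j =
          ((Y - D * W) * Z.charmatrix).col j - P.col j := congrArg (Matrix.col · j) h1
      rw [this]
      exact Submodule.sub_mem _ (col_mul_charmatrix_mem hY0 Z j)
        (adjBounded_mono (Nat.le_succ _) (hP j))
    have h3 := exists_eq_C_of_mulVec_mem hD h2 i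
    have h4 := congrArg (fun p => Polynomial.coeff p (m + 1)) h3
    simpa [Polynomial.coeff_C] using h4
  have := hY0 c
  rwa [hW, Matrix.mul_zero, sub_zero] at this

end Decay

/-! ### Decay at infinity as a condition on degrees -/

section Asymptotics

variable {r : Type} [Fintype r] [DecidableEq r]

/-- Decay like `z⁻¹` means `X p = O(d)`. If `deg d ≤ deg p`, then `d = o(X p)`, so `X p` would be
negligible against itself. -/
theorem isBigO_div_inv_iff_degree_lt {p d : ℂ[X]} (hd : d ≠ 0) :
    ((fun z : ℂ => p.eval z / d.eval z) =O[Bornology.cobounded ℂ] fun z : ℂ => z⁻¹) ↔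
      p.degree < d.degree := by
  have hne : ∀ᶠ z in Bornology.cobounded ℂ, d.eval z ≠ 0 := by
    have := (Polynomial.eventually_cofinite_not_isRoot hd).filter_mono
      (Bornology.le_cofinite (α := ℂ))
    exact this
  have hz : ∀ᶠ z : ℂ in Bornology.cobounded ℂ, z ≠ 0 := by
    have := (Polynomial.eventually_cofinite_not_isRoot (Polynomial.X_ne_zero (R := ℂ))).filter_mono
      (Bornology.le_cofinite (α := ℂ))
    filter_upwards [this] with z hz h0
    exact hz (by simp [h0])
  have hX : p ≠ 0 → p.degree < (Polynomial.X * p).degree := by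
    intro hp
    rw [Polynomial.degree_mul, Polynomial.degree_X, add_comm, Polynomial.degree_eq_natDegree hp]
    exact_mod_cast Nat.lt_succ_self _
  constructor
  · intro h
    by_contra hlt
    have hp : p ≠ 0 := by
      rintro rfl
      exact hlt (by simpa [bot_lt_iff_ne_bot] using hd)
    have h1 : (Polynomial.X * p).eval =O[Bornology.cobounded ℂ] d.eval := by
      have := (h.mul (Asymptotics.isBigO_refl (fun z : ℂ => z) _)).mul
        (Asymptotics.isBigO_refl d.eval _)
      refine (this.congr' ?_ ?_)
      · filter_upwards [hne] with z h1
        rw [Polynomial.eval_mul, Polynomial.eval_X]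
        field_simp
      · filter_upwards [hz] with z h1
        field_simp
    have h2 := Polynomial.isLittleO_cobounded_of_degree_lt (R := ℂ)
      ((not_lt.1 hlt).trans_lt (hX hp))
    have h3 := Asymptotics.isLittleO_irrefl' (l := Bornology.cobounded ℂ)
      (f' := (Polynomial.X * p).eval) ?_
    · exact h3 (h1.trans_isLittleO h2)
    · refine Filter.Eventually.frequently ?_
      have := (Polynomial.eventually_cofinite_not_isRoot
        (mul_ne_zero (Polynomial.X_ne_zero (R := ℂ)) hp)).filter_mono
        (Bornology.le_cofinite (α := ℂ))
      filter_upwards [this] with z hz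
      exact norm_ne_zero_iff.2 hz
  · intro h
    have h1 : (Polynomial.X * p).degree ≤ d.degree := by
      by_cases hp : p = 0
      · simp [hp]
      rw [Polynomial.degree_mul, Polynomial.degree_X, add_comm]
      rw [Polynomial.degree_eq_natDegree hp, Polynomial.degree_eq_natDegree hd] at *
      exact_mod_cast h
    have h2 := (Polynomial.isBigO_cobounded_of_degree_le (R := ℂ) h1).mul
      (Asymptotics.isBigO_refl (fun z : ℂ => z⁻¹ * (d.eval z)⁻¹) _)
    refine h2.congr' ?_ ?_
    · filter_upwards [hne, hz] with z h1 h2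
      rw [Polynomial.eval_mul, Polynomial.eval_X]
      field_simp
    · filter_upwards [hne] with z h1
      field_simp

theorem decays_iff {D : Matrix r r ℂ[X]} (hD : D.det ≠ 0) {v : r → ℂ[X]} :
    Decays D v ↔ v ∈ decaying D := by
  -- Cramer's rule. It holds even at the zeros of `det D`, where the matrix inverse and the division
  -- both give zero by convention.
  have key : ∀ z s, ((evalAt D z)⁻¹ *ᵥ fun t => (v t).eval z) s =
      ((D.adjugate *ᵥ v) s).eval z / D.det.eval z := by
    intro z s
    have h1 : (evalAt D z).det = D.det.eval z := by
      rw [← Polynomial.coe_evalRingHom, RingHom.map_det]; rfl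
    have h2 : (evalAt D z).adjugate = evalAt D.adjugate z :=
      (RingHom.map_adjugate (Polynomial.evalRingHom z) D).symm
    rw [Matrix.inv_def, h1, h2, Ring.inverse_eq_inv', Matrix.smul_mulVec, Pi.smul_apply,
      smul_eq_mul, div_eq_inv_mul]
    simp [Matrix.mulVec, dotProduct, evalAt, Polynomial.eval_finsetSum]
  simp only [Decays, key, isBigO_div_inv_iff_degree_lt hD, mem_adjBounded]
  refine forall_congr' fun s => ?_
  rw [Polynomial.degree_eq_natDegree hD, Polynomial.degree_lt_iff_coeff_zero]

end Asymptotics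

/-! ### Evaluation of polynomial matrices -/

section Eval

variable {r c s κ : Type}

theorem evalAt_mul [Fintype c] (M : Matrix r c ℂ[X]) (N : Matrix c s ℂ[X]) (z : ℂ) :
    evalAt (M * N) z = evalAt M z * evalAt N z :=
  Matrix.map_mul (f := Polynomial.evalRingHom z)

theorem evalAt_add (M N : Matrix r c ℂ[X]) (z : ℂ) :
    evalAt (M + N) z = evalAt M z + evalAt N z := by
  ext i j; simp [evalAt]

theorem evalAt_one [DecidableEq r] (z : ℂ) : evalAt (1 : Matrix r r ℂ[X]) z = 1 :=
  Matrix.map_one _ (by simp) (by simp)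

theorem evalAt_map_C (B : Matrix r c ℂ) (z : ℂ) : evalAt (B.map Polynomial.C) z = B := by
  ext i j; simp [evalAt]

theorem evalAt_det [Fintype r] [DecidableEq r] (D : Matrix r r ℂ[X]) (z : ℂ) :
    (evalAt D z).det = D.det.eval z := by
  rw [← Polynomial.coe_evalRingHom, RingHom.map_det]; rfl

theorem evalAt_charmatrix [Fintype κ] [DecidableEq κ] (Z : Matrix κ κ ℂ) (z : ℂ) :
    evalAt Z.charmatrix z = Matrix.scalar κ z - Z := by
  ext i j
  by_cases h : i = j
  · subst h; simp [evalAt]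
  · simp [evalAt, Matrix.charmatrix_apply_ne, h]

theorem eq_of_evalAt_eq {M N : Matrix r c ℂ[X]} (h : ∀ z, evalAt M z = evalAt N z) : M = N := by
  ext1 i j
  exact Polynomial.funext fun z => congrFun (congrFun (h z) i) j

end Eval

/-! ### Observable pairs: eigenvectors, Bezout identity, freeness, resolvent -/

section Observable

variable {r κ : Type} [Fintype r] [Fintype κ]

theorem exists_eigenvector_mem (Z : Matrix κ κ ℂ) {S : Submodule ℂ (κ → ℂ)}
    (hS : ∀ v ∈ S, Z *ᵥ v ∈ S) (hne : S ≠ ⊥) :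
    ∃ μ : ℂ, ∃ v ∈ S, v ≠ 0 ∧ Z *ᵥ v = μ • v := by
  have : Nontrivial S := Submodule.nontrivial_iff_ne_bot.2 hne
  obtain ⟨μ, hμ⟩ := Module.End.exists_eigenvalue (Z.mulVecLin.restrict hS)
  obtain ⟨v, hv⟩ := hμ.exists_hasEigenvector
  refine ⟨μ, v, v.2, fun h => hv.2 (Subtype.ext h), ?_⟩
  exact congrArg Subtype.val hv.apply_eq_smul

/-- The pair `(Ψ, Z)` has no unobservable eigenvector. -/
def Observable (Ψ : Matrix r κ ℂ) (Z : Matrix κ κ ℂ) : Prop :=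
  ∀ (μ : ℂ) (v : κ → ℂ), Z *ᵥ v = μ • v → Ψ *ᵥ v = 0 → v = 0

variable [DecidableEq κ] {Ψ : Matrix r κ ℂ} {Z : Matrix κ κ ℂ}

/-- Let `T` be the space of constant row vectors in the lattice `N` generated by the rows of `Ψ` and
`X - Z`. It contains the rows of `Ψ`, and it is stable under `Z` because `x Z` and `X x` agree
modulo `N`. If `T` were proper, its annihilator would be a nonzero `Z`-invariant space killed by `Ψ`
and would contain an unobservable eigenvector. -/
theorem Observable.exists_bezout (h : Observable Ψ Z) :
    ∃ (P : Matrix κ r ℂ[X]) (Q : Matrix κ κ ℂ[X]),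
      P * Ψ.map Polynomial.C + Q * Z.charmatrix = 1 := by
  let ι : (κ → ℂ) →ₗ[ℂ] κ → ℂ[X] := LinearMap.compLeft (Algebra.linearMap ℂ ℂ[X]) κ
  let N : Submodule ℂ[X] (κ → ℂ[X]) :=
    LinearMap.range (Ψ.map Polynomial.C).vecMulLinear ⊔ LinearMap.range Z.charmatrix.vecMulLinear
  let T : Submodule ℂ (κ → ℂ) := (N.restrictScalars ℂ).comap ι
  have hΨT : ∀ s, Ψ s ∈ T := fun s => by
    refine Submodule.mem_sup_left ?_
    classical
    exact ⟨Pi.single s 1, by simp; rfl⟩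
  have hZT : ∀ x ∈ T, x ᵥ* Z ∈ T := by
    intro x hx
    have h1 : ι (x ᵥ* Z) = (Polynomial.X : ℂ[X]) • ι x - ι x ᵥ* Z.charmatrix := by
      rw [Matrix.charmatrix, Matrix.vecMul_sub, Matrix.scalar_apply,
        ← Matrix.smul_one_eq_diagonal, Matrix.vecMul_smul, Matrix.vecMul_one, sub_sub_cancel]
      funext j
      simp [ι, Matrix.vecMul, dotProduct]
    change ι (x ᵥ* Z) ∈ N
    rw [h1]
    exact Submodule.sub_mem _ (Submodule.smul_mem _ _ hx)
      (Submodule.mem_sup_right ⟨ι x, rfl⟩)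
  have hT : T = ⊤ := by
    by_contra hne
    obtain ⟨f, hf0, hf⟩ := Submodule.exists_le_ker_of_lt_top T (lt_top_iff_ne_top.2 hne)
    let S : Submodule ℂ (κ → ℂ) :=
      { carrier := {v | ∀ x ∈ T, x ⬝ᵥ v = 0}
        zero_mem' := by simp
        add_mem' := fun ha hb x hx => by rw [dotProduct_add, ha x hx, hb x hx, add_zero]
        smul_mem' := fun c v hv x hx => by rw [dotProduct_smul, hv x hx, smul_zero] }
    have hfv : ∀ x, f x = x ⬝ᵥ fun s => f (Pi.single s 1) := fun x => by
      conv_lhs => rw [pi_eq_sum_univ' x]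
      simp [dotProduct]
    have hS : S ≠ ⊥ := by
      intro h0
      have : (fun s => f (Pi.single s 1)) ∈ S := fun x hx => (hfv x).symm.trans (hf hx)
      rw [h0, Submodule.mem_bot] at this
      exact hf0 (LinearMap.ext fun x => by rw [hfv, this]; simp)
    obtain ⟨μ, v, hv, hv0, hμ⟩ := exists_eigenvector_mem Z (S := S)
      (fun v hv x hx => by rw [Matrix.dotProduct_mulVec]; exact hv _ (hZT x hx)) hS
    exact hv0 (h μ v hμ (funext fun s => hv _ (hΨT s)))
  have : ∀ i, ∃ (u : r → ℂ[X]) (w : κ → ℂ[X]),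
      u ᵥ* Ψ.map Polynomial.C + w ᵥ* Z.charmatrix = Pi.single i 1 := by
    intro i
    have : (Pi.single i 1 : κ → ℂ) ∈ T := by rw [hT]; trivial
    obtain ⟨_, ⟨u, rfl⟩, _, ⟨w, rfl⟩, h⟩ := Submodule.mem_sup.1 this
    refine ⟨u, w, h.trans ?_⟩
    funext j
    by_cases hij : j = i
    · subst hij; simp [ι]
    · simp [ι, hij]
  choose u w huw using this
  refine ⟨Matrix.of u, Matrix.of w, ?_⟩
  refine Matrix.ext_row fun i => ?_
  refine (huw i).trans ?_
  funext j
  simp [Matrix.one_eq_pi_single]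

/-- For an unobservable eigenvector `v` and a left eigenvector `w` with the same eigenvalue, `v wᵀ`
commutes with `Z` and is killed by `Ψ`, so `1 + c v wᵀ` is a nontrivial stabilizer. Conversely, for
a stabilizer `g`, Bezout applied to `H = g - 1` gives `H = (Q H) (X - Z)`. As `H` is constant, `Q H
= 0` and `H = 0`. -/
theorem free_iff_observable :
    (∀ g : GL κ ℂ, (g⁻¹).val * Z * g.val = Z → Ψ * g.val = Ψ → g = 1) ↔ Observable Ψ Z := by
  constructor
  · intro h μ v hv hΨ
    by_contra hv0
    have hdet : (Matrix.scalar κ μ - Z)ᵀ.det = 0 := by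
      rw [Matrix.det_transpose]
      refine Matrix.exists_mulVec_eq_zero_iff.1 ⟨v, hv0, ?_⟩
      rw [Matrix.sub_mulVec, hv, Matrix.scalar_apply, ← Matrix.smul_one_eq_diagonal,
        Matrix.smul_mulVec, Matrix.one_mulVec, sub_self]
    obtain ⟨w, hw0, hw⟩ := Matrix.exists_mulVec_eq_zero_iff.2 hdet
    rw [Matrix.mulVec_transpose, Matrix.vecMul_sub, Matrix.scalar_apply,
      ← Matrix.smul_one_eq_diagonal, Matrix.vecMul_smul, Matrix.vecMul_one, sub_eq_zero] at hw
    set H := Matrix.vecMulVec v w with hH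
    have hZH : Z * H = H * Z := by
      rw [hH, Matrix.mul_vecMulVec, Matrix.vecMulVec_mul, ← hw, hv, Matrix.smul_vecMulVec,
        Matrix.vecMulVec_smul]
    have hΨH : Ψ * H = 0 := by rw [hH, Matrix.mul_vecMulVec, hΨ, Matrix.zero_vecMulVec]
    have hHne : H ≠ 0 := by
      rw [hH]
      obtain ⟨i, hi⟩ := Function.ne_iff.1 hv0
      obtain ⟨j, hj⟩ := Function.ne_iff.1 hw0
      intro h0
      exact mul_ne_zero hi hj (congrFun (congrFun h0 i) j)
    -- The determinant of `1 + c v wᵀ` is `1 + c (w ⬝ᵥ v)`; the values `c = 1` and `c = 2` cannot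
    -- both make it vanish.
    obtain ⟨c, hc0, hc⟩ : ∃ c : ℂ, c ≠ 0 ∧ 1 + c * (w ⬝ᵥ v) ≠ 0 := by
      by_cases h1 : 1 + 1 * (w ⬝ᵥ v) = 0
      · refine ⟨2, two_ne_zero, fun h2 => ?_⟩
        have : (1 : ℂ) = 0 := by linear_combination 2 * h1 - h2
        exact one_ne_zero this
      · exact ⟨1, one_ne_zero, h1⟩
    have hu : (1 + c • H).det ≠ 0 := by
      rw [hH, ← Matrix.smul_vecMulVec, Matrix.vecMulVec_eq (Fin 1), Matrix.det_one_add_mul_comm]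
      simpa using hc
    have := h (Matrix.GeneralLinearGroup.mkOfDetNeZero _ hu) ?_ ?_
    · have h1 := congrArg Units.val this
      change 1 + c • H = 1 at h1
      rw [add_eq_left, smul_eq_zero] at h1
      exact h1.elim hc0 hHne
    · rw [Matrix.mul_assoc, Units.inv_mul_eq_iff_eq_mul]
      change Z * (1 + c • H) = (1 + c • H) * Z
      rw [mul_add, add_mul, Matrix.mul_smul, Matrix.smul_mul, hZH, mul_one, one_mul]
    · change Ψ * (1 + c • H) = Ψ
      rw [Matrix.mul_add, Matrix.mul_smul, hΨH, Matrix.mul_one, smul_zero, add_zero]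
  · intro h g hg hΨ
    rw [Matrix.mul_assoc, Units.inv_mul_eq_iff_eq_mul] at hg
    have key : g.val - 1 = 0 := by
      obtain ⟨P, Q, hPQ⟩ := h.exists_bezout
      set H : Matrix κ κ ℂ[X] := (g.val - 1).map Polynomial.C with hH
      have h1 : Z.charmatrix * H = H * Z.charmatrix := by
        refine eq_of_evalAt_eq fun z => ?_
        rw [evalAt_mul, evalAt_mul, evalAt_charmatrix, hH, evalAt_map_C]
        simp only [sub_mul, mul_sub, one_mul, mul_one, hg,
          (Matrix.scalar_commute z (fun _ => mul_comm _ _) g.val).eq]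
        abel
      have h2 : Ψ.map Polynomial.C * H = 0 := by
        refine eq_of_evalAt_eq fun z => ?_
        rw [evalAt_mul, hH, evalAt_map_C, evalAt_map_C, Matrix.mul_sub, hΨ, Matrix.mul_one,
          sub_self]
        ext; simp [evalAt]
      have h3 : H = (Q * H) * Z.charmatrix := by
        calc H = (P * Ψ.map Polynomial.C + Q * Z.charmatrix) * H := by rw [hPQ, one_mul]
          _ = _ := by rw [add_mul, Matrix.mul_assoc P, h2, Matrix.mul_zero, zero_add,
                        Matrix.mul_assoc, h1, Matrix.mul_assoc]
      have h4 : Q * H = 0 := by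
        refine eq_zero_of_mul_charmatrix (Z := Z) fun i j m => ?_
        rw [← h3, hH]
        simp only [Matrix.map_apply, Polynomial.coeff_C_succ]
      rw [h4, Matrix.zero_mul] at h3
      have h5 := congrArg (evalAt · 0) h3
      simp only [hH, evalAt_map_C] at h5
      rw [h5]; ext; simp [evalAt]
    exact Units.ext (sub_eq_zero.1 key)

theorem mul_charmatrix_left_cancel {w : Matrix κ r ℂ[X]} {B : Matrix κ r ℂ}
    (h : Z.charmatrix * w = B.map Polynomial.C) : w = 0 := by
  have h1 := congrArg Matrix.transpose h
  rw [Matrix.transpose_mul, ← Matrix.charmatrix_transpose] at h1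
  have := eq_zero_of_mul_charmatrix (w := wᵀ) (Z := Zᵀ) fun i j m => by
    rw [h1]; simp
  exact Matrix.transpose_eq_zero.1 this

theorem charmatrix_det_ne_zero (Z : Matrix κ κ ℂ) : Z.charmatrix.det ≠ 0 :=
  Z.charpoly_monic.ne_zero

theorem eq_zero_of_eval_eq_zero_of_ne {p d : ℂ[X]} (hd : d ≠ 0)
    (h : ∀ z, d.eval z ≠ 0 → p.eval z = 0) : p = 0 := by
  have : p * d = 0 := Polynomial.funext fun z => by
    by_cases hz : d.eval z = 0
    · simp [hz]
    · simp [h z hz]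
  exact (mul_eq_zero.1 this).resolve_right hd

/-- If `Ψ (z - Z)⁻¹ v` vanishes identically, Bezout turns `(z - Z)⁻¹ v` into the polynomial vector
`Q v`. Then `(X - Z) Q v = v` is constant, so `Q v = 0` and `v = 0`. In the other direction the
resolvent acts on an eigenvector as `(z - μ)⁻¹`. -/
theorem observable_iff_resolvent :
    Observable Ψ Z ↔ ∀ v : κ → ℂ, (∀ z, (Matrix.scalar κ z - Z).det ≠ 0 →
      (Ψ * (Matrix.scalar κ z - Z)⁻¹) *ᵥ v = 0) → v = 0 := by
  constructor
  · intro h v hv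
    obtain ⟨P, Q, hPQ⟩ := h.exists_bezout
    let V : Matrix κ Unit ℂ := Matrix.of fun i _ => v i
    have h1 : Z.charmatrix * (Q * V.map Polynomial.C) = V.map Polynomial.C := by
      rw [← sub_eq_zero]
      ext1 i j
      refine eq_zero_of_eval_eq_zero_of_ne (charmatrix_det_ne_zero Z) fun z hz => ?_
      rw [← evalAt_det, evalAt_charmatrix] at hz
      have h2 : evalAt (Z.charmatrix * (Q * V.map Polynomial.C)) z = V := by
        rw [evalAt_mul, evalAt_mul, evalAt_map_C, evalAt_charmatrix]
        have h3 := congrArg (evalAt · z) hPQ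
        simp only [evalAt_add, evalAt_mul, evalAt_map_C, evalAt_charmatrix, evalAt_one] at h3
        set R := Matrix.scalar κ z - Z
        have hR : R * R⁻¹ = 1 := Matrix.mul_nonsing_inv _ (isUnit_iff_ne_zero.2 hz)
        have h4 : (Ψ * R⁻¹) * V = 0 := by
          ext i j
          exact congrFun (hv z hz) i
        have h5 : evalAt Q z * V = R⁻¹ * V := by
          calc evalAt Q z * V = evalAt P z * ((Ψ * R⁻¹) * V) + evalAt Q z * (R * R⁻¹) * V := by
                rw [h4, hR]; simp
            _ = (evalAt P z * Ψ + evalAt Q z * R) * R⁻¹ * V := by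
                simp only [add_mul, Matrix.add_mul, Matrix.mul_assoc]
            _ = _ := by rw [h3, one_mul]
        rw [h5, ← Matrix.mul_assoc, hR, Matrix.one_mul]
      have h6 := congrFun (congrFun h2 i) j
      simp only [evalAt, Matrix.map_apply] at h6
      simp [h6]
    have h7 := mul_charmatrix_left_cancel h1
    rw [h7, Matrix.mul_zero] at h1
    funext i
    have := congrFun (congrFun h1 i) ()
    exact Polynomial.C_eq_zero.1 (by simpa [V, eq_comm] using this.symm)
  · intro h μ v hv hΨ
    refine h v fun z hz => ?_
    set R := Matrix.scalar κ z - Z with hRdef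
    have h1 : R *ᵥ v = (z - μ) • v := by
      rw [hRdef, Matrix.sub_mulVec, hv, Matrix.scalar_apply, ← Matrix.smul_one_eq_diagonal,
        Matrix.smul_mulVec, Matrix.one_mulVec, sub_smul]
    have hR : R⁻¹ * R = 1 := Matrix.nonsing_inv_mul _ (isUnit_iff_ne_zero.2 hz)
    have h2 : v = (z - μ) • (R⁻¹ *ᵥ v) := by
      rw [← Matrix.mulVec_smul, ← h1, Matrix.mulVec_mulVec, hR, Matrix.one_mulVec]
    have h3 : (z - μ) • ((Ψ * R⁻¹) *ᵥ v) = 0 := by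
      rw [← Matrix.mulVec_mulVec, ← Matrix.mulVec_smul, ← h2, hΨ]
    -- If `z = μ` lies outside the spectrum, the eigenvector `v` is already zero.
    rcases smul_eq_zero.1 h3 with h4 | h4
    · rw [h4, zero_smul] at h2
      rw [h2, Matrix.mulVec_zero]
    · exact h4

/-- The involution `g ↦ (g⁻¹)ᵀ` carries this action to the one on the transposed pair. -/
theorem free_iff_observable_transpose {Ψt : Matrix κ r ℂ} :
    (∀ g : GL κ ℂ, (g⁻¹).val * Z * g.val = Z → (g⁻¹).val * Ψt = Ψt → g = 1) ↔
      Observable Ψtᵀ Zᵀ := by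
  rw [← free_iff_observable]
  let τ : GL κ ℂ → GL κ ℂ := fun g =>
    ⟨((g⁻¹).val)ᵀ, g.valᵀ, by rw [← Matrix.transpose_mul, Units.mul_inv, Matrix.transpose_one],
      by rw [← Matrix.transpose_mul, Units.inv_mul, Matrix.transpose_one]⟩
  have hττ : ∀ g, τ (τ g) = g := fun g => Units.ext (by simp [τ])
  have hτ1 : ∀ g, τ g = 1 ↔ g = 1 := fun g => by
    have h1 : τ 1 = 1 := Units.ext (by simp [τ])
    exact ⟨fun h => by rw [← hττ g, h, h1], fun h => by rw [h, h1]⟩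
  have hZ : ∀ g : GL κ ℂ, ((τ g)⁻¹.val * Zᵀ * (τ g).val = Zᵀ) ↔ (g⁻¹).val * Z * g.val = Z := by
    intro g
    have : (τ g)⁻¹.val * Zᵀ * (τ g).val = ((g⁻¹).val * Z * g.val)ᵀ := by
      rw [Matrix.transpose_mul, Matrix.transpose_mul, ← Matrix.mul_assoc]; rfl
    rw [this, Matrix.transpose_inj]
  have hΨ : ∀ g : GL κ ℂ, (Ψtᵀ * (τ g).val = Ψtᵀ) ↔ (g⁻¹).val * Ψt = Ψt := by
    intro g
    have : Ψtᵀ * (τ g).val = ((g⁻¹).val * Ψt)ᵀ := by rw [Matrix.transpose_mul]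
    rw [this, Matrix.transpose_inj]
  constructor
  · intro h g h1 h2
    rw [← hττ g] at h1 h2
    exact (hτ1 g).1 (h _ ((hZ _).1 h1) ((hΨ _).1 h2))
  · intro h g h1 h2
    exact (hτ1 g).1 (h _ ((hZ _).2 h1) ((hΨ _).2 h2))

end Observable

/-! ### Realizations `D Ψ = J (X - Z)` of a single matrix -/

section Realization

variable {r κ : Type} [Fintype r] [DecidableEq r] [Fintype κ] [DecidableEq κ]

/-- The constant polynomial vector with the given coefficients. -/
noncomputable def constVec {κ : Type} (c : κ → ℂ) : κ → ℂ[X] := fun i => Polynomial.C (c i)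

omit [Fintype r] [DecidableEq r] [DecidableEq κ] in
theorem mulVec_constVec (J : Matrix r κ ℂ[X]) (c : κ → ℂ) :
    J *ᵥ constVec c = ∑ j, c j • J.col j := by
  funext s
  simp [Matrix.mulVec, dotProduct, constVec, Polynomial.smul_eq_C_mul, mul_comm]

/-- `D⁻¹ J = Ψ (z - Z)⁻¹`, where the columns of `J` are a basis of the vectors `v` with strictly
proper `D⁻¹ v`. -/
structure Realizes (D : Matrix r r ℂ[X]) (J : Matrix r κ ℂ[X]) (Ψ : Matrix r κ ℂ)
    (Z : Matrix κ κ ℂ) : Prop where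
  det_ne : D.det ≠ 0
  inj : ∀ c : κ → ℂ, J *ᵥ constVec c = 0 → c = 0
  mem_iff : ∀ v, v ∈ decaying D ↔ ∃ c, J *ᵥ constVec c = v
  eq : D * Ψ.map Polynomial.C = J * Z.charmatrix

omit [DecidableEq r] in
theorem mul_charmatrix_right_cancel {A B : Matrix r κ ℂ[X]} {Z : Matrix κ κ ℂ}
    (h : A * Z.charmatrix = B * Z.charmatrix) : A = B := by
  rw [← sub_eq_zero, ← Matrix.sub_mul] at h
  exact sub_eq_zero.1 (eq_zero_of_mul_charmatrix (Z := Z) fun i j m => by rw [h]; simp)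

omit [Fintype κ] [DecidableEq κ] in
theorem mul_right_cancel_of_det_ne_zero {D : Matrix r r ℂ[X]} (hD : D.det ≠ 0)
    {A B : Matrix κ r ℂ[X]} (h : A * D = B * D) : A = B := by
  have := congrArg (· * D.adjugate) h
  simp only [Matrix.mul_assoc, Matrix.mul_adjugate, Matrix.mul_smul, Matrix.mul_one] at this
  ext1 i j
  exact mul_left_cancel₀ hD (congrFun (congrFun this i) j)

/-- Division by `X - Z` with constant remainder: vectors of this form are closed under
multiplication by `X`, because `X c = (X - Z) c + Z c`. -/
theorem exists_eq_charmatrix_mulVec_add (Z : Matrix κ κ ℂ) (x : κ → ℂ[X]) :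
    ∃ w c, x = Z.charmatrix *ᵥ w + constVec c := by
  let T : Submodule ℂ (κ → ℂ[X]) :=
    { carrier := {x | ∃ w c, x = Z.charmatrix *ᵥ w + constVec c}
      zero_mem' := ⟨0, 0, by funext i; simp [constVec]⟩
      add_mem' := by
        rintro _ _ ⟨w, c, rfl⟩ ⟨w', c', rfl⟩
        refine ⟨w + w', c + c', ?_⟩
        have : constVec (c + c') = constVec c + constVec c' := by funext i; simp [constVec]
        rw [this, Matrix.mulVec_add]; abel
      smul_mem' := by
        rintro a _ ⟨w, c, rfl⟩
        refine ⟨a • w, a • c, ?_⟩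
        have : constVec (a • c) = a • constVec c := by
          funext i; simp [constVec, Polynomial.smul_eq_C_mul]
        rw [this, Matrix.mulVec_smul Z.charmatrix a w, smul_add] }
  have hX : ∀ x ∈ T, (Polynomial.X : ℂ[X]) • x ∈ T := by
    rintro _ ⟨w, c, rfl⟩
    refine ⟨(Polynomial.X : ℂ[X]) • w + constVec c, Z *ᵥ c, ?_⟩
    have h1 : Z.charmatrix *ᵥ constVec c = (Polynomial.X : ℂ[X]) • constVec c -
        constVec (Z *ᵥ c) := by
      rw [Matrix.charmatrix, Matrix.sub_mulVec, Matrix.scalar_apply,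
        ← Matrix.smul_one_eq_diagonal, Matrix.smul_mulVec, Matrix.one_mulVec]
      congr 1
      funext i
      simp [constVec, Matrix.mulVec, dotProduct]
    rw [Matrix.mulVec_add, h1, smul_add, Matrix.mulVec_smul]
    abel
  have hsingle : ∀ i (p : ℂ[X]), (Pi.single i p : κ → ℂ[X]) ∈ T := by
    intro i p
    induction p using Polynomial.induction_on' with
    | add p q hp hq => rw [Pi.single_add]; exact T.add_mem hp hq
    | monomial m a =>
      induction m with
      | zero =>
        refine ⟨0, Pi.single i a, ?_⟩
        funext j
        by_cases hij : j = i
        · subst hij; simp [constVec]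
        · simp [constVec, hij]
      | succ m ih =>
        convert hX _ ih using 1
        rw [← Pi.single_smul, smul_eq_mul, Polynomial.X_mul_monomial]
  change x ∈ T
  rw [← Finset.univ_sum_single x]
  exact T.sum_mem fun i _ => hsingle i _

namespace Realizes

variable {D D' : Matrix r r ℂ[X]} {J J' : Matrix r κ ℂ[X]} {Ψ : Matrix r κ ℂ} {Z : Matrix κ κ ℂ}

/-- For an eigenvector `v` one has `D Ψ v = (X - μ) J v`. If `Ψ v = 0` then `J v = 0`, and the
columns of `J` are independent. -/
theorem observable (h : Realizes D J Ψ Z) : Observable Ψ Z := by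
  intro μ v hv hΨ
  have h1 := congrArg (· *ᵥ constVec v) h.eq
  have h2 : Ψ.map Polynomial.C *ᵥ constVec v = 0 := by
    funext i
    simpa [constVec, Matrix.mulVec, dotProduct] using
      congrArg (Polynomial.C : ℂ → ℂ[X]) (congrFun hΨ i)
  have h3 : Z.charmatrix *ᵥ constVec v = (Polynomial.X - Polynomial.C μ) • constVec v := by
    rw [Matrix.charmatrix, Matrix.sub_mulVec, Matrix.scalar_apply, ← Matrix.smul_one_eq_diagonal,
      Matrix.smul_mulVec, Matrix.one_mulVec, sub_smul]
    congr 1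
    funext i
    simpa [constVec, Matrix.mulVec, dotProduct] using
      congrArg (Polynomial.C : ℂ → ℂ[X]) (congrFun hv i)
  simp only [← Matrix.mulVec_mulVec, h2, h3, Matrix.mulVec_zero, Matrix.mulVec_smul] at h1
  exact h.inj v ((smul_eq_zero.1 h1.symm).resolve_left (Polynomial.X_sub_C_ne_zero μ))

theorem eq_zero_of_mulVec_eq (h : Realizes D J Ψ Z) {c : κ → ℂ} {w : r → ℂ[X]}
    (hcw : J *ᵥ constVec c = D *ᵥ w) : c = 0 := by
  have h1 : D *ᵥ w ∈ decaying D := (h.mem_iff _).2 ⟨c, hcw⟩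
  refine h.inj c ?_
  rw [hcw, eq_zero_of_mulVec_mem_decaying h.det_ne h1, Matrix.mulVec_zero]

/-- Left coprimeness of `D` and `J`: every standard basis vector splits into an element of the image
of `D` and a decaying one, and the latter is a constant combination of the columns of `J`. -/
theorem exists_bezout (h : Realizes D J Ψ Z) :
    ∃ (A : Matrix r r ℂ[X]) (B : Matrix κ r ℂ), D * A + J * B.map Polynomial.C = 1 := by
  have : ∀ s, ∃ w c, D *ᵥ w + J *ᵥ constVec c = Pi.single s 1 := fun s => by
    obtain ⟨w, hw⟩ := exists_sub_mulVec_mem_decaying h.det_ne (Pi.single s 1)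
    obtain ⟨c, hc⟩ := (h.mem_iff _).1 hw
    exact ⟨w, c, by rw [hc]; abel⟩
  choose w c hwc using this
  refine ⟨Matrix.of fun i s => w s i, Matrix.of fun j s => c s j, ?_⟩
  ext1 i s
  refine (congrFun (hwc s) i).trans ?_
  simp [Matrix.one_apply, Pi.single_apply]

/-- Reduce `x` to a constant modulo `X - Z`. Since `J (X - Z) = D Ψ`, the image under `J` of this
constant is decaying and also lies in the image of `D`, so the constant is zero. Thus `J` induces an
injection from the cokernel of `X - Z` to that of `D`. -/
theorem exists_eq_charmatrix_mulVec (h : Realizes D J Ψ Z) {x : κ → ℂ[X]} {y : r → ℂ[X]}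
    (hxy : J *ᵥ x = D *ᵥ y) : ∃ w, x = Z.charmatrix *ᵥ w := by
  obtain ⟨w, c, rfl⟩ := exists_eq_charmatrix_mulVec_add Z x
  refine ⟨w, ?_⟩
  rw [Matrix.mulVec_add, Matrix.mulVec_mulVec, ← h.eq, ← Matrix.mulVec_mulVec] at hxy
  have := h.eq_zero_of_mulVec_eq (c := c) (w := y - Ψ.map Polynomial.C *ᵥ w)
    (by rw [Matrix.mulVec_sub, ← hxy]; abel)
  rw [this]
  funext i
  simp [constVec]

theorem exists_eq_charmatrix_mul {s : Type} (h : Realizes D J Ψ Z) {x : Matrix κ s ℂ[X]}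
    {y : Matrix r s ℂ[X]} (hxy : J * x = D * y) : ∃ w : Matrix κ s ℂ[X], x = Z.charmatrix * w := by
  choose w hw using fun j => h.exists_eq_charmatrix_mulVec (x := x.col j) (y := y.col j)
    (congrArg (Matrix.col · j) hxy)
  exact ⟨Matrix.of fun i j => w j i, by ext1 i j; exact congrFun (hw j) i⟩

theorem vecMul_evalAt_charmatrix (h : Realizes D J Ψ Z) {z : ℂ} {u : r → ℂ}
    (hu : u ᵥ* evalAt D z = 0) : (u ᵥ* evalAt J z) ᵥ* (Matrix.scalar κ z - Z) = 0 := by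
  rw [← evalAt_charmatrix, Matrix.vecMul_vecMul, ← evalAt_mul, ← h.eq, evalAt_mul,
    ← Matrix.vecMul_vecMul, hu, Matrix.zero_vecMul]

theorem eq_zero_of_vecMul_evalAt (h : Realizes D J Ψ Z) {z : ℂ} {u : r → ℂ}
    (hu : u ᵥ* evalAt D z = 0) (hJ : u ᵥ* evalAt J z = 0) : u = 0 := by
  obtain ⟨A, B, hAB⟩ := h.exists_bezout
  have := congrArg (fun M => u ᵥ* evalAt M z) hAB
  simp only [evalAt_add, evalAt_mul, Matrix.vecMul_add, ← Matrix.vecMul_vecMul, hu, hJ,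
    Matrix.zero_vecMul, evalAt_one, Matrix.vecMul_one, add_zero] at this
  exact this.symm

/-- The preimage is `v B`, with `B` from `D A + J B = 1`. The matrices `B D` and `B J - 1` are sent
by `J` into the image of `D`, hence are left multiples of `X - Z`, and `v` kills these at `z`. So `u
↦ u J(z)` maps the left kernel of `D(z)` onto that of `z - Z`. -/
theorem exists_vecMul_evalAt (h : Realizes D J Ψ Z) {z : ℂ} {v : κ → ℂ}
    (hv : v ᵥ* (Matrix.scalar κ z - Z) = 0) :
    ∃ u : r → ℂ, u ᵥ* evalAt D z = 0 ∧ u ᵥ* evalAt J z = v := by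
  obtain ⟨A, B, hAB⟩ := h.exists_bezout
  have hJB : J * B.map Polynomial.C = 1 - D * A := by rw [← hAB]; abel
  obtain ⟨E, hE⟩ := h.exists_eq_charmatrix_mul (x := B.map Polynomial.C * D) (y := 1 - A * D) (by
    rw [← Matrix.mul_assoc, hJB, Matrix.sub_mul, Matrix.mul_sub, Matrix.one_mul, Matrix.mul_one,
      Matrix.mul_assoc])
  obtain ⟨F, hF⟩ := h.exists_eq_charmatrix_mul (x := B.map Polynomial.C * J - 1)
    (y := - (A * J)) (by
      rw [Matrix.mul_sub, ← Matrix.mul_assoc, hJB, Matrix.sub_mul, Matrix.one_mul, Matrix.mul_one,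
        Matrix.mul_assoc, Matrix.mul_neg]; abel)
  refine ⟨v ᵥ* B, ?_, ?_⟩
  · have := congrArg (fun M => v ᵥ* evalAt M z) hE
    simp only [evalAt_mul, evalAt_charmatrix, ← Matrix.vecMul_vecMul, hv, Matrix.zero_vecMul,
      evalAt_map_C] at this
    exact this
  · have := congrArg (fun M => v ᵥ* evalAt M z) (sub_eq_iff_eq_add.1 hF)
    simpa only [evalAt_mul, evalAt_add, evalAt_one, evalAt_charmatrix, ← Matrix.vecMul_vecMul, hv,
      Matrix.zero_vecMul, evalAt_map_C, Matrix.vecMul_add, Matrix.vecMul_one, zero_add] using this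

theorem det_evalAt_ne_zero_iff (h : Realizes D J Ψ Z) (z : ℂ) :
    (evalAt D z).det ≠ 0 ↔ (Matrix.scalar κ z - Z).det ≠ 0 := by
  rw [not_iff_not, ← Matrix.exists_vecMul_eq_zero_iff, ← Matrix.exists_vecMul_eq_zero_iff]
  constructor
  · rintro ⟨u, hu0, hu⟩
    exact ⟨_, fun h0 => hu0 (h.eq_zero_of_vecMul_evalAt hu h0), h.vecMul_evalAt_charmatrix hu⟩
  · rintro ⟨v, hv0, hv⟩
    obtain ⟨u, hu, huv⟩ := h.exists_vecMul_evalAt hv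
    refine ⟨u, ?_, hu⟩
    rintro rfl
    exact hv0 (by rw [← huv, Matrix.zero_vecMul])

theorem finrank_eq (h : Realizes D J Ψ Z) : D.det.natDegree = Fintype.card κ := by
  rw [← (finrank_decaying h.det_ne).2, ← Module.finrank_fintype_fun_eq_card ℂ]
  let f : (κ → ℂ) →ₗ[ℂ] decaying D :=
    { toFun := fun c => ⟨J *ᵥ constVec c, (h.mem_iff _).2 ⟨c, rfl⟩⟩
      map_add' := fun a b => Subtype.ext (by
        simp only [mulVec_constVec, Pi.add_apply, add_smul, Finset.sum_add_distrib]; rfl)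
      map_smul' := fun a b => Subtype.ext (by
        simp only [mulVec_constVec, Pi.smul_apply, smul_eq_mul, mul_smul]
        rw [← Finset.smul_sum]; rfl) }
  refine (LinearEquiv.finrank_eq (LinearEquiv.ofBijective f ⟨?_, ?_⟩)).symm
  · rw [← LinearMap.ker_eq_bot, LinearMap.ker_eq_bot']
    exact fun c hc => h.inj c (congrArg Subtype.val hc)
  · rintro ⟨v, hv⟩
    obtain ⟨c, hc⟩ := (h.mem_iff v).1 hv
    exact ⟨c, Subtype.ext hc⟩

/-- Multiplication by a unimodular matrix. -/
theorem unit_mul (h : Realizes D J Ψ Z) (V : (Matrix r r ℂ[X])ˣ) :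
    Realizes (V.val * D) (V.val * J) Ψ Z := by
  have hdet : (V.val * D).det = V.val.det * D.det := Matrix.det_mul _ _
  have hV : IsUnit V.val.det := (Matrix.isUnit_iff_isUnit_det _).1 V.isUnit
  obtain ⟨a, ha, haV⟩ := Polynomial.isUnit_iff.1 hV
  have hdeg : (V.val * D).det.natDegree = D.det.natDegree := by
    rw [hdet, ← haV, Polynomial.natDegree_C_mul ha.ne_zero]
  have hmem : ∀ v, V.val *ᵥ v ∈ decaying (V.val * D) ↔ v ∈ decaying D := by
    intro v
    have : (V.val * D).adjugate *ᵥ (V.val *ᵥ v) = Polynomial.C a • (D.adjugate *ᵥ v) := by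
      rw [Matrix.adjugate_mul_distrib, ← Matrix.mulVec_mulVec, Matrix.mulVec_mulVec v,
        Matrix.adjugate_mul, Matrix.smul_mulVec, Matrix.one_mulVec, Matrix.mulVec_smul, haV]
    simp only [decaying, mem_adjBounded, this, hdeg, Pi.smul_apply, smul_eq_mul,
      Polynomial.coeff_C_mul, mul_eq_zero, ha.ne_zero, false_or]
  have hVi : ∀ v, V.val *ᵥ ((V⁻¹).val *ᵥ v) = v := fun v => by
    rw [Matrix.mulVec_mulVec, Units.mul_inv, Matrix.one_mulVec]
  have hiV : ∀ v, (V⁻¹).val *ᵥ (V.val *ᵥ v) = v := fun v => by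
    rw [Matrix.mulVec_mulVec, Units.inv_mul, Matrix.one_mulVec]
  refine ⟨hdet ▸ mul_ne_zero hV.ne_zero h.det_ne, fun c hc => h.inj c ?_, fun v => ?_, ?_⟩
  · rw [← hiV (J *ᵥ constVec c), Matrix.mulVec_mulVec (constVec c), hc, Matrix.mulVec_zero]
  · rw [← hVi v, hmem, h.mem_iff]
    refine exists_congr fun c => ?_
    rw [← Matrix.mulVec_mulVec]
    exact ⟨fun h => by rw [h], fun h => by rw [← hiV (J *ᵥ constVec c), h, hiV]⟩
  · rw [Matrix.mul_assoc, h.eq, Matrix.mul_assoc]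

end Realizes

/-- The rows of `D` generate the lattice of all `u` for which `u Ψ` lies in the row lattice of `X -
Z`, and `J` collects the quotients. Bezout makes `f` surjective, so `deg det D` is the size of `Z`,
and counting dimensions shows that the columns of `J` fill `decaying D`. The last clause is the
universal property of this lattice; uniqueness of the realization and the existence of the `q_i`
both rest on it. -/
theorem Observable.exists_realizes {Ψ : Matrix r κ ℂ} {Z : Matrix κ κ ℂ} (h : Observable Ψ Z) :
    ∃ (D : Matrix r r ℂ[X]) (J : Matrix r κ ℂ[X]), Realizes D J Ψ Z ∧
      ∀ {s : Type} [Fintype s] (A : Matrix s r ℂ[X]) (B : Matrix s κ ℂ[X]),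
        A * Ψ.map Polynomial.C = B * Z.charmatrix → ∃ U : Matrix s r ℂ[X], A = U * D ∧ B = U * J := by
  obtain ⟨P, Q, hPQ⟩ := h.exists_bezout
  set M := LinearMap.range Z.charmatrix.vecMulLinear with hM
  obtain ⟨hfin, hrank⟩ := finrank_quotient_range_vecMulLinear (charmatrix_det_ne_zero Z)
  rw [← hM] at hfin hrank
  set f : (r → ℂ[X]) →ₗ[ℂ[X]] (κ → ℂ[X]) ⧸ M := M.mkQ.comp (Ψ.map Polynomial.C).vecMulLinear
    with hf
  have hker : ∀ u, u ∈ LinearMap.ker f ↔ ∃ w, w ᵥ* Z.charmatrix = u ᵥ* Ψ.map Polynomial.C := by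
    intro u
    rw [LinearMap.mem_ker]
    exact Submodule.Quotient.mk_eq_zero M
  have hsurj : Function.Surjective f := by
    intro y
    obtain ⟨x, rfl⟩ := M.mkQ_surjective y
    refine ⟨x ᵥ* P, (Submodule.Quotient.eq M).2 ⟨- (x ᵥ* Q), ?_⟩⟩
    have := congrArg (x ᵥ* ·) hPQ
    simp only [Matrix.vecMul_add, ← Matrix.vecMul_vecMul, Matrix.vecMul_one] at this
    simp only [Matrix.vecMulLinear_apply, Matrix.neg_vecMul]
    nth_rw 3 [← this]
    abel
  obtain ⟨D, hD, hDN⟩ := exists_range_vecMulLinear_eq (N := LinearMap.ker f)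
    (charmatrix_det_ne_zero Z) (fun v => by
      rw [LinearMap.mem_ker, map_smul]
      obtain ⟨x, hx⟩ := M.mkQ_surjective (f v)
      rw [← hx, ← map_smul]
      exact (Submodule.Quotient.mk_eq_zero M).2 (smul_det_mem_range_vecMulLinear _ _))
  have hdeg : D.det.natDegree = Fintype.card κ := by
    have h1 := (finrank_quotient_range_vecMulLinear hD).2
    rw [hDN] at h1
    rw [← h1, ((f.quotKerEquivOfSurjective hsurj).restrictScalars ℂ).finrank_eq, hrank]
    exact Z.charpoly_natDegree_eq_dim
  have hrow : ∀ i, ∃ w, w ᵥ* Z.charmatrix = D i ᵥ* Ψ.map Polynomial.C := fun i =>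
    (hker _).1 (hDN ▸ ⟨Pi.single i 1, by simp; rfl⟩)
  choose J hJ using hrow
  have hDJ : D * Ψ.map Polynomial.C = Matrix.of J * Z.charmatrix :=
    Matrix.ext_row fun i => (hJ i).symm
  -- Suppose `J c = 0` and put `y = adj(X - Z) c`. Then `D Ψ y = χ J c = 0`, so `Ψ y = 0`, and
  -- Bezout gives `y = χ Q c`. Hence `(X - Z) Q c = c`, which degrees allow only for `c = 0`.
  have hinj : ∀ c : κ → ℂ, Matrix.of J *ᵥ constVec c = 0 → c = 0 := by
    intro c hc
    set χ := Z.charmatrix.det with hχ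
    set y := Z.charmatrix.adjugate *ᵥ constVec c with hy
    have h1 : Z.charmatrix *ᵥ y = χ • constVec c := by
      rw [hy, Matrix.mulVec_mulVec, Matrix.mul_adjugate, Matrix.smul_mulVec, Matrix.one_mulVec]
    have h2 : D *ᵥ (Ψ.map Polynomial.C *ᵥ y) = 0 := by
      rw [Matrix.mulVec_mulVec, hDJ, ← Matrix.mulVec_mulVec, h1, Matrix.mulVec_smul, hc, smul_zero]
    have h3 : Ψ.map Polynomial.C *ᵥ y = 0 := by
      by_contra h0
      exact hD (Matrix.exists_mulVec_eq_zero_iff.1 ⟨_, h0, h2⟩)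
    have h4 : y = χ • (Q *ᵥ constVec c) := by
      have := congrArg (· *ᵥ y) hPQ
      simp only [Matrix.add_mulVec, ← Matrix.mulVec_mulVec, h3, h1, Matrix.mulVec_zero, zero_add,
        Matrix.one_mulVec, Matrix.mulVec_smul] at this
      exact this.symm
    rw [h4, Matrix.mulVec_smul] at h1
    have h5 : Z.charmatrix *ᵥ (Q *ᵥ constVec c) = constVec c :=
      smul_right_injective _ (charmatrix_det_ne_zero Z) h1
    have h6 := mul_charmatrix_left_cancel (Z := Z)
      (w := Matrix.of fun i (_ : Unit) => (Q *ᵥ constVec c) i)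
      (B := Matrix.of fun i (_ : Unit) => c i) (by ext1 i j; exact congrFun h5 i)
    have h7 : Q *ᵥ constVec c = 0 := funext fun i => congrFun (congrFun h6 i) ()
    rw [h7, Matrix.mulVec_zero] at h5
    exact funext fun i => Polynomial.C_eq_zero.1 (congrFun h5 i).symm
  refine ⟨D, Matrix.of J, ⟨hD, hinj, fun v => ?_, hDJ⟩, ?_⟩
  · have hcol := col_mem_decaying_of_mul_charmatrix hD (P := 0) (Ψ := Ψ) (Z := Z)
      (Y := Matrix.of J) (fun c => by exact zero_mem _) (by rw [add_zero]; exact hDJ)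
    have hmem : ∀ c, Matrix.of J *ᵥ constVec c ∈ decaying D := fun c => by
      rw [mulVec_constVec]
      exact Submodule.sum_mem _ fun j _ => Submodule.smul_mem _ _ (hcol j)
    let g : (κ → ℂ) →ₗ[ℂ] decaying D :=
      { toFun := fun c => ⟨Matrix.of J *ᵥ constVec c, hmem c⟩
        map_add' := fun a b => Subtype.ext (by
          simp only [mulVec_constVec, Pi.add_apply, add_smul, Finset.sum_add_distrib]; rfl)
        map_smul' := fun a b => Subtype.ext (by
          simp only [mulVec_constVec, Pi.smul_apply, smul_eq_mul, mul_smul]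
          rw [← Finset.smul_sum]; rfl) }
    have := (finrank_decaying hD).1
    have hg : Function.Surjective g := by
      refine (LinearMap.injective_iff_surjective_of_finrank_eq_finrank ?_).1 ?_
      · rw [(finrank_decaying hD).2, hdeg, Module.finrank_fintype_fun_eq_card]
      · rw [← LinearMap.ker_eq_bot, LinearMap.ker_eq_bot']
        exact fun c hc => hinj c (congrArg Subtype.val hc)
    constructor
    · intro hv
      obtain ⟨c, hc⟩ := hg ⟨v, hv⟩
      exact ⟨c, congrArg Subtype.val hc⟩
    · rintro ⟨c, rfl⟩
      exact hmem c
  · intro s _ A B hAB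
    have : ∀ i, ∃ u, u ᵥ* D = A i := fun i => by
      have : A i ∈ LinearMap.ker f := (hker _).2 ⟨B i, (congrFun hAB i).symm⟩
      rw [← hDN] at this
      exact this
    choose U hU using this
    have hUD : A = Matrix.of U * D := Matrix.ext_row fun i => (hU i).symm
    refine ⟨Matrix.of U, hUD, ?_⟩
    refine mul_charmatrix_right_cancel (Z := Z) ?_
    rw [Matrix.mul_assoc, ← hDJ, ← hAB, hUD, Matrix.mul_assoc]

/-- Both realizations are left multiples of the universal one. All three determinants have the same
degree, so the multipliers have constant determinant and are invertible. -/
theorem Realizes.exists_unit {D D' : Matrix r r ℂ[X]} {J J' : Matrix r κ ℂ[X]} {Ψ : Matrix r κ ℂ}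
    {Z : Matrix κ κ ℂ} (h : Realizes D J Ψ Z) (h' : Realizes D' J' Ψ Z) :
    ∃ V : (Matrix r r ℂ[X])ˣ, D' = V.val * D ∧ J' = V.val * J := by
  obtain ⟨D₀, J₀, h₀, huniv⟩ := h.observable.exists_realizes
  have key : ∀ {D J}, Realizes D J Ψ Z →
      ∃ V : (Matrix r r ℂ[X])ˣ, D = V.val * D₀ ∧ J = V.val * J₀ := by
    intro D J h
    obtain ⟨U, hU, hU'⟩ := huniv D J h.eq
    have hdet := congrArg Matrix.det hU
    rw [Matrix.det_mul] at hdet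
    have hU0 : U.det ≠ 0 := fun h0 => h.det_ne (by rw [hdet, h0, zero_mul])
    have hdeg := congrArg Polynomial.natDegree hdet
    rw [Polynomial.natDegree_mul hU0 h₀.det_ne, h.finrank_eq, h₀.finrank_eq] at hdeg
    have hunit : IsUnit U.det :=
      Polynomial.isUnit_iff_degree_eq_zero.2
        (by rw [Polynomial.degree_eq_natDegree hU0, show U.det.natDegree = 0 by omega]; rfl)
    obtain ⟨V, rfl⟩ := (Matrix.isUnit_iff_isUnit_det U).2 hunit
    exact ⟨V, hU, hU'⟩
  obtain ⟨V, hV, hV'⟩ := key h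
  obtain ⟨V', hV1, hV1'⟩ := key h'
  refine ⟨V' * V⁻¹, ?_, ?_⟩
  · rw [hV1, hV, Units.val_mul, ← Matrix.mul_assoc, Matrix.mul_assoc V'.val, Units.inv_mul,
      Matrix.mul_one]
  · rw [hV1', hV', Units.val_mul, ← Matrix.mul_assoc, Matrix.mul_assoc V'.val, Units.inv_mul,
      Matrix.mul_one]

/-- `Z` is multiplication by `X` on `decaying D`, projected along the image of `D`. The discarded
part is `D` times a constant vector, which supplies a column of `Ψ`. -/
theorem exists_realizes_of_natDegree {D : Matrix r r ℂ[X]} (hD : D.det ≠ 0) {k : ℕ}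
    (hk : D.det.natDegree = k) :
    ∃ (J : Matrix r (Fin k) ℂ[X]) (Ψ : Matrix r (Fin k) ℂ) (Z : Matrix (Fin k) (Fin k) ℂ),
      Realizes D J Ψ Z := by
  obtain ⟨hfin, hrank⟩ := finrank_decaying hD
  let b := Module.finBasisOfFinrankEq ℂ (decaying D) (hrank.trans hk)
  set J : Matrix r (Fin k) ℂ[X] := Matrix.of fun s j => (b j : r → ℂ[X]) s with hJ
  have hsum : ∀ c, J *ᵥ constVec c = (∑ j, c j • b j : decaying D) := fun c => by
    rw [mulVec_constVec, AddSubmonoidClass.coe_finsetSum]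
    rfl
  have hmem : ∀ v, v ∈ decaying D ↔ ∃ c, J *ᵥ constVec c = v := by
    intro v
    constructor
    · intro hv
      refine ⟨b.repr ⟨v, hv⟩, ?_⟩
      rw [hsum, b.sum_repr]
    · rintro ⟨c, rfl⟩
      rw [hsum]
      exact Subtype.property _
  have hcol : ∀ j, J.col j ∈ decaying D := fun j => (b j).2
  have hstep : ∀ j, ∃ (w : r → ℂ) (c : Fin k → ℂ),
      (Polynomial.X : ℂ[X]) • J.col j = D *ᵥ constVec w + J *ᵥ constVec c := by
    intro j
    obtain ⟨w, hw⟩ := exists_sub_mulVec_mem_decaying hD ((Polynomial.X : ℂ[X]) • J.col j)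
    obtain ⟨c, hc⟩ := (hmem _).1 hw
    have h1 : D *ᵥ w = (Polynomial.X : ℂ[X]) • J.col j - J *ᵥ constVec c := by rw [hc]; abel
    have h2 : D *ᵥ w ∈ adjBounded D (D.det.natDegree + 1) := by
      rw [h1]
      exact Submodule.sub_mem _ (X_smul_mem_adjBounded (hcol j))
        (adjBounded_mono (Nat.le_succ _) ((hmem _).2 ⟨c, rfl⟩))
    refine ⟨fun s => (w s).coeff 0, c, ?_⟩
    have h3 : constVec (fun s => (w s).coeff 0) = w :=
      funext fun s => (exists_eq_C_of_mulVec_mem hD h2 s).symm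
    rw [h3, h1]
    abel
  choose w c hwc using hstep
  refine ⟨J, Matrix.of fun s j => w j s, Matrix.of fun i j => c j i, hD, fun x hx => ?_, hmem, ?_⟩
  · rw [hsum] at hx
    have := Fintype.linearIndependent_iff.1 b.linearIndependent x (Subtype.ext hx)
    exact funext this
  · ext1 s j
    have := congrFun (hwc j) s
    rw [Matrix.charmatrix, Matrix.mul_sub, Matrix.sub_apply, eq_sub_iff_add_eq,
      Matrix.scalar_apply, ← Matrix.smul_one_eq_diagonal, Matrix.mul_smul, Matrix.mul_one]
    exact this.symm

end Realization

/-! ### Splitting indices at a node -/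

section Index

variable {L : ℕ} {n : Fin (L + 1) → ℕ}

/-- Transport of indices along an equality of labels. -/
def colorCast {a b : Fin (L + 1)} (h : a = b) : ColorIdx n a → ColorIdx n b :=
  fun t => ⟨t.val, h ▸ t.property⟩

/-- Inclusion of the indices of a node into those of a later one. -/
def colorUp {a b : Fin (L + 1)} (h : a ≤ b) : ColorIdx n a → ColorIdx n b :=
  fun t => ⟨t.val, t.property.trans h⟩

/-- The indices in the last block of a node. -/
def colorTop (a : Fin (L + 1)) : Fin (n a) → ColorIdx n a := fun s => ⟨⟨a, s⟩, le_rfl⟩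

/-- Inclusion of the complementary indices of a node into those of an earlier one. -/
def coUp {a b : Fin (L + 1)} (h : a ≤ b) : ColorCoIdx n b → ColorCoIdx n a :=
  fun t => ⟨t.val, h.trans_lt t.property⟩

/-- The complementary indices in the block `b`. -/
def coBlock {a : Fin (L + 1)} (b : Fin (L + 1)) (h : a < b) : Fin (n b) → ColorCoIdx n a :=
  fun s => ⟨⟨b, s⟩, h⟩

theorem castSucc_lt_castSucc_of_succ_eq {i j : Fin L} (h : i.succ = j.castSucc) :
    i.castSucc < j.castSucc := h ▸ i.castSucc_lt_succ

theorem colorIdx_cases {i j : Fin L} (h : i.succ = j.castSucc) (t : ColorIdx n j.castSucc) :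
    (∃ t', t = colorUp (castSucc_lt_castSucc_of_succ_eq h).le t') ∨ ∃ s, t = colorTop _ s := by
  obtain ⟨⟨a, s⟩, ha⟩ := t
  rcases lt_or_eq_of_le ha with hlt | heq
  · exact Or.inl ⟨⟨⟨a, s⟩, by rw [← h] at hlt; exact Fin.le_castSucc_iff.2 hlt⟩, rfl⟩
  · right
    change a = j.castSucc at heq
    subst heq
    exact ⟨s, rfl⟩

theorem colorCoIdx_cases {i j : Fin L} (h : i.succ = j.castSucc) (t : ColorCoIdx n i.castSucc) :
    (∃ t', t = coUp (castSucc_lt_castSucc_of_succ_eq h).le t') ∨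
      ∃ s, t = coBlock _ (castSucc_lt_castSucc_of_succ_eq h) s := by
  obtain ⟨⟨a, s⟩, ha⟩ := t
  have ha' : j.castSucc ≤ a := by rw [← h]; exact Fin.castSucc_lt_iff_succ_le.1 ha
  rcases lt_or_eq_of_le ha' with hlt | heq
  · exact Or.inl ⟨⟨⟨a, s⟩, hlt⟩, rfl⟩
  · right
    subst heq
    exact ⟨s, rfl⟩

theorem sum_colorIdx {R : Type*} [AddCommMonoid R] {i j : Fin L} (h : i.succ = j.castSucc)
    (f : ColorIdx n j.castSucc → R) :
    ∑ t, f t = ∑ t, f (colorUp (castSucc_lt_castSucc_of_succ_eq h).le t) +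
      ∑ s, f (colorTop _ s) := by
  let g : ColorIdx n i.castSucc ⊕ Fin (n j.castSucc) → ColorIdx n j.castSucc :=
    Sum.elim (colorUp (castSucc_lt_castSucc_of_succ_eq h).le) (colorTop _)
  have hlt := castSucc_lt_castSucc_of_succ_eq h
  have hg : Function.Bijective g := by
    constructor
    · rintro (⟨⟨a, s⟩, ha⟩ | s) (⟨⟨b, t⟩, hb⟩ | t) hst
      · simpa [g, colorUp] using hst
      · simp only [g, Sum.elim_inl, Sum.elim_inr, colorUp, colorTop, Subtype.mk.injEq,
          Sigma.mk.injEq] at hst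
        have h1 : a ≤ i.castSucc := ha
        exact absurd (hst.1 ▸ h1) (not_le.2 hlt)
      · simp only [g, Sum.elim_inl, Sum.elim_inr, colorUp, colorTop, Subtype.mk.injEq,
          Sigma.mk.injEq] at hst
        have h1 : b ≤ i.castSucc := hb
        exact absurd (hst.1 ▸ h1) (not_le.2 hlt)
      · simpa [g, colorTop] using hst
    · intro t
      rcases colorIdx_cases h t with ⟨t', rfl⟩ | ⟨s, rfl⟩
      · exact ⟨Sum.inl t', rfl⟩
      · exact ⟨Sum.inr s, rfl⟩
  rw [← (Equiv.ofBijective g hg).sum_comp, Fintype.sum_sum_type]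
  rfl

theorem sum_flavorIdx {R : Type*} [AddCommMonoid R] (a : Fin (L + 1)) (f : FlavorIdx n → R) :
    ∑ t, f t = ∑ t : ColorIdx n a, f t.val + ∑ t : ColorCoIdx n a, f t.val := by
  rw [← Fintype.sum_subtype_add_sum_subtype (fun t : FlavorIdx n => t.1 ≤ a) f]
  congr 1
  exact Fintype.sum_equiv (Equiv.subtypeEquivRight fun t => not_le) _ _ fun _ => rfl

theorem mul_eq_colorUp_add_colorTop {R : Type*} [Semiring R] {r c : Type} {i j : Fin L}
    (h : i.succ = j.castSucc)
    (A : Matrix r (ColorIdx n j.castSucc) R) (B : Matrix (ColorIdx n j.castSucc) c R) :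
    A * B = A.submatrix id (colorUp (castSucc_lt_castSucc_of_succ_eq h).le) *
        B.submatrix (colorUp (castSucc_lt_castSucc_of_succ_eq h).le) id +
      A.submatrix id (colorTop _) * B.submatrix (colorTop _) id := by
  ext s t
  simp only [Matrix.mul_apply, Matrix.add_apply, sum_colorIdx h]
  rfl

/-- The matrix with the given columns before and after the node `a`. -/
def joinCols {R r : Type*} {a : Fin (L + 1)} (A : Matrix r (ColorIdx n a) R)
    (B : Matrix r (ColorCoIdx n a) R) : Matrix r (FlavorIdx n) R :=
  Matrix.of fun s t => if h : t.1 ≤ a then A s ⟨t, h⟩ else B s ⟨t, not_le.1 h⟩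

theorem joinCols_color {R r : Type*} {a : Fin (L + 1)} (A : Matrix r (ColorIdx n a) R)
    (B : Matrix r (ColorCoIdx n a) R) (s : r) (t : ColorIdx n a) :
    joinCols A B s t.val = A s t := dif_pos t.property

theorem joinCols_coColor {R r : Type*} {a : Fin (L + 1)} (A : Matrix r (ColorIdx n a) R)
    (B : Matrix r (ColorCoIdx n a) R) (s : r) (t : ColorCoIdx n a) :
    joinCols A B s t.val = B s t := dif_neg (not_le.2 t.property)

theorem ext_cols {R r : Type*} {M N : Matrix r (FlavorIdx n) R} (a : Fin (L + 1))
    (h : M.submatrix id (Subtype.val : ColorIdx n a → _) = N.submatrix id Subtype.val)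
    (h' : M.submatrix id (Subtype.val : ColorCoIdx n a → _) = N.submatrix id Subtype.val) :
    M = N := by
  ext s t
  by_cases ht : t.1 ≤ a
  · exact congrFun (congrFun h s) ⟨t, ht⟩
  · exact congrFun (congrFun h' s) ⟨t, not_le.1 ht⟩

end Index

/-! ### The products `ξ` and their square and remaining parts -/

section Xi

variable {L : ℕ} {n : Fin (L + 1) → ℕ} (q : ModuliMatrix n)

theorem xi_last : xi q (Fin.last L) =
    (1 : Matrix (FlavorIdx n) (FlavorIdx n) ℂ[X]).submatrix Subtype.val id := by
  simp [xi]

theorem xi_castSucc (i : Fin L) : xi q i.castSucc = q i * xi q i.succ := by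
  simp [xi]

/-- The matrix `q_i` with its columns indexed by the next node. -/
def qStep (i j : Fin L) (h : i.succ = j.castSucc) :
    Matrix (ColorIdx n i.castSucc) (ColorIdx n j.castSucc) ℂ[X] :=
  (q i).submatrix id (colorCast h.symm)

theorem mul_eq_submatrix_colorCast_mul {R r c : Type*} [Semiring R] {a b : Fin (L + 1)}
    (h : a = b) (A : Matrix r (ColorIdx n a) R) (B : Matrix (ColorIdx n a) c R) :
    A * B = A.submatrix id (colorCast h.symm) * B.submatrix (colorCast h.symm) id := by
  subst h; rfl

theorem xi_submatrix_colorCast {a b : Fin (L + 1)} (h : b = a) :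
    (xi q a).submatrix (colorCast h) id = xi q b := by
  subst h; rfl

theorem xi_eq_qStep_mul (i j : Fin L) (h : i.succ = j.castSucc) :
    xi q i.castSucc = qStep q i j h * xi q j.castSucc := by
  rw [xi_castSucc, mul_eq_submatrix_colorCast_mul h, xi_submatrix_colorCast]
  rfl

theorem qStep_mul_Dmat (i j : Fin L) (h : i.succ = j.castSucc) :
    qStep q i j h * Dmat q j = (xi q i.castSucc).submatrix id Subtype.val := by
  rw [xi_eq_qStep_mul q i j h]; rfl

theorem qStep_mul_Dtil (i j : Fin L) (h : i.succ = j.castSucc) :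
    qStep q i j h * Dtil q j =
      (Dtil q i).submatrix id (coUp (castSucc_lt_castSucc_of_succ_eq h).le) := by
  rw [Dtil, Dtil, xi_eq_qStep_mul q i j h]; rfl

/-- The left part of `ξ_i` that is as wide as `ξ_{i+1}`'s square part consists of `𝔇_i` and the
first block column of `𝔇̃_i`. -/
theorem qStep_mul_Dmat_mul {c : Type} (i j : Fin L) (h : i.succ = j.castSucc)
    (B : Matrix (ColorIdx n j.castSucc) c ℂ[X]) :
    qStep q i j h * Dmat q j * B =
      Dmat q i * B.submatrix (colorUp (castSucc_lt_castSucc_of_succ_eq h).le) id +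
      (Dtil q i).submatrix id (coBlock _ (castSucc_lt_castSucc_of_succ_eq h)) *
        B.submatrix (colorTop _) id := by
  rw [qStep_mul_Dmat, mul_eq_colorUp_add_colorTop h]
  rfl

end Xi

/-! ### Recursions for `Ψ` and `Ψ̃` along the chain -/

namespace HalfADHM

variable {L : ℕ} {n : Fin (L + 1) → ℕ} {k : Fin L → ℕ} (d : HalfADHM n k)

theorem Wprod_self (i : Fin L) : d.Wprod i i le_rfl = 1 := by
  have : ∀ m (h : i.val + m = i.val), d.Wpath m i i h = 1 := by
    intro m h
    obtain rfl : m = 0 := by omega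
    simp [Wpath]
  exact this _ _

theorem Wpath_succ (m : ℕ) (i j l : Fin L) (hij : i.succ = j.castSucc)
    (h : i.val + (m + 1) = l.val) (h' : j.val + m = l.val) :
    d.Wpath (m + 1) i l h = d.W i j hij * d.Wpath m j l h' := by
  obtain ⟨j, hj⟩ := j
  obtain rfl : i.val + 1 = j := congrArg Fin.val hij
  rfl

theorem Wprod_eq_W_mul {i j l : Fin L} (hij : i.succ = j.castSucc) (hjl : j ≤ l) (hil : i ≤ l) :
    d.Wprod i l hil = d.W i j hij * d.Wprod j l hjl := by
  have hj : i.val + 1 = j.val := congrArg Fin.val hij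
  have hjl' : j.val ≤ l.val := hjl
  have : ∀ m m' (h : i.val + m = l.val) (h' : j.val + m' = l.val),
      d.Wpath m i l h = d.W i j hij * d.Wpath m' j l h' := by
    intro m m' h h'
    obtain rfl : m = m' + 1 := by omega
    exact d.Wpath_succ m' i j l hij h h'
  exact this _ _ _ _

/-- The recursive definition peels factors off on the left; induction moves this to the right end.
-/
theorem Wprod_eq_mul_W {i j l : Fin L} (hij : i ≤ j) (hjl : j.succ = l.castSucc) (hil : i ≤ l) :
    d.Wprod i l hil = d.Wprod i j hij * d.W j l hjl := by
  have hl : j.val + 1 = l.val := congrArg Fin.val hjl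
  obtain ⟨m, hm⟩ : ∃ m, i.val + m = j.val := ⟨j.val - i.val, Nat.add_sub_cancel' hij⟩
  induction m generalizing i with
  | zero =>
    obtain rfl : i = j := Fin.ext hm
    rw [d.Wprod_eq_W_mul hjl le_rfl hil, Wprod_self, Wprod_self, Matrix.mul_one, Matrix.one_mul]
  | succ m ih =>
    have hi : i.val + 1 < L := by omega
    have h1 : i.succ = (⟨i.val + 1, hi⟩ : Fin L).castSucc := rfl
    have h2 : (⟨i.val + 1, hi⟩ : Fin L) ≤ j := Fin.le_def.2 (by simp; omega)
    have h3 : (⟨i.val + 1, hi⟩ : Fin L) ≤ l := Fin.le_def.2 (by simp; omega)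
    rw [d.Wprod_eq_W_mul h1 h3 hil, d.Wprod_eq_W_mul h1 h2 hij, Matrix.mul_assoc,
      ih h2 h3 (by simp; omega)]

theorem Ψ_colorTop (i : Fin L) :
    (d.Ψ i).submatrix (colorTop _) id = d.Υ i.castSucc i rfl := by
  ext s c
  change (d.Υ i.castSucc i rfl * d.Wprod i i le_rfl) s c = _
  rw [Wprod_self, Matrix.mul_one]

/-- Together with `Ψ_colorTop` this is the recursion `Ψ_{i+1} = (Ψ_i W_i ; Υ_{i+1})`, which replaces
the explicit products from here on. -/
theorem Ψ_colorUp (i j : Fin L) (h : i.succ = j.castSucc) :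
    (d.Ψ j).submatrix (colorUp (castSucc_lt_castSucc_of_succ_eq h).le) id =
      d.Ψ i * d.W i j h := by
  ext ⟨⟨a, s⟩, ha⟩ c
  have ha' : a < Fin.last L := lt_of_le_of_lt ha i.castSucc_lt_last
  have h1 : (d.Ψ j).submatrix (colorUp (castSucc_lt_castSucc_of_succ_eq h).le) id ⟨⟨a, s⟩, ha⟩ c =
    (d.Υ a (nodeFrom a ha') (castSucc_nodeFrom _ _).symm *
      d.Wprod (nodeFrom a ha') j (le_trans ha (castSucc_lt_castSucc_of_succ_eq h).le)) s c := rfl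
  rw [h1, d.Wprod_eq_mul_W (i := nodeFrom a ha') (j := i) ha h, ← Matrix.mul_assoc]
  rfl

theorem Ψt_coBlock (i : Fin L) :
    (d.Ψt i).submatrix id (coBlock i.succ i.castSucc_lt_succ) = d.Υt i i.succ rfl := by
  ext c s
  change (d.Wprod i i le_rfl * d.Υt i i.succ rfl) c s = _
  rw [Wprod_self, Matrix.one_mul]

theorem Ψt_coBlock_castSucc (i j : Fin L) (h : i.succ = j.castSucc) :
    (d.Ψt i).submatrix id (coBlock _ (castSucc_lt_castSucc_of_succ_eq h)) =
      d.Υt i j.castSucc h.symm := by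
  -- The labels `i.succ` and `j.castSucc` are only propositionally equal, so the claim is
  -- generalized over the label before substituting.
  have : ∀ a (ha : a = i.succ) (hia : i.castSucc < a),
      (d.Ψt i).submatrix id (coBlock a hia) = d.Υt i a ha := by
    rintro a rfl _
    exact d.Ψt_coBlock i
  exact this _ _ _

theorem Ψt_coUp (i j : Fin L) (h : i.succ = j.castSucc) :
    (d.Ψt i).submatrix id (coUp (castSucc_lt_castSucc_of_succ_eq h).le) =
      d.W i j h * d.Ψt j := by
  ext c ⟨⟨b, s⟩, hb⟩
  have hb0 : 0 < b := lt_of_le_of_lt (Fin.zero_le _) hb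
  have h1 : (d.Ψt i).submatrix id (coUp (castSucc_lt_castSucc_of_succ_eq h).le) c ⟨⟨b, s⟩, hb⟩ =
    (d.Wprod i (nodeTo b hb0)
        (le_nodeTo ((castSucc_lt_castSucc_of_succ_eq h).trans hb)) *
      d.Υt (nodeTo b hb0) b (succ_nodeTo _ _).symm) c s := rfl
  rw [h1, d.Wprod_eq_W_mul h (le_nodeTo hb), Matrix.mul_assoc]
  rfl

theorem constraint' (i j : Fin L) (h : i.succ = j.castSucc) :
    d.Z i * d.W i j h - d.W i j h * d.Z j =
      d.Υt i j.castSucc h.symm * d.Υ j.castSucc j rfl := by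
  rw [d.constraint]
  have : ∀ a (ha : a = i.succ) (ha' : a = j.castSucc),
      d.Υt i a ha * d.Υ a j ha' = d.Υt i i.succ rfl * d.Υ i.succ j h := by
    rintro a rfl _; rfl
  exact (this _ _ _).symm

end HalfADHM

/-! ### Comparing constant coefficients in a realization -/

section Realization

variable {r κ s : Type} [Fintype r] [DecidableEq r] [Fintype κ] [DecidableEq κ]
  {D : Matrix r r ℂ[X]} {J J' : Matrix r κ ℂ[X]} {Ψ : Matrix r κ ℂ} {Z : Matrix κ κ ℂ}

namespace Realizes

theorem col_mem (h : Realizes D J Ψ Z) (c : κ) : J.col c ∈ decaying D := by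
  refine (h.mem_iff _).2 ⟨Pi.single c 1, ?_⟩
  rw [mulVec_constVec, Finset.sum_eq_single c]
  · simp
  · intro b _ hb; simp [hb]
  · simp

/-- The image of `D` and the span of the columns of `J` meet only in zero. So an identity between
constant multiples of `D` and of `J` decouples; all matrix equations among the data are extracted
this way. -/
theorem eq_zero_of_mul_map_C_eq (h : Realizes D J Ψ Z) {A : Matrix r s ℂ} {B : Matrix κ s ℂ}
    (hAB : D * A.map Polynomial.C = J * B.map Polynomial.C) : A = 0 ∧ B = 0 := by
  have hcol : ∀ j, J *ᵥ constVec (B.col j) = D *ᵥ constVec (A.col j) := fun j =>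
    (congrArg (Matrix.col · j) hAB).symm
  have hB : ∀ j, B.col j = 0 := fun j => h.eq_zero_of_mulVec_eq (hcol j)
  have hA : ∀ j, constVec (A.col j) = 0 := fun j =>
    eq_zero_of_mulVec_mem_decaying h.det_ne ((h.mem_iff _).2 ⟨_, hcol j⟩)
  refine ⟨?_, ?_⟩
  · ext i j
    exact Polynomial.C_eq_zero.1 (congrFun (hA j) i)
  · ext i j
    exact congrFun (hB j) i

theorem left_cancel_map_C (h : Realizes D J Ψ Z) {A B : Matrix κ s ℂ}
    (hAB : J * A.map Polynomial.C = J * B.map Polynomial.C) : A = B := by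
  refine sub_eq_zero.1 (h.eq_zero_of_mul_map_C_eq (A := 0) (B := A - B) ?_).2
  rw [Matrix.map_sub _ (fun _ _ => Polynomial.C_sub), Matrix.mul_sub, hAB, sub_self,
    Matrix.map_zero _ Polynomial.C_0, Matrix.mul_zero]

theorem exists_eq_mul_map_C (h : Realizes D J Ψ Z) {Y : Matrix r s ℂ[X]}
    (hY : ∀ c, Y.col c ∈ decaying D) : ∃ B : Matrix κ s ℂ, Y = J * B.map Polynomial.C := by
  choose c hc using fun j => (h.mem_iff _).1 (hY j)
  exact ⟨Matrix.of fun i j => c j i, by ext1 i j; exact (congrFun (hc j) i).symm⟩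

end Realizes

theorem mul_map_C_map_C {r c s : Type} [Fintype c] (A : Matrix r c ℂ) (B : Matrix c s ℂ) :
    (A * B).map Polynomial.C = A.map Polynomial.C * B.map Polynomial.C :=
  Matrix.map_mul

theorem map_C_mul_charmatrix (W : Matrix s κ ℂ) (Z : Matrix κ κ ℂ) :
    W.map Polynomial.C * Z.charmatrix =
      (Polynomial.X : ℂ[X]) • W.map Polynomial.C - (W * Z).map Polynomial.C := by
  rw [Matrix.charmatrix, Matrix.mul_sub, Matrix.scalar_apply, ← Matrix.smul_one_eq_diagonal,
    Matrix.mul_smul, Matrix.mul_one, mul_map_C_map_C]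
  rfl

theorem charmatrix_mul_map_C (W : Matrix κ s ℂ) (Z : Matrix κ κ ℂ) :
    Z.charmatrix * W.map Polynomial.C =
      (Polynomial.X : ℂ[X]) • W.map Polynomial.C - (Z * W).map Polynomial.C := by
  rw [Matrix.charmatrix, Matrix.sub_mul, Matrix.scalar_apply, ← Matrix.smul_one_eq_diagonal,
    Matrix.smul_mul, Matrix.one_mul, mul_map_C_map_C]
  rfl

end Realization

/-! ### From moduli matrices to half-ADHM data -/

variable {L : ℕ} {n : Fin (L + 1) → ℕ} {k : Fin L → ℕ}

/-- The half-ADHM mapping relation with given matrices `𝔍_i`, in algebraic form. -/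
structure CorrVia (q : ModuliMatrix n) (d : HalfADHM n k)
    (J : ∀ i : Fin L, Matrix (ColorIdx n i.castSucc) (Fin (k i)) ℂ[X]) : Prop where
  realizes : ∀ i, Realizes (Dmat q i) (J i) (d.Ψ i) (d.Z i)
  til : ∀ i, Dtil q i = J i * (d.Ψt i).map Polynomial.C
  step : ∀ i j h, qStep q i j h * J j = J i * (d.W i j h).map Polynomial.C

theorem CorrVia.isVortex {q : ModuliMatrix n} {d : HalfADHM n k}
    {J : ∀ i : Fin L, Matrix (ColorIdx n i.castSucc) (Fin (k i)) ℂ[X]} (h : CorrVia q d J) :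
    IsVortex q k := by
  intro i
  have hi := h.realizes i
  refine ⟨?_, fun c => (decays_iff hi.det_ne).2 ?_⟩
  · rw [Polynomial.degree_eq_natDegree hi.det_ne, hi.finrank_eq, Fintype.card_fin]
  · rw [h.til i]
    exact col_mul_map_C_mem hi.col_mem _ _

theorem IsVortex.det_ne_zero {q : ModuliMatrix n} (hq : IsVortex q k) (i : Fin L) :
    (Dmat q i).det ≠ 0 := by
  intro h0
  have := (hq i).1
  simp [h0] at this

theorem CorrVia.corresponds {q : ModuliMatrix n} {d : HalfADHM n k}
    {J : ∀ i : Fin L, Matrix (ColorIdx n i.castSucc) (Fin (k i)) ℂ[X]} (h : CorrVia q d J) :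
    Corresponds q d := by
  refine ⟨fun a i ha => (J i).submatrix (colorCast ha) id, fun i => ⟨?_, fun v => ?_⟩,
    fun i => (h.realizes i).eq, fun i => h.til i, fun i j hij => ?_⟩
  · rw [Fintype.linearIndependent_iff]
    intro g hg
    refine congrFun ((h.realizes i).inj g ?_)
    rw [mulVec_constVec]
    exact hg
  · rw [decays_iff (h.realizes i).det_ne, (h.realizes i).mem_iff,
      Submodule.mem_span_range_iff_exists_fun]
    refine exists_congr fun c => ?_
    rw [mulVec_constVec]
    rfl
  · rw [mul_eq_submatrix_colorCast_mul hij]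
    exact h.step i j hij

/-- The vortex condition enters only through `det 𝔇_i ≠ 0`, which makes the analytic decay condition
agree with the algebraic one. -/
theorem Corresponds.exists_corrVia {q : ModuliMatrix n} {d : HalfADHM n k} (hq : IsVortex q k)
    (h : Corresponds q d) : ∃ J, CorrVia q d J := by
  obtain ⟨J, hJ, h1, h2, h3⟩ := h
  refine ⟨fun i => J i.castSucc i rfl, fun i => ?_, h2, fun i j hij => ?_⟩
  · refine ⟨hq.det_ne_zero i, fun c hc => ?_, fun v => ?_, h1 i⟩
    · rw [mulVec_constVec] at hc
      exact funext (Fintype.linearIndependent_iff.1 (hJ i).1 c hc)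
    · rw [← decays_iff (hq.det_ne_zero i), ← (hJ i).2,
        Submodule.mem_span_range_iff_exists_fun]
      refine exists_congr fun c => ?_
      rw [mulVec_constVec]
      rfl
  · refine Eq.trans ?_ (h3 i j hij)
    rw [mul_eq_submatrix_colorCast_mul hij]
    have : ∀ a (ha : a = j.castSucc), J j.castSucc j rfl =
        (J a j ha).submatrix (colorCast ha.symm) id := by
      rintro a rfl; rfl
    rw [← this]
    rfl

theorem fin_eq_zero_or_succ_eq (i : Fin L) :
    i.val = 0 ∨ ∃ j : Fin L, j.succ = i.castSucc := by
  rcases Nat.eq_zero_or_pos i.val with h | h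
  · exact Or.inl h
  · exact Or.inr ⟨⟨i.val - 1, by omega⟩, Fin.ext (by simp; omega)⟩

theorem fin_succ_eq_last_or (i : Fin L) :
    i.succ = Fin.last L ∨ ∃ j : Fin L, i.succ = j.castSucc := by
  by_cases h : i.val + 1 < L
  · exact Or.inr ⟨⟨i.val + 1, h⟩, rfl⟩
  · exact Or.inl (Fin.ext (by simp; omega))

/-- The recursion determines `Ψ`, by induction from the first node. This identifies `Ψ` for
assembled or transformed data without opening the products of the `W`. -/
theorem HalfADHM.Ψ_unique (d : HalfADHM n k)
    (P : ∀ i : Fin L, Matrix (ColorIdx n i.castSucc) (Fin (k i)) ℂ)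
    (hup : ∀ (i j : Fin L) (h : i.succ = j.castSucc),
      (P j).submatrix (colorUp (castSucc_lt_castSucc_of_succ_eq h).le) id = P i * d.W i j h)
    (htop : ∀ i : Fin L, (P i).submatrix (colorTop _) id = d.Υ i.castSucc i rfl) (i : Fin L) :
    d.Ψ i = P i := by
  obtain ⟨m, hm⟩ : ∃ m, i.val = m := ⟨_, rfl⟩
  induction m generalizing i with
  | zero =>
    ext ⟨⟨a, s⟩, ha⟩ c
    obtain rfl : a = i.castSucc := by
      have : a ≤ i.castSucc := ha
      exact le_antisymm this (Fin.le_def.2 (by simp [hm]))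
    exact (congrFun (congrFun (d.Ψ_colorTop i) s) c).trans (congrFun (congrFun (htop i) s) c).symm
  | succ m ih =>
    obtain ⟨j, hj⟩ := (fin_eq_zero_or_succ_eq i).resolve_left (by omega)
    have hjm : j.val = m := by
      have := congrArg Fin.val hj
      simp at this
      omega
    ext t c
    rcases colorIdx_cases hj t with ⟨t', rfl⟩ | ⟨s, rfl⟩
    · refine (congrFun (congrFun (d.Ψ_colorUp j i hj) t') c).trans ?_
      rw [ih j hjm]
      exact (congrFun (congrFun (hup j i hj) t') c).symm
    · exact (congrFun (congrFun (d.Ψ_colorTop i) s) c).trans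
        (congrFun (congrFun (htop i) s) c).symm

theorem HalfADHM.Ψt_unique (d : HalfADHM n k)
    (T : ∀ i : Fin L, Matrix (Fin (k i)) (ColorCoIdx n i.castSucc) ℂ)
    (hup : ∀ (i j : Fin L) (h : i.succ = j.castSucc),
      (T i).submatrix id (coUp (castSucc_lt_castSucc_of_succ_eq h).le) = d.W i j h * T j)
    (htop : ∀ i : Fin L, (T i).submatrix id (coBlock i.succ i.castSucc_lt_succ) =
      d.Υt i i.succ rfl) (i : Fin L) : d.Ψt i = T i := by
  -- Here the recursion runs backwards, so the induction is on the distance `m` to the last node.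
  obtain ⟨m, hm⟩ : ∃ m, i.val + m + 1 = L := ⟨L - 1 - i.val, by omega⟩
  have hblock : ∀ a (ha : a = i.succ) (hia : i.castSucc < a),
      (d.Ψt i).submatrix id (coBlock a hia) = (T i).submatrix id (coBlock a hia) := by
    rintro a rfl _
    exact (d.Ψt_coBlock i).trans (htop i).symm
  induction m generalizing i with
  | zero =>
    ext c ⟨⟨a, s⟩, ha⟩
    have ha' : i.castSucc < a := ha
    have : a = i.succ := by
      have := Fin.lt_def.1 ha'
      exact Fin.ext (by simp at this ⊢; omega)
    exact congrFun (congrFun (hblock a this ha') c) s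
  | succ m ih =>
    obtain ⟨j, hj⟩ := (fin_succ_eq_last_or i).resolve_left (fun h => by
      have := congrArg Fin.val h
      simp at this
      omega)
    have hjm : j.val + m + 1 = L := by
      have := congrArg Fin.val hj
      simp at this
      omega
    ext c t
    rcases colorCoIdx_cases hj t with ⟨t', rfl⟩ | ⟨s, rfl⟩
    · refine (congrFun (congrFun (d.Ψt_coUp i j hj) c) t').trans ?_
      rw [ih j hjm]
      · exact (congrFun (congrFun (hup i j hj) c) t').symm
      · rintro a rfl _
        exact (d.Ψt_coBlock j).trans (htop j).symm
    · exact congrFun (congrFun (hblock _ hj.symm _) c) s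

/-- Each `𝔇_i` is realized separately, and decay of `𝔇̃_i` gives `T i`. Then `q_i J_{i+1} (X -
Z_{i+1})` is `𝔇_i` times a constant matrix plus a decaying term, so `q_i J_{i+1}` decays and equals
`J_i W_i`. Inserting this and separating the image of `𝔇_i` from the span of `J_i` yields the
recursion for `Ψ` and the half-ADHM constraint together. -/
theorem exists_corrVia_of_isVortex {q : ModuliMatrix n} (hq : IsVortex q k) :
    ∃ (d : HalfADHM n k) (J : ∀ i : Fin L, Matrix (ColorIdx n i.castSucc) (Fin (k i)) ℂ[X]),
      CorrVia q d J := by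
  have hdeg : ∀ i, (Dmat q i).det.natDegree = k i := fun i =>
    Polynomial.natDegree_eq_of_degree_eq_some (hq i).1
  choose J P Z hR using fun i => exists_realizes_of_natDegree (hq.det_ne_zero i) (hdeg i)
  choose T hT using fun i => (hR i).exists_eq_mul_map_C (Y := Dtil q i)
    (fun c => (decays_iff (hq.det_ne_zero i)).1 ((hq i).2 c))
  have hblock : ∀ (i j : Fin L) (h : i.succ = j.castSucc),
      (Dtil q i).submatrix id (coBlock _ (castSucc_lt_castSucc_of_succ_eq h)) =
        J i * ((T i).submatrix id
          (coBlock _ (castSucc_lt_castSucc_of_succ_eq h))).map Polynomial.C := by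
    intro i j h
    rw [hT i]; rfl
  have hstep : ∀ (i j : Fin L) (h : i.succ = j.castSucc),
      Dmat q i * ((P j).submatrix (colorUp (castSucc_lt_castSucc_of_succ_eq h).le) id).map
          Polynomial.C +
        J i * ((T i).submatrix id (coBlock _ (castSucc_lt_castSucc_of_succ_eq h)) *
          (P j).submatrix (colorTop _) id).map Polynomial.C =
      (qStep q i j h * J j) * (Z j).charmatrix := by
    intro i j h
    rw [Matrix.mul_assoc, ← (hR j).eq, ← Matrix.mul_assoc, qStep_mul_Dmat_mul q i j h, hblock i j h,
      mul_map_C_map_C, Matrix.mul_assoc]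
    rfl
  choose W hW using fun (i j : Fin L) (h : i.succ = j.castSucc) => (hR i).exists_eq_mul_map_C (Y := qStep q i j h * J j)
    (fun c => col_mem_decaying_of_mul_charmatrix (hR i).det_ne
      (fun c => col_mul_map_C_mem (hR i).col_mem _ c) (hstep i j h) c)
  have hkey : ∀ (i j : Fin L) (h : i.succ = j.castSucc),
      (P j).submatrix (colorUp (castSucc_lt_castSucc_of_succ_eq h).le) id = P i * W i j h ∧
      Z i * W i j h - W i j h * Z j =
        (T i).submatrix id (coBlock _ (castSucc_lt_castSucc_of_succ_eq h)) *
          (P j).submatrix (colorTop _) id := by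
    intro i j h
    have h1 := hstep i j h
    rw [hW i j h, Matrix.mul_assoc, map_C_mul_charmatrix] at h1
    have h2 : Dmat q i * (P i * W i j h).map Polynomial.C =
        J i * ((Polynomial.X : ℂ[X]) • (W i j h).map Polynomial.C -
          (Z i * W i j h).map Polynomial.C) := by
      rw [mul_map_C_map_C, ← Matrix.mul_assoc, (hR i).eq, Matrix.mul_assoc, charmatrix_mul_map_C]
    -- The terms with `X` cancel, leaving constant multiples of `𝔇_i` and of `J_i`.
    have h3 := (hR i).eq_zero_of_mul_map_C_eq
      (A := (P j).submatrix (colorUp (castSucc_lt_castSucc_of_succ_eq h).le) id - P i * W i j h)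
      (B := Z i * W i j h - W i j h * Z j -
        (T i).submatrix id (coBlock _ (castSucc_lt_castSucc_of_succ_eq h)) *
          (P j).submatrix (colorTop _) id) (by
        simp only [Matrix.map_sub _ (fun a b => Polynomial.C_sub (a := a) (b := b)),
          Matrix.mul_sub] at h1 h2 ⊢
        rw [h2, eq_sub_iff_add_eq.2 h1]
        abel)
    exact ⟨sub_eq_zero.1 h3.1, sub_eq_zero.1 h3.2⟩
  have hTup : ∀ (i j : Fin L) (h : i.succ = j.castSucc),
      (T i).submatrix id (coUp (castSucc_lt_castSucc_of_succ_eq h).le) = W i j h * T j := by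
    intro i j h
    refine (hR i).left_cancel_map_C ?_
    rw [mul_map_C_map_C, ← Matrix.mul_assoc, ← hW, Matrix.mul_assoc, ← hT, qStep_mul_Dtil, hT i]
    rfl
  -- `Υ_i` is the last block row of `P i` and `Υ̃_i` the first block column of `T i`.
  let d : HalfADHM n k :=
    { Z := Z
      Υ := fun a i h => Matrix.of fun s c => P i ⟨⟨a, s⟩, h.le⟩ c
      Υt := fun i a h => Matrix.of fun c s => T i c ⟨⟨a, s⟩, h ▸ i.castSucc_lt_succ⟩
      W := W
      constraint := by
        intro i j h
        rw [(hkey i j h).2]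
        have : ∀ a (ha : a = i.succ) (ha' : a = j.castSucc),
            (Matrix.of fun c s => T i c ⟨⟨a, s⟩, ha ▸ i.castSucc_lt_succ⟩) *
              (Matrix.of fun s c => P j ⟨⟨a, s⟩, ha'.le⟩ c) =
            (T i).submatrix id (coBlock _ (castSucc_lt_castSucc_of_succ_eq h)) *
              (P j).submatrix (colorTop _) id := by
          rintro _ _ rfl; rfl
        exact (this i.succ rfl h).symm }
  have hΨ : ∀ i, d.Ψ i = P i := d.Ψ_unique P (fun i j h => (hkey i j h).1) fun i => rfl
  have hΨt : ∀ i, d.Ψt i = T i := d.Ψt_unique T hTup fun i => rfl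
  exact ⟨d, J, fun i => by rw [hΨ]; exact hR i, fun i => by rw [hΨt]; exact hT i, hW⟩

/-! ### Gauge transformations, `V`-transformations, and the inverse construction -/

theorem Realizes.gauge {r κ : Type} [Fintype r] [DecidableEq r] [Fintype κ] [DecidableEq κ]
    {D : Matrix r r ℂ[X]} {J : Matrix r κ ℂ[X]} {Ψ : Matrix r κ ℂ} {Z : Matrix κ κ ℂ}
    (h : Realizes D J Ψ Z) (g : GL κ ℂ) :
    Realizes D (J * g.val.map Polynomial.C) (Ψ * g.val) ((g⁻¹).val * Z * g.val) := by
  have hJ : ∀ c, (J * g.val.map Polynomial.C) *ᵥ constVec c = J *ᵥ constVec (g.val *ᵥ c) := by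
    intro c
    rw [← Matrix.mulVec_mulVec]
    congr 1
    funext i
    simp [constVec, Matrix.mulVec, dotProduct]
  have hgi : ∀ c, g.val *ᵥ ((g⁻¹).val *ᵥ c) = c := fun c => by
    rw [Matrix.mulVec_mulVec, Units.mul_inv, Matrix.one_mulVec]
  have hig : ∀ c, (g⁻¹).val *ᵥ (g.val *ᵥ c) = c := fun c => by
    rw [Matrix.mulVec_mulVec, Units.inv_mul, Matrix.one_mulVec]
  refine ⟨h.det_ne, fun c hc => ?_, fun v => ?_, ?_⟩
  · rw [hJ] at hc
    rw [← hig c, h.inj _ hc, Matrix.mulVec_zero]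
  · rw [h.mem_iff]
    constructor
    · rintro ⟨c, rfl⟩
      exact ⟨(g⁻¹).val *ᵥ c, by rw [hJ, hgi]⟩
    · rintro ⟨c, rfl⟩
      exact ⟨_, (hJ c).symm⟩
  · rw [mul_map_C_map_C, ← Matrix.mul_assoc, h.eq, Matrix.mul_assoc, Matrix.mul_assoc,
      charmatrix_mul_map_C, map_C_mul_charmatrix, Matrix.mul_assoc, ← Matrix.mul_assoc g.val,
      Units.mul_inv, Matrix.one_mul]

variable {L : ℕ} {n : Fin (L + 1) → ℕ} {k : Fin L → ℕ}

/-- The relation `q_i 𝔍_{i+1} = 𝔍_i W_i` follows from the other two mapping relations. -/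
theorem CorrVia.of_realizes {q : ModuliMatrix n} {d : HalfADHM n k}
    {J : ∀ i : Fin L, Matrix (ColorIdx n i.castSucc) (Fin (k i)) ℂ[X]}
    (hR : ∀ i, Realizes (Dmat q i) (J i) (d.Ψ i) (d.Z i))
    (hT : ∀ i, Dtil q i = J i * (d.Ψt i).map Polynomial.C) : CorrVia q d J := by
  refine ⟨hR, hT, fun i j h => mul_charmatrix_right_cancel (Z := d.Z j) ?_⟩
  have h1 : ((d.Ψ j).map Polynomial.C).submatrix
      (colorUp (castSucc_lt_castSucc_of_succ_eq h).le) id =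
        (d.Ψ i).map Polynomial.C * (d.W i j h).map Polynomial.C := by
    rw [← mul_map_C_map_C, ← d.Ψ_colorUp i j h]; rfl
  have h2 : ((d.Ψ j).map Polynomial.C).submatrix (colorTop _) id =
      (d.Υ j.castSucc j rfl).map Polynomial.C := by
    rw [← d.Ψ_colorTop j]; rfl
  have h3 : (Dtil q i).submatrix id (coBlock _ (castSucc_lt_castSucc_of_succ_eq h)) =
      J i * (d.Υt i j.castSucc h.symm).map Polynomial.C := by
    rw [hT i, ← d.Ψt_coBlock_castSucc i j h]; rfl
  -- After multiplication by `X - Z_{i+1}` the claim is `J_i` applied to `(X - Z_i) W_i + Υ̃_i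
  -- Υ_{i+1} = W_i (X - Z_{i+1})`, which is the constraint.
  rw [Matrix.mul_assoc, ← (hR j).eq, ← Matrix.mul_assoc, qStep_mul_Dmat_mul q i j h, h1, h2, h3,
    ← Matrix.mul_assoc, (hR i).eq, Matrix.mul_assoc, Matrix.mul_assoc, Matrix.mul_assoc,
    charmatrix_mul_map_C, map_C_mul_charmatrix, ← Matrix.mul_add, ← mul_map_C_map_C,
    ← d.constraint' i j h, Matrix.map_sub _ (fun a b => Polynomial.C_sub (a := a) (b := b))]
  congr 1
  abel

theorem HalfADHM.Ψ_gauge {d d' : HalfADHM n k} {g : ∀ i : Fin L, GL (Fin (k i)) ℂ}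
    (hU : ∀ a i h, d'.Υ a i h = d.Υ a i h * (g i).val)
    (hW : ∀ i j h, d'.W i j h = ((g i)⁻¹).val * d.W i j h * (g j).val) (i : Fin L) :
    d'.Ψ i = d.Ψ i * (g i).val := by
  refine d'.Ψ_unique (fun i => d.Ψ i * (g i).val) (fun i j h => ?_) (fun i => ?_) i
  · rw [hW, Matrix.mul_assoc, ← Matrix.mul_assoc (g i).val, ← Matrix.mul_assoc (g i).val,
      Units.mul_inv, Matrix.one_mul, ← Matrix.mul_assoc, ← d.Ψ_colorUp i j h]
    rfl
  · rw [hU, ← d.Ψ_colorTop i]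
    rfl

theorem HalfADHM.Ψt_gauge {d d' : HalfADHM n k} {g : ∀ i : Fin L, GL (Fin (k i)) ℂ}
    (hV : ∀ i a h, d'.Υt i a h = ((g i)⁻¹).val * d.Υt i a h)
    (hW : ∀ i j h, d'.W i j h = ((g i)⁻¹).val * d.W i j h * (g j).val) (i : Fin L) :
    d'.Ψt i = ((g i)⁻¹).val * d.Ψt i := by
  refine d'.Ψt_unique (fun i => ((g i)⁻¹).val * d.Ψt i) (fun i j h => ?_) (fun i => ?_) i
  · rw [hW, Matrix.mul_assoc, ← Matrix.mul_assoc (g j).val, Units.mul_inv, Matrix.one_mul,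
      Matrix.mul_assoc, ← d.Ψt_coUp i j h]
    rfl
  · rw [hV, ← d.Ψt_coBlock i]
    rfl

theorem CorrVia.of_gaugeEquiv {q : ModuliMatrix n} {d d' : HalfADHM n k}
    {J : ∀ i : Fin L, Matrix (ColorIdx n i.castSucc) (Fin (k i)) ℂ[X]} (h : CorrVia q d J)
    (hg : HalfADHM.GaugeEquiv d d') : ∃ J', CorrVia q d' J' := by
  obtain ⟨g, hZ, hU, hV, hW⟩ := hg
  refine ⟨fun i => J i * (g i).val.map Polynomial.C, CorrVia.of_realizes (fun i => ?_) fun i => ?_⟩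
  · rw [HalfADHM.Ψ_gauge hU hW, hZ]
    exact (h.realizes i).gauge (g i)
  · rw [HalfADHM.Ψt_gauge hV hW, h.til, Matrix.mul_assoc, ← mul_map_C_map_C, ← Matrix.mul_assoc,
      Units.mul_inv, Matrix.one_mul]

/-- The two families `𝔍` are bases of the same spaces, so they differ by constant invertible
matrices `g i`; cancelling `𝔍` in each mapping relation gives the transformation laws. -/
theorem CorrVia.gaugeEquiv {q : ModuliMatrix n} {d d' : HalfADHM n k}
    {J J' : ∀ i : Fin L, Matrix (ColorIdx n i.castSucc) (Fin (k i)) ℂ[X]} (h : CorrVia q d J)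
    (h' : CorrVia q d' J') : HalfADHM.GaugeEquiv d d' := by
  choose B hB using fun i => (h.realizes i).exists_eq_mul_map_C (h'.realizes i).col_mem
  choose B' hB' using fun i => (h'.realizes i).exists_eq_mul_map_C (h.realizes i).col_mem
  have hBB' : ∀ i, B i * B' i = 1 := fun i => by
    refine (h.realizes i).left_cancel_map_C ?_
    rw [mul_map_C_map_C, ← Matrix.mul_assoc, ← hB, ← hB',
      Matrix.map_one _ Polynomial.C_0 Polynomial.C_1, Matrix.mul_one]
  let g : ∀ i : Fin L, GL (Fin (k i)) ℂ := fun i =>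
    ⟨B i, B' i, hBB' i, mul_eq_one_comm.1 (hBB' i)⟩
  have hgB : ∀ i, J' i = J i * (g i).val.map Polynomial.C := hB
  have hinv : ∀ {s : Type} (i) (A A' : Matrix (Fin (k i)) s ℂ), (g i).val * A = A' →
      A = ((g i)⁻¹).val * A' := by
    rintro s i A _ rfl
    rw [← Matrix.mul_assoc, Units.inv_mul, Matrix.one_mul]
  have hΨZ : ∀ i, d'.Ψ i = d.Ψ i * (g i).val ∧ (g i).val * d'.Z i = d.Z i * (g i).val := by
    intro i
    have h1 := (h'.realizes i).eq
    have h2 := congrArg (· * (g i).val.map Polynomial.C) (h.realizes i).eq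
    simp only [Matrix.mul_assoc, ← mul_map_C_map_C] at h2
    rw [hgB, Matrix.mul_assoc, map_C_mul_charmatrix] at h1
    rw [charmatrix_mul_map_C] at h2
    have h3 := (h.realizes i).eq_zero_of_mul_map_C_eq (A := d'.Ψ i - d.Ψ i * (g i).val)
      (B := d.Z i * (g i).val - (g i).val * d'.Z i) (by
        simp only [Matrix.map_sub _ (fun a b => Polynomial.C_sub (a := a) (b := b)),
          Matrix.mul_sub] at h1 h2 ⊢
        rw [h1, h2]
        abel)
    exact ⟨sub_eq_zero.1 h3.1, (sub_eq_zero.1 h3.2).symm⟩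
  have hΨt : ∀ i, d'.Ψt i = ((g i)⁻¹).val * d.Ψt i := by
    intro i
    refine hinv i _ _ ((h.realizes i).left_cancel_map_C ?_)
    rw [mul_map_C_map_C, ← Matrix.mul_assoc, ← hgB, ← h'.til, h.til]
  refine ⟨g, fun i => ?_, ?_, ?_, fun i j hij => ?_⟩
  · rw [Matrix.mul_assoc]
    exact hinv i _ _ (hΨZ i).2
  · rintro _ i rfl
    rw [← d'.Ψ_colorTop, ← d.Ψ_colorTop, (hΨZ i).1]
    rfl
  · rintro i _ rfl
    rw [← d'.Ψt_coBlock, ← d.Ψt_coBlock, hΨt i]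
    rfl
  · rw [Matrix.mul_assoc]
    refine hinv i _ _ ((h.realizes i).left_cancel_map_C ?_)
    rw [mul_map_C_map_C, mul_map_C_map_C, ← Matrix.mul_assoc, ← Matrix.mul_assoc, ← hgB,
      ← h'.step, ← h.step, hgB, Matrix.mul_assoc]

/-- At a node, `ξ` contains the block `𝔇` with nonzero determinant; at the last label it is a
reindexed identity. -/
theorem xi_right_cancel {q : ModuliMatrix n} (hq : ∀ i, (Dmat q i).det ≠ 0) {r : Type}
    {m : Fin (L + 1)} {A B : Matrix r (ColorIdx n m) ℂ[X]} (h : A * xi q m = B * xi q m) :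
    A = B := by
  cases m using Fin.lastCases with
  | last =>
    have key : ∀ A : Matrix r (ColorIdx n (Fin.last L)) ℂ[X],
        (A * xi q (Fin.last L)).submatrix id Subtype.val = A := by
      intro A
      have : (xi q (Fin.last L)).submatrix id (Subtype.val : ColorIdx n (Fin.last L) → _) = 1 := by
        rw [xi_last]
        exact Matrix.submatrix_one _ Subtype.val_injective
      conv_rhs => rw [← Matrix.mul_one A, ← this]
      rfl
    rw [← key A, h, key]
  | cast i =>
    refine mul_right_cancel_of_det_ne_zero (hq i) ?_
    exact congrArg (fun M => Matrix.submatrix M id Subtype.val) h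

/-- Cancelling `ξ_{i+1}` on the right recovers the law for `q_i`, so it suffices to compare the `ξ`.
-/
theorem vEquiv_of_xi_eq {q q' : ModuliMatrix n} (hq : ∀ i, (Dmat q i).det ≠ 0)
    (V : ∀ m : Fin (L + 1), (Matrix (ColorIdx n m) (ColorIdx n m) ℂ[X])ˣ)
    (hV : V (Fin.last L) = 1) (h : ∀ m, xi q' m = (V m).val * xi q m) : VEquiv q q' := by
  refine ⟨V, hV, fun i => ?_⟩
  have : q' i * (V i.succ).val = (V i.castSucc).val * q i := by
    refine xi_right_cancel hq ?_
    rw [Matrix.mul_assoc, ← h, ← xi_castSucc, h, xi_castSucc, Matrix.mul_assoc]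
  rw [← this, Matrix.mul_assoc, Units.mul_inv, Matrix.mul_one]

theorem xi_eq_of_vEquiv {q q' : ModuliMatrix n}
    {V : ∀ m : Fin (L + 1), (Matrix (ColorIdx n m) (ColorIdx n m) ℂ[X])ˣ}
    (hV : V (Fin.last L) = 1)
    (h : ∀ i : Fin L, q' i = (V i.castSucc).val * q i * ((V i.succ)⁻¹).val) (m : Fin (L + 1)) :
    xi q' m = (V m).val * xi q m := by
  induction m using Fin.reverseInduction with
  | last => rw [xi_last, xi_last, hV, Units.val_one, Matrix.one_mul]
  | cast i ih =>
    rw [xi_castSucc, ih, h, Matrix.mul_assoc, ← Matrix.mul_assoc _ (V i.succ).val, Units.inv_mul,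
      Matrix.one_mul, Matrix.mul_assoc, ← xi_castSucc]

theorem CorrVia.of_vEquiv {q q' : ModuliMatrix n} {d : HalfADHM n k}
    {J : ∀ i : Fin L, Matrix (ColorIdx n i.castSucc) (Fin (k i)) ℂ[X]} (h : CorrVia q d J)
    (hV : VEquiv q q') : ∃ J', CorrVia q' d J' := by
  obtain ⟨V, hV, hq⟩ := hV
  have hxi := xi_eq_of_vEquiv hV hq
  have hD : ∀ i, Dmat q' i = (V i.castSucc).val * Dmat q i := fun i => by
    rw [Dmat, hxi]; rfl
  have hT : ∀ i, Dtil q' i = (V i.castSucc).val * Dtil q i := fun i => by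
    rw [Dtil, hxi]; rfl
  refine ⟨fun i => (V i.castSucc).val * J i, CorrVia.of_realizes (fun i => ?_) fun i => ?_⟩
  · rw [hD]
    exact (h.realizes i).unit_mul _
  · rw [hT, h.til, Matrix.mul_assoc]

theorem xi_eq_joinCols (q : ModuliMatrix n) (i : Fin L) :
    xi q i.castSucc = joinCols (Dmat q i) (Dtil q i) := by
  refine ext_cols i.castSucc ?_ ?_
  · ext1 s t
    exact (joinCols_color (Dmat q i) (Dtil q i) s t).symm
  · ext1 s t
    exact (joinCols_coColor (Dmat q i) (Dtil q i) s t).symm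

/-- One unimodular matrix carries both `𝔇_i` and `𝔍_i` to their primed versions, and `𝔇̃_i = 𝔍_i
Ψ̃_i` follows along. -/
theorem CorrVia.vEquiv {q q' : ModuliMatrix n} {d : HalfADHM n k}
    {J J' : ∀ i : Fin L, Matrix (ColorIdx n i.castSucc) (Fin (k i)) ℂ[X]} (h : CorrVia q d J)
    (h' : CorrVia q' d J') : VEquiv q q' := by
  choose V hV hVJ using fun i => (h.realizes i).exists_unit (h'.realizes i)
  let U : ∀ m : Fin (L + 1), (Matrix (ColorIdx n m) (ColorIdx n m) ℂ[X])ˣ :=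
    Fin.lastCases 1 V
  have hUl : U (Fin.last L) = 1 := Fin.lastCases_last
  have hUc : ∀ i : Fin L, U i.castSucc = V i := fun i => Fin.lastCases_castSucc i
  refine vEquiv_of_xi_eq (fun i => (h.realizes i).det_ne) U hUl fun m => ?_
  cases m using Fin.lastCases with
  | last => rw [hUl, xi_last, xi_last, Units.val_one, Matrix.one_mul]
  | cast i =>
    rw [hUc]
    refine ext_cols i.castSucc (hV i) ?_
    change Dtil q' i = (V i).val * Dtil q i
    rw [h'.til, h.til, hVJ, Matrix.mul_assoc]

/-- The mapping relations force `ξ_i = (D_i, J_i Ψ̃_i)`. It remains to factor `ξ_i` through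
`ξ_{i+1}`. By the constraint, the leading columns `E` of `ξ_i` satisfy `E Ψ_{i+1} = J_i W_i (X -
Z_{i+1})`, and the universal property of `D_{i+1}` supplies the factor. -/
theorem exists_corrVia_of_observable {d : HalfADHM n k}
    (hd : ∀ i, Observable (d.Ψ i) (d.Z i)) :
    ∃ (q : ModuliMatrix n) (J : ∀ i : Fin L, Matrix (ColorIdx n i.castSucc) (Fin (k i)) ℂ[X]),
      CorrVia q d J := by
  choose D J hR huniv using fun i => (hd i).exists_realizes
  let X : ∀ i : Fin L, Matrix (ColorIdx n i.castSucc) (FlavorIdx n) ℂ[X] := fun i =>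
    joinCols (D i) (J i * (d.Ψt i).map Polynomial.C)
  let Ξ : ∀ m : Fin (L + 1), Matrix (ColorIdx n m) (FlavorIdx n) ℂ[X] :=
    Fin.lastCases ((1 : Matrix (FlavorIdx n) (FlavorIdx n) ℂ[X]).submatrix Subtype.val id) X
  have hΞl : Ξ (Fin.last L) = (1 : Matrix (FlavorIdx n) (FlavorIdx n) ℂ[X]).submatrix
      Subtype.val id := Fin.lastCases_last
  have hΞc : ∀ i : Fin L, Ξ i.castSucc = X i := fun i => Fin.lastCases_castSucc i
  have hXD : ∀ i, (X i).submatrix id Subtype.val = D i := fun i => by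
    ext1 s t; exact joinCols_color _ _ s t
  have hXT : ∀ i, (X i).submatrix id Subtype.val = J i * (d.Ψt i).map Polynomial.C := fun i => by
    ext1 s t; exact joinCols_coColor _ _ s t
  have hstep : ∀ (i : Fin L) (m : Fin (L + 1)), i.succ = m →
      ∃ Q : Matrix (ColorIdx n i.castSucc) (ColorIdx n m) ℂ[X], X i = Q * Ξ m := by
    intro i m hm
    cases m using Fin.lastCases with
    | last =>
      let e : ColorIdx n (Fin.last L) ≃ FlavorIdx n :=
        Equiv.subtypeUnivEquiv fun t => Fin.le_last t.1
      refine ⟨(X i).submatrix id e, ?_⟩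
      rw [hΞl]
      exact ((Matrix.submatrix_mul_equiv (X i) 1 id e id).trans (by rw [Matrix.mul_one]; rfl)).symm
    | cast j =>
      rw [hΞc]
      set E := (X i).submatrix id (Subtype.val : ColorIdx n j.castSucc → _) with hE
      have hup : E.submatrix id (colorUp (castSucc_lt_castSucc_of_succ_eq hm).le) = D i := hXD i
      have htop : E.submatrix id (colorTop _) =
          J i * (d.Υt i j.castSucc hm.symm).map Polynomial.C := by
        rw [← d.Ψt_coBlock_castSucc i j hm]
        exact congrArg (fun M => Matrix.submatrix M id
          (coBlock j.castSucc (castSucc_lt_castSucc_of_succ_eq hm))) (hXT i)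
      have hEΨ : E * (d.Ψ j).map Polynomial.C =
          (J i * (d.W i j hm).map Polynomial.C) * (d.Z j).charmatrix := by
        have h1 : ((d.Ψ j).map Polynomial.C).submatrix
            (colorUp (castSucc_lt_castSucc_of_succ_eq hm).le) id =
              (d.Ψ i).map Polynomial.C * (d.W i j hm).map Polynomial.C := by
          rw [← mul_map_C_map_C, ← d.Ψ_colorUp i j hm]; rfl
        have h2 : ((d.Ψ j).map Polynomial.C).submatrix (colorTop _) id =
            (d.Υ j.castSucc j rfl).map Polynomial.C := by
          rw [← d.Ψ_colorTop j]; rfl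
        rw [mul_eq_colorUp_add_colorTop hm, hup, htop, h1, h2,
          ← Matrix.mul_assoc, (hR i).eq, Matrix.mul_assoc, Matrix.mul_assoc, Matrix.mul_assoc,
          charmatrix_mul_map_C, map_C_mul_charmatrix, ← Matrix.mul_add, ← mul_map_C_map_C,
          ← d.constraint' i j hm,
          Matrix.map_sub _ (fun a b => Polynomial.C_sub (a := a) (b := b))]
        congr 1
        abel
      obtain ⟨Q, hQD, hQJ⟩ := huniv j _ _ hEΨ
      refine ⟨Q, ext_cols j.castSucc ?_ ?_⟩
      · rw [← hE, hQD, ← hXD j]; rfl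
      · have h1 : (Q * X j).submatrix id (Subtype.val : ColorCoIdx n j.castSucc → _) =
            Q * (J j * (d.Ψt j).map Polynomial.C) := by rw [← hXT j]; rfl
        rw [h1, ← Matrix.mul_assoc, ← hQJ, Matrix.mul_assoc, ← mul_map_C_map_C,
          ← d.Ψt_coUp i j hm]
        exact congrArg (fun M => Matrix.submatrix M id
          (coUp (castSucc_lt_castSucc_of_succ_eq hm).le)) (hXT i)
  choose q hq using fun i : Fin L => hstep i i.succ rfl
  have hxi : ∀ m, xi q m = Ξ m := by
    intro m
    induction m using Fin.reverseInduction with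
    | last => rw [xi_last, hΞl]
    | cast i ih => rw [xi_castSucc, ih, ← hq, hΞc]
  refine ⟨q, J, CorrVia.of_realizes (fun i => ?_) fun i => ?_⟩
  · rw [Dmat, hxi, hΞc, hXD]
    exact hR i
  · rw [Dtil, hxi, hΞc, hXT]

/-! ### Block matrices and the inverse of `𝒰(φ)` -/

section BlockFamily

variable {ι ι' ι'' : Type} {m : ι → ℕ} {m' : ι' → ℕ} {m'' : ι'' → ℕ}

/-- The matrix assembled from a family of blocks. -/
def ofBlocks (B : ∀ i j, Matrix (Fin (m i)) (Fin (m' j)) ℂ) :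
    Matrix (Σ i, Fin (m i)) (Σ j, Fin (m' j)) ℂ :=
  Matrix.of fun x y => B x.1 y.1 x.2 y.2

theorem ofBlocks_mul [Fintype ι'] (A : ∀ i j, Matrix (Fin (m i)) (Fin (m' j)) ℂ)
    (B : ∀ i j, Matrix (Fin (m' i)) (Fin (m'' j)) ℂ) :
    ofBlocks A * ofBlocks B = ofBlocks fun i j => ∑ l, A i l * B l j := by
  ext x y
  simp [ofBlocks, Matrix.mul_apply, Fintype.sum_sigma, Matrix.sum_apply]

theorem ofBlocks_sub (A B : ∀ i j, Matrix (Fin (m i)) (Fin (m' j)) ℂ) :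
    ofBlocks A - ofBlocks B = ofBlocks fun i j => A i j - B i j := rfl

/-- The block diagonal family. -/
def diagBlocks [DecidableEq ι] (Z : ∀ i, Matrix (Fin (m i)) (Fin (m i)) ℂ) (i j : ι) :
    Matrix (Fin (m i)) (Fin (m j)) ℂ :=
  if h : i = j then (Z i).submatrix id (Fin.cast (congrArg m h.symm)) else 0

theorem diagBlocks_self [DecidableEq ι] (Z : ∀ i, Matrix (Fin (m i)) (Fin (m i)) ℂ) (i : ι) :
    diagBlocks Z i i = Z i := dif_pos rfl

theorem diagBlocks_ne [DecidableEq ι] (Z : ∀ i, Matrix (Fin (m i)) (Fin (m i)) ℂ) {i j : ι}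
    (h : i ≠ j) : diagBlocks Z i j = 0 := dif_neg h

theorem sum_diagBlocks_mul [Fintype ι] [DecidableEq ι]
    (Z : ∀ i, Matrix (Fin (m i)) (Fin (m i)) ℂ)
    (B : ∀ i j, Matrix (Fin (m i)) (Fin (m' j)) ℂ) (i : ι) (j : ι') :
    ∑ l, diagBlocks Z i l * B l j = Z i * B i j := by
  rw [Finset.sum_eq_single i, diagBlocks_self]
  · intro l _ hl; rw [diagBlocks_ne Z hl.symm, Matrix.zero_mul]
  · simp

theorem sum_mul_diagBlocks [Fintype ι] [DecidableEq ι]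
    (Z : ∀ i, Matrix (Fin (m i)) (Fin (m i)) ℂ)
    (B : ∀ i j, Matrix (Fin (m' i)) (Fin (m j)) ℂ) (i : ι') (j : ι) :
    ∑ l, B i l * diagBlocks Z l j = B i j * Z j := by
  rw [Finset.sum_eq_single j, diagBlocks_self]
  · intro l _ hl; rw [diagBlocks_ne Z hl, Matrix.mul_zero]
  · simp

theorem ofBlocks_diagBlocks_one [DecidableEq ι] :
    ofBlocks (diagBlocks fun i : ι => (1 : Matrix (Fin (m i)) (Fin (m i)) ℂ)) = 1 := by
  ext ⟨i, s⟩ ⟨j, t⟩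
  by_cases h : i = j
  · subst h
    change diagBlocks (fun i : ι => (1 : Matrix (Fin (m i)) (Fin (m i)) ℂ)) i i s t = _
    rw [diagBlocks_self]
    simp [Matrix.one_apply]
  · change diagBlocks (fun i : ι => (1 : Matrix (Fin (m i)) (Fin (m i)) ℂ)) i j s t = _
    rw [diagBlocks_ne _ h]
    simp [h]

end BlockFamily

/-- A factorization identity for `1 + Υ A⁻¹ M⁻¹ Υ̃` when `A M - M A = Υ̃ Υ`. -/
theorem one_add_mul_one_sub_eq_one {f κ : Type} [Fintype f] [DecidableEq f] [Fintype κ]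
    [DecidableEq κ] {U : Matrix f κ ℂ} {Ut : Matrix κ f ℂ} {A G M N : Matrix κ κ ℂ}
    (hAG : A * G = 1) (hMN : M * N = 1) (h : A * M - M * A = Ut * U) :
    (1 + U * (G * N) * Ut) * (1 - U * (N * G) * Ut) = 1 := by
  have hGA : G * A = 1 := mul_eq_one_comm.1 hAG
  have hNM : N * M = 1 := mul_eq_one_comm.1 hMN
  -- Between `G N` and `N G` the commutator of `A` and `M` becomes that of their inverses, which
  -- cancels the first-order terms of the product.
  have h1 : G * N * (Ut * U) * (N * G) = G * N - N * G := by
    rw [← h]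
    calc G * N * (A * M - M * A) * (N * G)
        = G * N * A * (M * N) * G - G * (N * M) * A * N * G := by noncomm_ring
      _ = G * N * (A * G) - (G * A) * N * G := by rw [hMN, hNM]; noncomm_ring
      _ = _ := by rw [hAG, hGA]; noncomm_ring
  have h2 : U * (G * N) * Ut * (U * (N * G) * Ut) = U * (G * N - N * G) * Ut := by
    rw [← h1]; simp only [Matrix.mul_assoc]
  rw [Matrix.add_mul, Matrix.mul_sub, Matrix.mul_sub, h2]
  simp only [Matrix.mul_one, Matrix.one_mul, Matrix.mul_sub, Matrix.sub_mul]
  abel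

namespace HalfADHM

variable {L : ℕ} {n : Fin (L + 1) → ℕ} {k : Fin L → ℕ} (d : HalfADHM n k)

/-- `Υ` as a family of blocks. -/
def blockΥ (a : Fin (L + 1)) (i : Fin L) : Matrix (Fin (n a)) (Fin (k i)) ℂ :=
  if h : a = i.castSucc then d.Υ a i h else 0

/-- `Υ̃` as a family of blocks. -/
def blockΥt (i : Fin L) (a : Fin (L + 1)) : Matrix (Fin (k i)) (Fin (n a)) ℂ :=
  if h : a = i.succ then d.Υt i a h else 0

/-- `W` as a family of blocks. -/
def blockW (i j : Fin L) : Matrix (Fin (k i)) (Fin (k j)) ℂ :=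
  if h : i.succ = j.castSucc then d.W i j h else 0

/-- The products of the `W` as a family of blocks. -/
def blockWprod (i j : Fin L) : Matrix (Fin (k i)) (Fin (k j)) ℂ :=
  if h : i ≤ j then d.Wprod i j h else 0

/-- The block form of `(1 - W) (1 + W + W² + ⋯) = 1` for the nilpotent matrix `W`. -/
theorem sum_blockW_mul_blockWprod (i j : Fin L) :
    d.blockWprod i j - ∑ l, d.blockW i l * d.blockWprod l j =
      diagBlocks (fun i => (1 : Matrix (Fin (k i)) (Fin (k i)) ℂ)) i j := by
  have hval : ∀ l : Fin L, i.succ = l.castSucc → l.val = i.val + 1 := fun l h =>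
    (congrArg Fin.val h).symm
  rcases lt_trichotomy i j with hij | rfl | hij
  · obtain ⟨l, hl⟩ := (fin_succ_eq_last_or i).resolve_left (fun h => by
      have := congrArg Fin.val h
      simp at this
      have := Fin.lt_def.1 hij
      omega)
    have hlj : l ≤ j := Fin.le_def.2 (by rw [hval l hl]; exact Fin.lt_def.1 hij)
    rw [diagBlocks_ne _ hij.ne, Finset.sum_eq_single l, blockWprod, blockWprod, blockW,
      dif_pos hij.le, dif_pos hl, dif_pos hlj, d.Wprod_eq_W_mul hl hlj, sub_self]
    · intro l' _ hne
      rw [blockW, dif_neg, Matrix.zero_mul]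
      intro h
      exact hne (Fin.ext ((hval l' h).trans (hval l hl).symm))
    · simp
  · rw [diagBlocks_self, Finset.sum_eq_zero, blockWprod, dif_pos le_rfl, Wprod_self, sub_zero]
    intro l _
    by_cases h : i.succ = l.castSucc
    · have := hval l h
      rw [blockWprod, dif_neg, Matrix.mul_zero]
      rw [Fin.le_def]; omega
    · rw [blockW, dif_neg h, Matrix.zero_mul]
  · rw [diagBlocks_ne _ hij.ne', Finset.sum_eq_zero, blockWprod, dif_neg (not_le.2 hij), sub_zero]
    intro l _
    by_cases h : i.succ = l.castSucc
    · have := hval l h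
      have := Fin.lt_def.1 hij
      rw [blockWprod, dif_neg, Matrix.mul_zero]
      rw [Fin.le_def]; omega
    · rw [blockW, dif_neg h, Matrix.zero_mul]

theorem blockΥt_mul_blockΥ (i j : Fin L) :
    ∑ a, d.blockΥt i a * d.blockΥ a j = d.Z i * d.blockW i j - d.blockW i j * d.Z j := by
  rw [Finset.sum_eq_single i.succ]
  · by_cases h : i.succ = j.castSucc
    · rw [blockΥt, blockΥ, blockW, dif_pos rfl, dif_pos h, dif_pos h, d.constraint]
    · rw [blockΥ, blockW, dif_neg h, dif_neg h]; simp
  · intro a _ ha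
    rw [blockΥt, dif_neg ha, Matrix.zero_mul]
  · simp

theorem sum_blockΥ_mul {c : Type} (a : Fin (L + 1)) (i : Fin L) (h : a = i.castSucc)
    (B : ∀ i, Matrix (Fin (k i)) c ℂ) : ∑ l, d.blockΥ a l * B l = d.Υ a i h * B i := by
  rw [Finset.sum_eq_single i, blockΥ, dif_pos h]
  · intro l _ hl
    rw [blockΥ, dif_neg, Matrix.zero_mul]
    rintro rfl
    exact hl (Fin.castSucc_injective _ h)
  · simp

theorem sum_mul_blockΥt {c : Type} (i : Fin L) (b : Fin (L + 1)) (h : b = i.succ)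
    (B : ∀ i, Matrix c (Fin (k i)) ℂ) : ∑ l, B l * d.blockΥt l b = B i * d.Υt i b h := by
  rw [Finset.sum_eq_single i, blockΥt, dif_pos h]
  · intro l _ hl
    rw [blockΥt, dif_neg, Matrix.mul_zero]
    rintro rfl
    exact hl (Fin.succ_injective _ h)
  · simp

/-- The blocks of `𝒰(φ)⁻¹`. -/
noncomputable def φinv (z : ℂ) : Blocks n := fun a b h =>
  -(d.Υ a (nodeFrom a (lt_of_lt_of_le h (Fin.le_last b))) (castSucc_nodeFrom _ _).symm *
    (d.Wprod (nodeFrom a (lt_of_lt_of_le h (Fin.le_last b)))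
      (nodeTo b (lt_of_le_of_lt (Fin.zero_le a) h)) (nodeFrom_le_nodeTo h) *
    (d.res (nodeTo b (lt_of_le_of_lt (Fin.zero_le a) h)) z)⁻¹) *
    d.Υt (nodeTo b (lt_of_le_of_lt (Fin.zero_le a) h)) b (succ_nodeTo _ _).symm)

/-- A unitriangular matrix built from blocks `Υ_a B_{ij} Υ̃_b` with `B` upper triangular. -/
theorem unitriangular_eq_one_add (B : ∀ i j : Fin L, Matrix (Fin (k i)) (Fin (k j)) ℂ)
    (hB : ∀ i j, j < i → B i j = 0) (f : Blocks n)
    (hf : ∀ a b h, f a b h =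
      d.Υ a (nodeFrom a (lt_of_lt_of_le h (Fin.le_last b))) (castSucc_nodeFrom _ _).symm *
        B (nodeFrom a (lt_of_lt_of_le h (Fin.le_last b)))
          (nodeTo b (lt_of_le_of_lt (Fin.zero_le a) h)) *
        d.Υt (nodeTo b (lt_of_le_of_lt (Fin.zero_le a) h)) b (succ_nodeTo _ _).symm) :
    unitriangular f = 1 + ofBlocks d.blockΥ * ofBlocks B * ofBlocks d.blockΥt := by
  rw [ofBlocks_mul, ofBlocks_mul]
  ext ⟨a, s⟩ ⟨b, t⟩
  rw [Matrix.add_apply]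
  change (if h : a < b then f a b h s t else if (⟨a, s⟩ : FlavorIdx n) = ⟨b, t⟩ then 1 else 0) =
    (1 : Matrix (FlavorIdx n) (FlavorIdx n) ℂ) ⟨a, s⟩ ⟨b, t⟩ +
      (∑ j, (∑ i, d.blockΥ a i * B i j) * d.blockΥt j b) s t
  by_cases h : a < b
  · rw [dif_pos h, hf, Matrix.one_apply_ne (by rintro ⟨⟩; exact lt_irrefl _ h), zero_add,
      d.sum_mul_blockΥt (nodeTo b (lt_of_le_of_lt (Fin.zero_le a) h)) b (succ_nodeTo _ _).symm
        (fun j => ∑ i, d.blockΥ a i * B i j),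
      d.sum_blockΥ_mul a (nodeFrom a (lt_of_lt_of_le h (Fin.le_last b)))
        (castSucc_nodeFrom _ _).symm (fun i => B i _)]
  · rw [dif_neg h, Finset.sum_eq_zero, Matrix.zero_apply, add_zero, Matrix.one_apply]
    intro j _
    by_cases hj : b = j.succ
    · rw [Finset.sum_eq_zero, Matrix.zero_mul]
      intro i _
      by_cases hi : a = i.castSucc
      · rw [hB i j, Matrix.mul_zero]
        subst hi hj
        exact Fin.succ_le_castSucc_iff.1 (not_lt.1 h)
      · rw [blockΥ, dif_neg hi, Matrix.zero_mul]
    · rw [blockΥt, dif_neg hj, Matrix.mul_zero]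

/-- With `A` block diagonal with blocks `z - Z_i` and `M = 1 - W`, the two factors are `1 + Υ A⁻¹
M⁻¹ Υ̃` and `1 - Υ M⁻¹ A⁻¹ Υ̃`. All constraints together say `A M - M A = Υ̃ Υ`. -/
theorem unitriangular_φ_mul (z : ℂ) (hz : ∀ i, (d.res i z).det ≠ 0) :
    unitriangular (d.φ z) * unitriangular (d.φinv z) = 1 := by
  have hN : ∀ i j : Fin L, j < i → d.blockWprod i j = 0 := fun i j h => dif_neg (not_le.2 h)
  rw [d.unitriangular_eq_one_add (fun i j => (d.res i z)⁻¹ * d.blockWprod i j)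
      (fun i j h => by rw [hN i j h, Matrix.mul_zero]) (d.φ z) (fun a b h => by
        rw [φ, blockWprod, dif_pos (nodeFrom_le_nodeTo h)]
        simp only [Matrix.mul_assoc]),
    d.unitriangular_eq_one_add (fun i j => -(d.blockWprod i j * (d.res j z)⁻¹))
      (fun i j h => by rw [hN i j h, Matrix.zero_mul, neg_zero]) (d.φinv z) (fun a b h => by
        rw [φinv, blockWprod, dif_pos (nodeFrom_le_nodeTo h), Matrix.mul_neg, Matrix.neg_mul])]
  set A := ofBlocks (diagBlocks fun i => d.res i z)
  set G := ofBlocks (diagBlocks fun i => (d.res i z)⁻¹)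
  set N := ofBlocks d.blockWprod
  set M : Matrix (Σ i, Fin (k i)) (Σ i, Fin (k i)) ℂ := 1 - ofBlocks d.blockW with hM
  have hAG : A * G = 1 := by
    rw [ofBlocks_mul, ← ofBlocks_diagBlocks_one]
    congr 1
    funext i j
    rw [sum_diagBlocks_mul]
    by_cases h : i = j
    · subst h
      rw [diagBlocks_self, diagBlocks_self,
        Matrix.mul_nonsing_inv _ (isUnit_iff_ne_zero.2 (hz i))]
    · rw [diagBlocks_ne _ h, diagBlocks_ne _ h, Matrix.mul_zero]
  have hMN : M * N = 1 := by
    rw [hM, Matrix.sub_mul, Matrix.one_mul, ofBlocks_mul, ofBlocks_sub, ← ofBlocks_diagBlocks_one]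
    congr 1
    funext i j
    exact d.sum_blockW_mul_blockWprod i j
  have hcomm : A * M - M * A = ofBlocks d.blockΥt * ofBlocks d.blockΥ := by
    have h1 : A * M - M * A = ofBlocks d.blockW * A - A * ofBlocks d.blockW := by
      rw [hM, Matrix.mul_sub, Matrix.sub_mul, Matrix.mul_one, Matrix.one_mul]; abel
    rw [h1, ofBlocks_mul, ofBlocks_mul, ofBlocks_mul, ofBlocks_sub]
    congr 1
    funext i j
    rw [sum_diagBlocks_mul, sum_mul_diagBlocks, d.blockΥt_mul_blockΥ, res, res, Matrix.mul_sub,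
      Matrix.sub_mul, Matrix.scalar_apply, Matrix.scalar_apply, ← Matrix.smul_one_eq_diagonal,
      ← Matrix.smul_one_eq_diagonal, Matrix.mul_smul, Matrix.smul_mul, Matrix.mul_one,
      Matrix.one_mul]
    abel
  have h1 : ofBlocks (fun i j => (d.res i z)⁻¹ * d.blockWprod i j) = G * N := by
    rw [ofBlocks_mul]
    congr 1
    funext i j
    rw [sum_diagBlocks_mul]
  have h2 : ofBlocks (fun i j => -(d.blockWprod i j * (d.res j z)⁻¹)) = -(N * G) := by
    rw [ofBlocks_mul]
    ext x y
    change (-(d.blockWprod x.1 y.1 * (d.res y.1 z)⁻¹)) x.2 y.2 =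
      -((∑ l, d.blockWprod x.1 l * diagBlocks (fun i => (d.res i z)⁻¹) l y.1) x.2 y.2)
    rw [sum_mul_diagBlocks]
    rfl
  rw [h1, h2, Matrix.mul_neg, Matrix.neg_mul, ← sub_eq_add_neg]
  exact one_add_mul_one_sub_eq_one hAG hMN hcomm

theorem dual_Wprod (i j : Fin L) (h : i ≤ j) :
    d.dual.Wprod i j h = (d.Wprod j.rev i.rev (Fin.rev_le_rev.2 h))ᵀ := by
  obtain ⟨m, hm⟩ : ∃ m, i.val + m = j.val := ⟨j.val - i.val, Nat.add_sub_cancel' h⟩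
  induction m generalizing i with
  | zero =>
    obtain rfl : i = j := Fin.ext hm
    rw [Wprod_self, Wprod_self, Matrix.transpose_one]
  | succ m ih =>
    have hi : i.val + 1 < L := by omega
    set l : Fin L := ⟨i.val + 1, hi⟩ with hl
    have h1 : i.succ = l.castSucc := rfl
    have h2 : l ≤ j := Fin.le_def.2 (by simp [hl]; omega)
    have h3 : l.rev.succ = i.rev.castSucc := by rw [← Fin.rev_castSucc, ← h1, Fin.rev_succ]
    rw [d.dual.Wprod_eq_W_mul h1 h2 h, ih l h2 (by simp [hl]; omega),
      d.Wprod_eq_mul_W (Fin.rev_le_rev.2 h2) h3 (Fin.rev_le_rev.2 h), Matrix.transpose_mul]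
    rfl

theorem dual_res (i : Fin L) (z : ℂ) : d.dual.res i z = (d.res i.rev z)ᵀ := by
  rw [res, res, Matrix.transpose_sub]
  congr 1
  exact (Matrix.diagonal_transpose _).symm

end HalfADHM

/-! ### Reversal of the index sets -/

section Reversal

variable {L : ℕ} {n : Fin (L + 1) → ℕ}

/-- The index of `ℂ^N` corresponding to an index for the reversed sequence. -/
def flavorRev (t : FlavorIdx (rev n)) : FlavorIdx n := ⟨t.1.rev, t.2⟩

theorem flavorRev_bijective : Function.Bijective (flavorRev : FlavorIdx (rev n) → FlavorIdx n) := by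
  constructor
  · rintro ⟨a, s⟩ ⟨b, t⟩ h
    have h1 : a = b := Fin.rev_injective (congrArg Sigma.fst h)
    subst h1
    have h2 : s = t := by simpa [flavorRev] using h
    rw [h2]
  · rintro ⟨a, s⟩
    obtain ⟨b, rfl⟩ := Fin.rev_surjective a
    exact ⟨⟨b, s⟩, rfl⟩

theorem castSucc_rev_lt_rev {i : Fin L} {a : Fin (L + 1)} (h : a ≤ i.castSucc) :
    i.rev.castSucc < a.rev := by
  rw [← Fin.rev_succ, Fin.rev_lt_rev]
  exact Fin.le_castSucc_iff.1 h

theorem rev_le_castSucc_rev {i : Fin L} {a : Fin (L + 1)} (h : i.castSucc < a) :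
    a.rev ≤ i.rev.castSucc := by
  rw [← Fin.rev_succ, Fin.rev_le_rev]
  exact Fin.castSucc_lt_iff_succ_le.1 h

/-- Reversal exchanges indices and complementary indices of a node. -/
def colorRev (i : Fin L) (t : ColorIdx (rev n) i.castSucc) : ColorCoIdx n i.rev.castSucc :=
  ⟨flavorRev t.val, castSucc_rev_lt_rev t.property⟩

/-- Reversal exchanges complementary indices and indices of a node. -/
def coColorRev (i : Fin L) (t : ColorCoIdx (rev n) i.castSucc) : ColorIdx n i.rev.castSucc :=
  ⟨flavorRev t.val, rev_le_castSucc_rev t.property⟩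

theorem colorRev_bijective (i : Fin L) :
    Function.Bijective (colorRev i : ColorIdx (rev n) i.castSucc → _) := by
  constructor
  · intro s t h
    exact Subtype.ext (flavorRev_bijective.1 (congrArg Subtype.val h))
  · rintro ⟨t, ht⟩
    obtain ⟨s, rfl⟩ := flavorRev_bijective.2 t
    refine ⟨⟨s, ?_⟩, rfl⟩
    by_contra hs
    exact absurd (rev_le_castSucc_rev (not_le.1 hs)) (not_le.2 ht)

theorem coColorRev_bijective (i : Fin L) :
    Function.Bijective (coColorRev i : ColorCoIdx (rev n) i.castSucc → _) := by
  constructor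
  · intro s t h
    exact Subtype.ext (flavorRev_bijective.1 (congrArg Subtype.val h))
  · rintro ⟨t, ht⟩
    obtain ⟨s, rfl⟩ := flavorRev_bijective.2 t
    refine ⟨⟨s, ?_⟩, rfl⟩
    by_contra hs
    exact absurd (castSucc_rev_lt_rev (not_lt.1 hs)) (not_lt.2 ht)

end Reversal

/-! ### `Ψ`, `Ψ̃` and coordinates of the dual data -/

namespace HalfADHM

variable {L : ℕ} {n : Fin (L + 1) → ℕ} {k : Fin L → ℕ} (d : HalfADHM n k)

theorem dual_Ψ (i : Fin L) :
    d.dual.Ψ i = ((d.Ψt i.rev)ᵀ).submatrix (colorRev i) id := by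
  ext ⟨⟨a, s⟩, ha⟩ c
  have ha' : a < Fin.last L := lt_of_le_of_lt ha i.castSucc_lt_last
  have hle : nodeFrom a ha' ≤ i := ha
  change ((d.Υt (nodeFrom a ha').rev a.rev _)ᵀ * d.dual.Wprod (nodeFrom a ha') i hle) s c = _
  rw [d.dual_Wprod, ← Matrix.transpose_mul]
  -- The reversed node and the node found from the reversed label agree only propositionally, so the
  -- node is left arbitrary until it can be substituted.
  have : ∀ (j : Fin L) (hj : a.rev = j.succ) (hij : i.rev ≤ j) (hc : i.rev.castSucc < a.rev),
      (d.Wprod i.rev j hij * d.Υt j a.rev hj) c s = d.Ψt i.rev c ⟨⟨a.rev, s⟩, hc⟩ := by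
    intro j hj hij hc
    obtain rfl : nodeTo a.rev (lt_of_le_of_lt (Fin.zero_le _) hc) = j :=
      Fin.succ_injective _ (by rw [succ_nodeTo, hj])
    rfl
  exact this _ _ _ _

theorem dual_Ψt (i : Fin L) :
    d.dual.Ψt i = -((d.Ψ i.rev)ᵀ).submatrix id (coColorRev i) := by
  ext c ⟨⟨a, s⟩, ha⟩
  have ha' : 0 < a := lt_of_le_of_lt (Fin.zero_le _) ha
  change (d.dual.Wprod i (nodeTo a ha') (le_nodeTo ha) *
    -(d.Υ a.rev (nodeTo a ha').rev _)ᵀ) c s = _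
  rw [d.dual_Wprod, Matrix.mul_neg, ← Matrix.transpose_mul, Matrix.neg_apply, Matrix.neg_apply]
  congr 1
  have : ∀ (j : Fin L) (hj : a.rev = j.castSucc) (hij : j ≤ i.rev) (hc : a.rev ≤ i.rev.castSucc),
      (d.Υ a.rev j hj * d.Wprod j i.rev hij) s c = d.Ψ i.rev ⟨⟨a.rev, s⟩, hc⟩ c := by
    intro j hj hij hc
    obtain rfl : nodeFrom a.rev (lt_of_le_of_lt hc (Fin.castSucc_lt_last _)) = j :=
      Fin.castSucc_injective _ (by rw [castSucc_nodeFrom, hj])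
    rfl
  exact this _ _ _ _

/-- The sign in the dual `Υ̃` is the sign in `φinv`, and transposition reverses the order of the
factors; hence the dual coordinates come from the inverse of `𝒰(φ)`. -/
theorem dual_φ (z : ℂ) (a b : Fin (L + 1)) (h : a < b) :
    d.dual.φ z a b h = (d.φinv z b.rev a.rev (Fin.rev_lt_rev.2 h))ᵀ := by
  have key : ∀ (i j : Fin L) (hi : b.rev = i.castSucc) (hj : a.rev = j.succ) (hij : i ≤ j),
      d.φinv z b.rev a.rev (Fin.rev_lt_rev.2 h) =
        -(d.Υ b.rev i hi * (d.Wprod i j hij * (d.res j z)⁻¹) * d.Υt j a.rev hj) := by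
    intro i j hi hj hij
    obtain rfl : nodeTo a.rev (lt_of_le_of_lt (Fin.zero_le _) (Fin.rev_lt_rev.2 h)) = j :=
      Fin.succ_injective _ (by rw [succ_nodeTo, hj])
    obtain rfl : nodeFrom b.rev (lt_of_lt_of_le (Fin.rev_lt_rev.2 h) (Fin.le_last _)) = i :=
      Fin.castSucc_injective _ (by rw [castSucc_nodeFrom, hi])
    rfl
  set j := nodeFrom a (lt_of_lt_of_le h (Fin.le_last b)) with hjdef
  set i := nodeTo b (lt_of_le_of_lt (Fin.zero_le a) h) with hidef
  have hi : b.rev = i.rev.castSucc := by rw [← Fin.rev_succ, hidef, succ_nodeTo]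
  have hj : a.rev = j.rev.succ := by rw [← Fin.rev_castSucc, hjdef, castSucc_nodeFrom]
  rw [key i.rev j.rev hi hj (Fin.rev_le_rev.2 (nodeFrom_le_nodeTo h)), φ, d.dual_Wprod, d.dual_res,
    Matrix.transpose_neg, Matrix.transpose_mul, Matrix.transpose_mul, Matrix.transpose_mul,
    ← Matrix.transpose_nonsing_inv]
  change (d.Υt j.rev a.rev _)ᵀ * _ * _ * -(d.Υ b.rev i.rev _)ᵀ = _
  rw [Matrix.mul_neg]
  simp only [Matrix.mul_assoc]
  rfl

end HalfADHM

/-! ### Non-singularity and reconstruction from the flag -/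

section Nonsingular

variable {L : ℕ} {n : Fin (L + 1) → ℕ} {k : Fin L → ℕ}

open scoped ComplexOrder in
-- By positivity, `M M†` and `M` have the same left kernel.
theorem nonsingularAt_iff (q : ModuliMatrix n) (i : Fin L) :
    NonsingularAt q i ↔ ∀ z u, u ᵥ* evalAt (xi q i.castSucc) z = 0 → u = 0 := by
  refine forall_congr' fun z => ?_
  rw [← not_iff_not, not_not, ← Matrix.exists_vecMul_eq_zero_iff]
  push Not
  refine exists_congr fun u => ?_
  rw [Matrix.vecMul_self_mul_conjTranspose_eq_zero, and_comm]

theorem vecMul_xi_eq_zero_iff (q : ModuliMatrix n) (i : Fin L) (z : ℂ)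
    (u : ColorIdx n i.castSucc → ℂ) :
    u ᵥ* evalAt (xi q i.castSucc) z = 0 ↔
      u ᵥ* evalAt (Dmat q i) z = 0 ∧ u ᵥ* evalAt (Dtil q i) z = 0 := by
  constructor
  · intro h
    exact ⟨funext fun t => congrFun h t.val, funext fun t => congrFun h t.val⟩
  · rintro ⟨h1, h2⟩
    funext t
    by_cases ht : t.1 ≤ i.castSucc
    · exact congrFun h1 ⟨t, ht⟩
    · exact congrFun h2 ⟨t, not_le.1 ht⟩

/-- The map `u ↦ u 𝔍_i(z)` identifies the left kernel of `𝔇_i(z)` with the left eigenspace of `Z_i`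
at `z`. Under it, the condition `u 𝔇̃_i(z) = 0` becomes annihilation by `Ψ̃_i`. -/
theorem CorrVia.nonsingularAt_iff {q : ModuliMatrix n} {d : HalfADHM n k}
    {J : ∀ i : Fin L, Matrix (ColorIdx n i.castSucc) (Fin (k i)) ℂ[X]} (h : CorrVia q d J)
    (i : Fin L) : NonsingularAt q i ↔ Observable (d.Ψt i)ᵀ (d.Z i)ᵀ := by
  have hres : ∀ (z : ℂ) (v : Fin (k i) → ℂ),
      v ᵥ* (Matrix.scalar (Fin (k i)) z - d.Z i) = 0 ↔ (d.Z i)ᵀ *ᵥ v = z • v := by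
    intro z v
    rw [Matrix.vecMul_sub, Matrix.scalar_apply, ← Matrix.smul_one_eq_diagonal, Matrix.vecMul_smul,
      Matrix.vecMul_one, sub_eq_zero, Matrix.mulVec_transpose, eq_comm]
  have htil : ∀ (z : ℂ) (u : ColorIdx n i.castSucc → ℂ),
      u ᵥ* evalAt (Dtil q i) z = (u ᵥ* evalAt (J i) z) ᵥ* d.Ψt i := by
    intro z u
    rw [h.til, evalAt_mul, evalAt_map_C, Matrix.vecMul_vecMul]
  rw [FlagLump.nonsingularAt_iff]
  constructor
  · intro hns z v hv hΨ
    rw [← hres] at hv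
    rw [Matrix.mulVec_transpose] at hΨ
    obtain ⟨u, hu, huv⟩ := (h.realizes i).exists_vecMul_evalAt hv
    have := hns z u ((vecMul_xi_eq_zero_iff q i z u).2 ⟨hu, by rw [htil, huv, hΨ]⟩)
    rw [← huv, this, Matrix.zero_vecMul]
  · intro hobs z u hu
    obtain ⟨h1, h2⟩ := (vecMul_xi_eq_zero_iff q i z u).1 hu
    rw [htil] at h2
    refine (h.realizes i).eq_zero_of_vecMul_evalAt h1 ?_
    exact hobs z _ ((hres z _).1 ((h.realizes i).vecMul_evalAt_charmatrix h1))
      (by rw [Matrix.mulVec_transpose]; exact h2)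

theorem joinCols_mul_transpose {R r s : Type} [Semiring R] {a : Fin (L + 1)}
    (A : Matrix r (ColorIdx n a) R) (B : Matrix r (ColorCoIdx n a) R)
    (A' : Matrix s (ColorIdx n a) R) (B' : Matrix s (ColorCoIdx n a) R) :
    joinCols A B * (joinCols A' B')ᵀ = A * A'ᵀ + B * B'ᵀ := by
  ext i j
  simp only [Matrix.mul_apply, Matrix.add_apply, Matrix.transpose_apply, sum_flavorIdx a,
    joinCols_color, joinCols_coColor]

/-- At a non-singular node, `ξ` has a polynomial right inverse. -/
theorem CorrVia.exists_right_inverse {q : ModuliMatrix n} {d : HalfADHM n k}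
    {J : ∀ i : Fin L, Matrix (ColorIdx n i.castSucc) (Fin (k i)) ℂ[X]} (h : CorrVia q d J)
    (i : Fin L) (hi : NonsingularAt q i) :
    ∃ E : Matrix (FlavorIdx n) (ColorIdx n i.castSucc) ℂ[X], xi q i.castSucc * E = 1 := by
  obtain ⟨P, Q, hPQ⟩ := ((h.nonsingularAt_iff i).1 hi).exists_bezout
  obtain ⟨A, B, hAB⟩ := (h.realizes i).exists_bezout
  have h1 : (d.Ψt i).map Polynomial.C * Pᵀ + (d.Z i).charmatrix * Qᵀ = 1 := by
    have := congrArg Matrix.transpose hPQ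
    rw [Matrix.transpose_add, Matrix.transpose_mul, Matrix.transpose_mul,
      Matrix.charmatrix_transpose, Matrix.transpose_transpose, Matrix.transpose_one] at this
    exact this
  -- Multiplying the Bezout identity for `Ψ̃` by `𝔍_i` on the left puts `𝔍_i` in the column lattice
  -- of `ξ_i`; substitution into `𝔇_i A + 𝔍_i B = 1` gives the right inverse.
  have h2 : J i = Dtil q i * Pᵀ + Dmat q i * ((d.Ψ i).map Polynomial.C * Qᵀ) := by
    rw [h.til, ← Matrix.mul_assoc, (h.realizes i).eq, Matrix.mul_assoc, Matrix.mul_assoc,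
      ← Matrix.mul_add, h1, Matrix.mul_one]
  refine ⟨(joinCols (A + (d.Ψ i).map Polynomial.C * Qᵀ * B.map Polynomial.C)ᵀ
    (Pᵀ * B.map Polynomial.C)ᵀ)ᵀ, ?_⟩
  rw [xi_eq_joinCols, joinCols_mul_transpose, Matrix.transpose_transpose,
    Matrix.transpose_transpose, ← hAB]
  conv_rhs => rw [h2]
  simp only [Matrix.mul_add, Matrix.add_mul, Matrix.mul_assoc]
  abel

theorem mem_lumpFlag {q : ModuliMatrix n} {z : ℂ} {i : Fin L} {w : FlavorIdx n → ℂ} :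
    w ∈ lumpFlag q z i ↔ ∃ u, u ᵥ* evalAt (xi q i.castSucc) z = w := by
  have : lumpFlag q z i = LinearMap.range (evalAt (xi q i.castSucc) z).vecMulLinear :=
    (range_vecMulLinear _).symm
  rw [this]
  rfl

theorem row_mem_lumpFlag (q : ModuliMatrix n) (z : ℂ) (i : Fin L) (r : ColorIdx n i.castSucc) :
    evalAt (xi q i.castSucc) z r ∈ lumpFlag q z i := Submodule.subset_span ⟨r, rfl⟩

theorem lumpFlag_le_of_xi_eq {q q' : ModuliMatrix n} {i : Fin L}
    {V : Matrix (ColorIdx n i.castSucc) (ColorIdx n i.castSucc) ℂ[X]}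
    (h : xi q' i.castSucc = V * xi q i.castSucc) (z : ℂ) : lumpFlag q' z i ≤ lumpFlag q z i := by
  intro w hw
  obtain ⟨u, rfl⟩ := mem_lumpFlag.1 hw
  exact mem_lumpFlag.2 ⟨u ᵥ* evalAt V z, by rw [Matrix.vecMul_vecMul, ← evalAt_mul, ← h]⟩

theorem lumpFlag_eq_of_vEquiv {q q' : ModuliMatrix n} (h : VEquiv q q') (z : ℂ) :
    lumpFlag q z = lumpFlag q' z := by
  have key : ∀ {q q' : ModuliMatrix n}, VEquiv q q' → ∀ i, lumpFlag q' z i ≤ lumpFlag q z i := by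
    rintro q q' ⟨V, hV, hq⟩ i
    exact lumpFlag_le_of_xi_eq (xi_eq_of_vEquiv hV hq _) z
  exact funext fun i => le_antisymm (key h.symm i) (key h i)

/-- Pointwise inclusion of flags gives `ξ'(z) = U ξ(z)` with `U` depending on `z` in no controlled
way; the right inverse `E` shows that `U` is the value of the polynomial matrix `ξ' E`. -/
theorem exists_mul_xi_eq {q q' : ModuliMatrix n} {i : Fin L}
    {E : Matrix (FlavorIdx n) (ColorIdx n i.castSucc) ℂ[X]} (hE : xi q i.castSucc * E = 1)
    (h : ∀ z, lumpFlag q' z i ≤ lumpFlag q z i) :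
    xi q' i.castSucc = (xi q' i.castSucc * E) * xi q i.castSucc := by
  refine eq_of_evalAt_eq fun z => ?_
  have : ∀ r, ∃ u, u ᵥ* evalAt (xi q i.castSucc) z = evalAt (xi q' i.castSucc) z r := fun r =>
    mem_lumpFlag.1 (h z (row_mem_lumpFlag q' z i r))
  choose U hU using this
  have hU' : evalAt (xi q' i.castSucc) z = Matrix.of U * evalAt (xi q i.castSucc) z :=
    Matrix.ext_row fun r => (hU r).symm
  rw [evalAt_mul, evalAt_mul, hU', Matrix.mul_assoc (Matrix.of U), ← evalAt_mul, hE, evalAt_one,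
    Matrix.mul_one]

/-- Here `ξ' = (ξ' E) ξ` and `ξ = (ξ E') ξ'`, so `(ξ' E) (ξ E') = ξ' E' = 1` and the transition
matrices are unimodular. -/
theorem vEquiv_of_lumpFlag_eq {q q' : ModuliMatrix n} (hq : IsLump q k) (hq' : IsLump q' k)
    (h : ∀ z, lumpFlag q z = lumpFlag q' z) : VEquiv q q' := by
  obtain ⟨d, J, hJ⟩ := exists_corrVia_of_isVortex hq.1
  obtain ⟨d', J', hJ'⟩ := exists_corrVia_of_isVortex hq'.1
  choose E hE using fun i => hJ.exists_right_inverse i (hq.2 i)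
  choose E' hE' using fun i => hJ'.exists_right_inverse i (hq'.2 i)
  have h1 := fun i => exists_mul_xi_eq (q' := q') (hE i) fun z => (congrFun (h z) i).ge
  have h2 := fun i => exists_mul_xi_eq (q' := q) (hE' i) fun z => (congrFun (h z) i).le
  have hunit : ∀ i, xi q' i.castSucc * E i * (xi q i.castSucc * E' i) = 1 := fun i => by
    rw [← Matrix.mul_assoc, ← h1, hE']
  let V : ∀ i : Fin L, (Matrix (ColorIdx n i.castSucc) (ColorIdx n i.castSucc) ℂ[X])ˣ :=
    fun i => ⟨_, _, hunit i, mul_eq_one_comm.1 (hunit i)⟩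
  let U : ∀ m : Fin (L + 1), (Matrix (ColorIdx n m) (ColorIdx n m) ℂ[X])ˣ :=
    Fin.lastCases 1 V
  have hUl : U (Fin.last L) = 1 := Fin.lastCases_last
  have hUc : ∀ i : Fin L, U i.castSucc = V i := fun i => Fin.lastCases_castSucc i
  refine vEquiv_of_xi_eq (fun i => hq.1.det_ne_zero i) U hUl fun m => ?_
  cases m using Fin.lastCases with
  | last => rw [hUl, xi_last, xi_last, Units.val_one, Matrix.one_mul]
  | cast i => rw [hUc]; exact h1 i

end Nonsingular

/-! ### Flags at a point and inhomogeneous coordinates -/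

section Flags

variable {L : ℕ} {n : Fin (L + 1) → ℕ} {k : Fin L → ℕ}

theorem finrank_span_rows {r c : Type} [Fintype r] {M : Matrix r c ℂ}
    (h : ∀ u, u ᵥ* M = 0 → u = 0) :
    Module.finrank ℂ (Submodule.span ℂ (Set.range fun i => M i)) = Fintype.card r := by
  refine finrank_span_eq_card (Fintype.linearIndependent_iff.2 fun g hg => congrFun (h g ?_))
  rw [← hg]
  funext j
  simp [Matrix.vecMul, dotProduct]

theorem finrank_flagOf {G : Matrix (FlavorIdx n) (FlavorIdx n) ℂ} (hG : IsUnit G) (i : Fin L) :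
    Module.finrank ℂ (flagOf G i) = Fintype.card (ColorIdx n i.castSucc) := by
  have := (Matrix.linearIndependent_rows_iff_isUnit.2 hG).comp
    (Subtype.val : ColorIdx n i.castSucc → FlavorIdx n) Subtype.val_injective
  exact finrank_span_eq_card this

theorem finrank_lumpFlag {q : ModuliMatrix n} {z : ℂ} {i : Fin L}
    (h : ∀ u, u ᵥ* evalAt (xi q i.castSucc) z = 0 → u = 0) :
    Module.finrank ℂ (lumpFlag q z i) = Fintype.card (ColorIdx n i.castSucc) :=
  finrank_span_rows h

/-- The row space of `ξ_m(z)`, for all labels `m`. -/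
noncomputable def xiFlag (q : ModuliMatrix n) (z : ℂ) (m : Fin (L + 1)) : Submodule ℂ (FlavorIdx n → ℂ) :=
  LinearMap.range (evalAt (xi q m) z).vecMulLinear

theorem lumpFlag_eq_xiFlag (q : ModuliMatrix n) (z : ℂ) (i : Fin L) :
    lumpFlag q z i = xiFlag q z i.castSucc := (range_vecMulLinear _).symm

theorem xiFlag_monotone (q : ModuliMatrix n) (z : ℂ) : Monotone (xiFlag q z) := by
  refine Fin.monotone_iff_le_succ.2 fun i => ?_
  rintro _ ⟨u, rfl⟩
  refine ⟨u ᵥ* evalAt (q i) z, ?_⟩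
  simp only [Matrix.vecMulLinear_apply]
  rw [Matrix.vecMul_vecMul, ← evalAt_mul, ← xi_castSucc]

theorem xiFlag_last (q : ModuliMatrix n) (z : ℂ) : xiFlag q z (Fin.last L) = ⊤ := by
  rw [Submodule.eq_top_iff']
  intro w
  refine ⟨fun t => w t.val, ?_⟩
  funext t
  simp only [Matrix.vecMulLinear_apply, xi_last, Matrix.vecMul, dotProduct]
  rw [Finset.sum_eq_single ⟨t, Fin.le_last _⟩]
  · change w t * Polynomial.eval z ((1 : Matrix (FlavorIdx n) (FlavorIdx n) ℂ[X]) t t) = w t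
    rw [Matrix.one_apply_eq, Polynomial.eval_one, mul_one]
  · intro s _ hs
    have : s.val ≠ t := fun h => hs (Subtype.ext h)
    change w s * Polynomial.eval z ((1 : Matrix (FlavorIdx n) (FlavorIdx n) ℂ[X]) s t) = 0
    rw [Matrix.one_apply_ne this, Polynomial.eval_zero, mul_zero]
  · simp

theorem card_colorIdx (m : Fin (L + 1)) :
    Fintype.card (ColorIdx n m) = ∑ a ∈ Finset.Iic m, n a := by
  rw [Fintype.card_congr (Equiv.subtypeSigmaEquiv (fun a => Fin (n a)) fun a => a ≤ m),
    Fintype.card_sigma]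
  simp only [Fintype.card_fin]
  exact Finset.sum_subtype _ (fun a => by simp) n |>.symm

theorem card_colorIdx_succ (i : Fin L) :
    Fintype.card (ColorIdx n i.succ) = Fintype.card (ColorIdx n i.castSucc) + n i.succ := by
  rw [card_colorIdx, card_colorIdx]
  have : Finset.Iic i.succ = insert i.succ (Finset.Iic i.castSucc) := by
    ext a
    simp only [Finset.mem_Iic, Finset.mem_insert, Fin.le_castSucc_iff]
    exact le_iff_eq_or_lt
  rw [this, Finset.sum_insert (by simp), add_comm (n i.succ)]

theorem finrank_xiFlag {q : ModuliMatrix n} {z : ℂ}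
    (h : ∀ i : Fin L, ∀ u, u ᵥ* evalAt (xi q i.castSucc) z = 0 → u = 0) (m : Fin (L + 1)) :
    Module.finrank ℂ (xiFlag q z m) = Fintype.card (ColorIdx n m) := by
  cases m using Fin.lastCases with
  | last =>
    rw [xiFlag_last, finrank_top, Module.finrank_fintype_fun_eq_card]
    let e : ColorIdx n (Fin.last L) ≃ FlavorIdx n :=
      Equiv.subtypeUnivEquiv fun t : FlavorIdx n => Fin.le_last t.1
    exact (Fintype.card_congr e).symm
  | cast i => rw [← lumpFlag_eq_xiFlag, finrank_lumpFlag (h i)]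

theorem exists_sup_span_range_eq {V : Type*} [AddCommGroup V] [Module ℂ V] [FiniteDimensional ℂ V]
    {A B : Submodule ℂ V} (hAB : A ≤ B) {m : ℕ}
    (h : Module.finrank ℂ B = Module.finrank ℂ A + m) :
    ∃ v : Fin m → V, A ⊔ Submodule.span ℂ (Set.range v) = B := by
  obtain ⟨C, hC⟩ := A.exists_isCompl
  have h1 : A ⊔ C ⊓ B = B := by
    rw [← sup_inf_assoc_of_le C hAB, hC.sup_eq_top, top_inf_eq]
  have h2 : A ⊓ (C ⊓ B) = ⊥ := by rw [← inf_assoc, hC.inf_eq_bot, bot_inf_eq]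
  have h3 := Submodule.finrank_sup_add_finrank_inf_eq A (C ⊓ B)
  rw [h1, h2, finrank_bot] at h3
  let b := Module.finBasisOfFinrankEq ℂ (C ⊓ B : Submodule ℂ V) (n := m) (by omega)
  refine ⟨fun i => b i, ?_⟩
  have : Submodule.span ℂ (Set.range fun i => (b i : V)) = C ⊓ B := by
    change Submodule.span ℂ (Set.range fun i => (C ⊓ B).subtype (b i)) = _
    rw [Set.range_comp', Submodule.span_image, b.span_eq, Submodule.map_top, Submodule.range_subtype]
  rw [this, h1]

/-- At each label `a`, choose `n a` vectors completing the previous row space to the next. The last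
row space is everything, so together they form a basis of `ℂ^N`. -/
theorem exists_flagOf_eq {q : ModuliMatrix n} {z : ℂ}
    (h : ∀ i : Fin L, ∀ u, u ᵥ* evalAt (xi q i.castSucc) z = 0 → u = 0) :
    ∃ G : GL (FlavorIdx n) ℂ, flagOf G.val = lumpFlag q z := by
  have hstep : ∀ a : Fin (L + 1), ∃ v : Fin (n a) → FlavorIdx n → ℂ,
      -- The supremum over earlier labels is the previous space, and zero at the first label, so
      -- both cases share one statement.
      (⨆ b : {b : Fin (L + 1) // b < a}, xiFlag q z b) ⊔ Submodule.span ℂ (Set.range v) =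
        xiFlag q z a := by
    intro a
    refine exists_sup_span_range_eq (iSup_le fun b => xiFlag_monotone q z b.2.le) ?_
    rw [finrank_xiFlag h]
    cases a using Fin.cases with
    | zero =>
      have : (⨆ b : {b : Fin (L + 1) // b < 0}, xiFlag q z b) = ⊥ :=
        iSup_eq_bot.2 fun b => absurd b.2 (Fin.not_lt_zero _)
      rw [this, finrank_bot, zero_add, card_colorIdx]
      have : Finset.Iic (0 : Fin (L + 1)) = {0} := by ext a; simp
      rw [this, Finset.sum_singleton]
    | succ i =>
      have : (⨆ b : {b : Fin (L + 1) // b < i.succ}, xiFlag q z b) = xiFlag q z i.castSucc :=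
        le_antisymm (iSup_le fun b => xiFlag_monotone q z (Fin.le_castSucc_iff.2 b.2))
          (le_iSup (fun b : {b : Fin (L + 1) // b < i.succ} => xiFlag q z b)
            ⟨i.castSucc, i.castSucc_lt_succ⟩)
      rw [this, finrank_xiFlag h, card_colorIdx_succ]
  choose v hv using hstep
  let G : Matrix (FlavorIdx n) (FlavorIdx n) ℂ := Matrix.of fun t => v t.1 t.2
  have hspan : ∀ m : Fin (L + 1),
      Submodule.span ℂ (Set.range fun r : ColorIdx n m => G r.val) = xiFlag q z m := by
    intro m
    refine le_antisymm (Submodule.span_le.2 ?_) ?_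
    · rintro _ ⟨⟨t, ht⟩, rfl⟩
      refine xiFlag_monotone q z ht ?_
      rw [← hv]
      exact Submodule.mem_sup_right (Submodule.subset_span ⟨t.2, rfl⟩)
    · induction m using WellFoundedLT.induction with
      | ind m ih =>
        rw [← hv m]
        refine sup_le (iSup_le fun b => (ih b b.2).trans (Submodule.span_mono ?_))
          (Submodule.span_mono ?_)
        · rintro _ ⟨t, rfl⟩
          exact ⟨colorUp b.2.le t, rfl⟩
        · rintro _ ⟨s, rfl⟩
          exact ⟨colorTop m s, rfl⟩
  have hG : IsUnit G := by
    refine Matrix.linearIndependent_rows_iff_isUnit.1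
      (linearIndependent_of_top_le_span_of_card_eq_finrank ?_ ?_)
    · rw [← xiFlag_last q z, ← hspan]
      refine Submodule.span_mono ?_
      rintro _ ⟨t, rfl⟩
      exact ⟨t.val, rfl⟩
    · rw [Module.finrank_fintype_fun_eq_card]
  obtain ⟨g, hg⟩ := hG
  exact ⟨g, funext fun i => by rw [hg, lumpFlag_eq_xiFlag, ← hspan]; rfl⟩

/-- In the coordinate patch, `ξ_i(z)` has the same row space as `(1, Ψ_i (z - Z_i)⁻¹ Ψ̃_i)`. -/
theorem CorrVia.mem_lumpFlag_iff {q : ModuliMatrix n} {d : HalfADHM n k}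
    {J : ∀ i : Fin L, Matrix (ColorIdx n i.castSucc) (Fin (k i)) ℂ[X]} (h : CorrVia q d J)
    {z : ℂ} {i : Fin L} (hz : (evalAt (Dmat q i) z).det ≠ 0) {w : FlavorIdx n → ℂ} :
    w ∈ lumpFlag q z i ↔
      (fun t : ColorCoIdx n i.castSucc => w t.val) =
        (fun t : ColorIdx n i.castSucc => w t.val) ᵥ* (d.Ψ i * (d.res i z)⁻¹ * d.Ψt i) := by
  set D := evalAt (Dmat q i) z with hD
  have hDD : D * D⁻¹ = 1 := Matrix.mul_nonsing_inv _ (isUnit_iff_ne_zero.2 hz)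
  have hDD' : D⁻¹ * D = 1 := Matrix.nonsing_inv_mul _ (isUnit_iff_ne_zero.2 hz)
  have hR : d.res i z * (d.res i z)⁻¹ = 1 :=
    Matrix.mul_nonsing_inv _ (isUnit_iff_ne_zero.2
      (((h.realizes i).det_evalAt_ne_zero_iff z).1 hz))
  have hDΨ : D * d.Ψ i = evalAt (J i) z * d.res i z := by
    have := congrArg (evalAt · z) (h.realizes i).eq
    simp only [evalAt_mul, evalAt_map_C, evalAt_charmatrix] at this
    exact this
  have hT : evalAt (Dtil q i) z = D * (d.Ψ i * (d.res i z)⁻¹ * d.Ψt i) := by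
    rw [← Matrix.mul_assoc, ← Matrix.mul_assoc, hDΨ, Matrix.mul_assoc (evalAt (J i) z), hR,
      Matrix.mul_one, h.til, evalAt_mul, evalAt_map_C]
  rw [mem_lumpFlag]
  constructor
  · rintro ⟨u, rfl⟩
    change u ᵥ* evalAt (Dtil q i) z = (u ᵥ* D) ᵥ* _
    rw [hT, Matrix.vecMul_vecMul]
  · intro hw
    refine ⟨(fun t : ColorIdx n i.castSucc => w t.val) ᵥ* D⁻¹, ?_⟩
    funext t
    by_cases ht : t.1 ≤ i.castSucc
    · have : (((fun t : ColorIdx n i.castSucc => w t.val) ᵥ* D⁻¹) ᵥ* D) ⟨t, ht⟩ = w t := by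
        rw [Matrix.vecMul_vecMul, hDD', Matrix.vecMul_one]
      exact this
    · have : (((fun t : ColorIdx n i.castSucc => w t.val) ᵥ* D⁻¹) ᵥ* evalAt (Dtil q i) z)
          ⟨t, not_le.1 ht⟩ = w t := by
        rw [hT, Matrix.vecMul_vecMul, ← Matrix.mul_assoc, hDD', Matrix.one_mul, ← hw]
      exact this

/-- In the patch the `i`-th space is the graph of `Ψ_i (z - Z_i)⁻¹ Ψ̃_i`. A row of `𝒰(f)` in the
last block of the node has a unit vector before the cut and entries of `f` after it, so membership
compares `f` with `Υ_i (z - Z_i)⁻¹ Ψ̃_i`, whose blocks are those of `φ`. -/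
theorem unitriangular_row_mem_iff {q : ModuliMatrix n} {d : HalfADHM n k}
    {J : ∀ i : Fin L, Matrix (ColorIdx n i.castSucc) (Fin (k i)) ℂ[X]} (h : CorrVia q d J)
    {z : ℂ} {i : Fin L} (hz : (evalAt (Dmat q i) z).det ≠ 0) (f : Blocks n)
    (s : Fin (n i.castSucc)) :
    unitriangular f ⟨i.castSucc, s⟩ ∈ lumpFlag q z i ↔
      ∀ b (hb : i.castSucc < b) t, f i.castSucc b hb s t = d.φ z i.castSucc b hb s t := by
  rw [h.mem_lumpFlag_iff hz]
  have h1 : (fun t : ColorIdx n i.castSucc => unitriangular f ⟨i.castSucc, s⟩ t.val) =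
      Pi.single (colorTop _ s) 1 := by
    funext t
    have ht : ¬ i.castSucc < t.val.1 := not_lt.2 t.property
    change (if h : i.castSucc < t.val.1 then f i.castSucc t.val.1 h s t.val.2 else
      if (⟨i.castSucc, s⟩ : FlavorIdx n) = t.val then (1 : ℂ) else 0) = _
    rw [dif_neg ht]
    by_cases hts : t = colorTop _ s
    · rw [hts, Pi.single_eq_same]; exact if_pos rfl
    · rw [Pi.single_eq_of_ne hts, if_neg]
      intro h; exact hts (Subtype.ext h.symm)
  have h2 : ∀ t : ColorCoIdx n i.castSucc, unitriangular f ⟨i.castSucc, s⟩ t.val =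
      f i.castSucc t.val.1 t.property s t.val.2 := fun t => dif_pos t.property
  have h3 : ∀ t : ColorCoIdx n i.castSucc,
      (d.Ψ i * (d.res i z)⁻¹ * d.Ψt i) (colorTop _ s) t =
        d.φ z i.castSucc t.val.1 t.property s t.val.2 := by
    intro t
    have : (d.Ψ i * (d.res i z)⁻¹ * d.Ψt i).submatrix (colorTop _) id =
        d.Υ i.castSucc i rfl * (d.res i z)⁻¹ * d.Ψt i := by
      rw [← d.Ψ_colorTop]; rfl
    have h4 := congrFun (congrFun this s) t
    refine h4.trans ?_
    rw [HalfADHM.φ, Matrix.mul_assoc _ (d.Wprod _ _ _)]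
    rfl
  rw [h1, Matrix.single_one_vecMul]
  constructor
  · intro h b hb t
    have := congrFun h ⟨⟨b, t⟩, hb⟩
    rw [h2] at this
    exact this.trans (h3 ⟨⟨b, t⟩, hb⟩)
  · intro h
    funext t
    rw [h2, h]
    exact (h3 t).symm

theorem CorrVia.flagOf_unitriangular_eq_iff {q : ModuliMatrix n} {d : HalfADHM n k}
    {J : ∀ i : Fin L, Matrix (ColorIdx n i.castSucc) (Fin (k i)) ℂ[X]} (h : CorrVia q d J)
    {z : ℂ} (hz : ∀ i, (evalAt (Dmat q i) z).det ≠ 0) (f : Blocks n) :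
    flagOf (unitriangular f) = lumpFlag q z ↔ f = d.φ z := by
  constructor
  · intro hf
    have key : ∀ (i : Fin L) b (hb : i.castSucc < b), f i.castSucc b hb = d.φ z i.castSucc b hb := by
      intro i b hb
      ext s t
      refine (unitriangular_row_mem_iff h (hz i) f s).1 ?_ b hb t
      rw [← hf]
      exact Submodule.subset_span ⟨colorTop _ s, rfl⟩
    funext a b hab
    exact key (nodeFrom a (lt_of_lt_of_le hab (Fin.le_last b))) b hab
  · rintro rfl
    have hU : IsUnit (unitriangular (d.φ z)) :=
      IsUnit.of_mul_eq_one _ (d.unitriangular_φ_mul z fun i =>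
        ((h.realizes i).det_evalAt_ne_zero_iff z).1 (hz i))
    funext i
    refine Submodule.eq_of_le_of_finrank_eq (Submodule.span_le.2 ?_) ?_
    · rintro _ ⟨⟨⟨a, s⟩, ha⟩, rfl⟩
      have ha' : a < Fin.last L := lt_of_le_of_lt ha i.castSucc_lt_last
      have h1 := (unitriangular_row_mem_iff h (hz (nodeFrom a ha')) (d.φ z) s).2
        fun _ _ _ => rfl
      -- A row in block `a` is known to lie in the space of its own node; nestedness puts it into
      -- all later spaces.
      rw [lumpFlag_eq_xiFlag] at h1
      rw [lumpFlag_eq_xiFlag]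
      exact xiFlag_monotone q z ha h1
    · rw [finrank_flagOf hU, finrank_lumpFlag]
      intro u hu
      have h1 := ((vecMul_xi_eq_zero_iff q i z u).1 hu).1
      by_contra hu0
      exact hz i (Matrix.exists_vecMul_eq_zero_iff.1 ⟨u, hu0, h1⟩)

end Flags

/-! ### Invariance of observability under reindexing and sign -/

section Observability

variable {r r' κ : Type} [Fintype κ] {Ψ : Matrix r κ ℂ} {Z : Matrix κ κ ℂ}

theorem observable_submatrix_iff {e : r' → r} (he : Function.Surjective e) :
    Observable (Ψ.submatrix e id) Z ↔ Observable Ψ Z := by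
  refine forall₃_congr fun μ v _ => imp_congr_left ⟨fun h => funext fun i => ?_, fun h => ?_⟩
  · obtain ⟨j, rfl⟩ := he i
    exact congrFun h j
  · exact funext fun j => congrFun h (e j)

theorem observable_neg_iff : Observable (-Ψ) Z ↔ Observable Ψ Z := by
  refine forall₃_congr fun μ v _ => ?_
  rw [Matrix.neg_mulVec, neg_eq_zero]

end Observability

/-! ### Duality of data, coordinates and orbits -/

section Duality

variable {L : ℕ} {n : Fin (L + 1) → ℕ} {k : Fin L → ℕ}

namespace HalfADHM

theorem freeΨ_iff (d : HalfADHM n k) (i : Fin L) : d.FreeΨ i ↔ Observable (d.Ψ i) (d.Z i) :=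
  free_iff_observable

theorem freeΨt_iff (d : HalfADHM n k) (i : Fin L) :
    d.FreeΨt i ↔ Observable (d.Ψt i)ᵀ (d.Z i)ᵀ :=
  free_iff_observable_transpose

theorem freeΨ_iff_resolvent (d : HalfADHM n k) (i : Fin L) :
    d.FreeΨ i ↔ ∀ v : Fin (k i) → ℂ,
      (∀ z, (d.res i z).det ≠ 0 → (d.Ψ i * (d.res i z)⁻¹) *ᵥ v = 0) → v = 0 :=
  (d.freeΨ_iff i).trans observable_iff_resolvent

theorem freeΨt_iff_resolvent (d : HalfADHM n k) (i : Fin L) :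
    d.FreeΨt i ↔ ∀ v : Fin (k i) → ℂ,
      (∀ z, (d.res i z).det ≠ 0 → v ᵥ* ((d.res i z)⁻¹ * d.Ψt i) = 0) → v = 0 := by
  have hres : ∀ z, Matrix.scalar (Fin (k i)) z - (d.Z i)ᵀ = (d.res i z)ᵀ := fun z => by
    rw [res, Matrix.transpose_sub]
    congr 1
    exact (Matrix.diagonal_transpose _).symm
  rw [freeΨt_iff, observable_iff_resolvent]
  refine forall_congr' fun v => imp_congr_left (forall_congr' fun z => ?_)
  rw [hres, Matrix.det_transpose, ← Matrix.transpose_nonsing_inv, ← Matrix.transpose_mul,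
    Matrix.mulVec_transpose]

theorem dual_freeΨ_iff (d : HalfADHM n k) (i : Fin L) : d.dual.FreeΨ i ↔ d.FreeΨt i.rev := by
  rw [freeΨ_iff, freeΨt_iff, dual_Ψ]
  exact observable_submatrix_iff (colorRev_bijective i).2

theorem dual_freeΨt_iff (d : HalfADHM n k) (i : Fin L) : d.dual.FreeΨt i ↔ d.FreeΨ i.rev := by
  rw [freeΨ_iff, freeΨt_iff, dual_Ψt, Matrix.transpose_neg, observable_neg_iff]
  exact observable_submatrix_iff (Ψ := d.Ψ i.rev) (Z := d.Z i.rev) (coColorRev_bijective i).2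

end HalfADHM

theorem dualG_eq (G : Matrix (FlavorIdx n) (FlavorIdx n) ℂ) :
    dualG G = (Gᵀ⁻¹).submatrix flavorRev flavorRev := by
  have hR : Rmat n = (1 : Matrix (FlavorIdx n) (FlavorIdx n) ℂ).submatrix flavorRev id := by
    ext s t
    rw [Matrix.submatrix_apply, Matrix.one_apply]
    exact if_congr Iff.rfl rfl rfl
  have hRH : (Rmat n)ᴴ = (1 : Matrix (FlavorIdx n) (FlavorIdx n) ℂ).submatrix id flavorRev := by
    rw [hR, Matrix.conjTranspose_submatrix, Matrix.conjTranspose_one]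
  have h1 : Rmat n * Gᵀ⁻¹ = (Gᵀ⁻¹).submatrix flavorRev id := by
    rw [hR]
    conv_rhs => rw [← Matrix.one_mul (Gᵀ⁻¹)]
    rfl
  rw [dualG, h1, hRH]
  conv_rhs => rw [← Matrix.mul_one (Gᵀ⁻¹)]
  rfl

theorem dualG_mul {G : Matrix (FlavorIdx n) (FlavorIdx n) ℂ} (hG : IsUnit G) :
    (Gᵀ).submatrix flavorRev flavorRev * dualG G = 1 := by
  rw [dualG_eq, ← Matrix.submatrix_mul _ _ _ _ _ flavorRev_bijective, Matrix.mul_nonsing_inv,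
    Matrix.submatrix_one _ flavorRev_bijective.1]
  rw [Matrix.det_transpose]
  exact (Matrix.isUnit_iff_isUnit_det _).1 hG

theorem HalfADHM.unitriangular_dual_φ (d : HalfADHM n k) (z : ℂ)
    (hz : ∀ i, (d.res i z).det ≠ 0) :
    unitriangular (d.dual.φ z) = dualG (unitriangular (d.φ z)) := by
  rw [dualG_eq, ← Matrix.transpose_nonsing_inv,
    Matrix.inv_eq_right_inv (d.unitriangular_φ_mul z hz)]
  ext s t
  change (if h : s.1 < t.1 then d.dual.φ z s.1 t.1 h s.2 t.2 else if s = t then 1 else 0) =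
    if h : t.1.rev < s.1.rev then d.φinv z t.1.rev s.1.rev h t.2 s.2 else
      if flavorRev t = flavorRev s then 1 else 0
  by_cases h : s.1 < t.1
  · rw [dif_pos h, dif_pos (Fin.rev_lt_rev.2 h), d.dual_φ]
    rfl
  · rw [dif_neg h, dif_neg (fun h' => h (Fin.rev_lt_rev.1 h'))]
    exact if_congr (eq_comm.trans flavorRev_bijective.1.eq_iff.symm) rfl rfl

/-- A family indexed through the reversal. -/
theorem exists_forall_rev_eq {m : ℕ} {P : Fin m → Type*} (f : ∀ i : Fin m, P i.rev) :
    ∃ g : ∀ i, P i, ∀ i : Fin m, g i.rev = f i :=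
  ⟨Equiv.piCongrLeft P Fin.revPerm f, fun i => Equiv.piCongrLeft_apply_apply P Fin.revPerm f i⟩

theorem exists_forall_rev_rev_eq {m m' : ℕ} {P : Fin m → Fin m' → Type*}
    (f : ∀ (i : Fin m) (j : Fin m'), P i.rev j.rev) :
    ∃ g : ∀ i j, P i j, ∀ i j, g (Fin.rev i) (Fin.rev j) = f i j := by
  choose g hg using fun i => exists_forall_rev_eq (P := P (Fin.rev i)) (f i)
  obtain ⟨g', hg'⟩ := exists_forall_rev_eq (P := fun i => ∀ j, P i j) g
  exact ⟨g', fun i j => by rw [hg', hg]⟩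

theorem rev_eq_castSucc_iff {a : Fin (L + 1)} {i : Fin L} :
    a.rev = i.rev.castSucc ↔ a = i.succ := by
  rw [← Fin.rev_succ, Fin.rev_inj]

theorem rev_eq_succ_iff {a : Fin (L + 1)} {i : Fin L} : a.rev = i.rev.succ ↔ a = i.castSucc := by
  rw [← Fin.rev_castSucc, Fin.rev_inj]

theorem rev_succ_eq_castSucc_iff {i j : Fin L} :
    i.rev.succ = j.rev.castSucc ↔ j.succ = i.castSucc := by
  rw [← Fin.rev_succ, ← Fin.rev_castSucc, Fin.rev_inj, eq_comm]

/-- Double reversal is not the identity by definition, so `dual` cannot simply be applied twice; a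
preimage is built field by field, with the sign now on `Υ`. -/
theorem HalfADHM.exists_dual_eq (e : HalfADHM (rev n) (rev k)) :
    ∃ d : HalfADHM n k, d.dual = e := by
  obtain ⟨Z, hZ⟩ := exists_forall_rev_eq (P := fun i => Matrix (Fin (k i)) (Fin (k i)) ℂ)
    fun i => (e.Z i)ᵀ
  obtain ⟨U, hU⟩ := exists_forall_rev_rev_eq
    (P := fun a i => a = i.castSucc → Matrix (Fin (n a)) (Fin (k i)) ℂ)
    fun a i h => -(e.Υt i a (rev_eq_castSucc_iff.1 h))ᵀ
  obtain ⟨V, hV⟩ := exists_forall_rev_rev_eq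
    (P := fun i a => a = i.succ → Matrix (Fin (k i)) (Fin (n a)) ℂ)
    fun i a h => (e.Υ a i (rev_eq_succ_iff.1 h))ᵀ
  obtain ⟨W, hW⟩ := exists_forall_rev_rev_eq
    (P := fun i j => i.succ = j.castSucc → Matrix (Fin (k i)) (Fin (k j)) ℂ)
    fun i j h => (e.W j i (rev_succ_eq_castSucc_iff.1 h))ᵀ
  have hc : ∀ (i j : Fin L) (h : i.succ = j.castSucc),
      Z i * W i j h - W i j h * Z j = V i i.succ rfl * U i.succ j h := by
    have key : ∀ (i j : Fin L) (h : i.succ = j.castSucc) (a : Fin (L + 1)) (ha : a = i.succ),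
        Z i * W i j h - W i j h * Z j = V i a ha * U a j (ha.trans h) := by
      intro i j h a ha
      obtain ⟨i, rfl⟩ := Fin.rev_surjective i
      obtain ⟨j, rfl⟩ := Fin.rev_surjective j
      obtain ⟨a, rfl⟩ := Fin.rev_surjective a
      obtain rfl := rev_eq_castSucc_iff.1 (ha.trans h)
      rw [hZ, hZ, hW, hV, hU, Matrix.mul_neg, ← Matrix.transpose_mul, ← Matrix.transpose_mul,
        ← Matrix.transpose_mul, ← e.constraint, Matrix.transpose_sub, neg_sub]
    exact fun i j h => key i j h _ rfl
  refine ⟨⟨Z, U, V, W, hc⟩, ?_⟩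
  obtain ⟨eZ, eU, eV, eW, _⟩ := e
  simp only [HalfADHM.dual, HalfADHM.mk.injEq]
  refine ⟨funext fun i => ?_, funext fun a => funext fun i => funext fun h => ?_,
    funext fun i => funext fun a => funext fun h => ?_,
    funext fun i => funext fun j => funext fun h => ?_⟩
  · rw [hZ, Matrix.transpose_transpose]
  · rw [hV, Matrix.transpose_transpose]
  · rw [hU, Matrix.transpose_neg, Matrix.transpose_transpose, neg_neg]
  · rw [hW, Matrix.transpose_transpose]

theorem HalfADHM.gaugeEquiv_of_dual {d d' : HalfADHM n k}
    (h : HalfADHM.GaugeEquiv d.dual d'.dual) : HalfADHM.GaugeEquiv d d' := by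
  obtain ⟨g, hZ, hU, hV, hW⟩ := h
  have h1 : ∀ i, ((g i)⁻¹).valᵀ * (g i).valᵀ = 1 := fun i => by
    rw [← Matrix.transpose_mul, Units.mul_inv, Matrix.transpose_one]
  have h2 : ∀ i, (g i).valᵀ * ((g i)⁻¹).valᵀ = 1 := fun i => by
    rw [← Matrix.transpose_mul, Units.inv_mul, Matrix.transpose_one]
  obtain ⟨G, hG⟩ := exists_forall_rev_eq (P := fun i => GL (Fin (k i)) ℂ) fun i =>
    ⟨((g i)⁻¹).valᵀ, (g i).valᵀ, h1 i, h2 i⟩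
  have hGv : ∀ i, (G (Fin.rev i)).val = ((g i)⁻¹).valᵀ := fun i => by rw [hG]
  have hGi : ∀ i, ((G (Fin.rev i))⁻¹).val = (g i).valᵀ := fun i => by rw [hG]; rfl
  refine ⟨G, fun i => ?_, fun a i h => ?_, fun i a h => ?_, fun i j h => ?_⟩
  · obtain ⟨i, rfl⟩ := Fin.rev_surjective i
    rw [hGv, hGi, ← Matrix.transpose_transpose (d'.Z i.rev)]
    refine (congrArg Matrix.transpose (hZ i)).trans ?_
    rw [Matrix.transpose_mul, Matrix.transpose_mul, ← Matrix.mul_assoc]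
    rfl
  · obtain ⟨i, rfl⟩ := Fin.rev_surjective i
    obtain ⟨a, rfl⟩ := Fin.rev_surjective a
    have := congrArg (fun M => -Mᵀ) (hV i a (rev_eq_castSucc_iff.1 h))
    simp only [HalfADHM.dual, Matrix.transpose_neg, Matrix.transpose_transpose, neg_neg,
      Matrix.mul_neg, Matrix.transpose_mul] at this
    rw [hGv, this]
  · obtain ⟨i, rfl⟩ := Fin.rev_surjective i
    obtain ⟨a, rfl⟩ := Fin.rev_surjective a
    have := congrArg Matrix.transpose (hU a i (rev_eq_succ_iff.1 h))
    simp only [HalfADHM.dual, Matrix.transpose_transpose, Matrix.transpose_mul] at this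
    rw [hGi, this]
  · obtain ⟨i, rfl⟩ := Fin.rev_surjective i
    obtain ⟨j, rfl⟩ := Fin.rev_surjective j
    have := congrArg Matrix.transpose (hW j i (rev_succ_eq_castSucc_iff.1 h))
    simp only [HalfADHM.dual, Matrix.transpose_transpose, Matrix.transpose_mul] at this
    rw [hGi, hGv, this, Matrix.mul_assoc]

theorem dualMap_bijective : Function.Bijective (dualMap n k) := by
  constructor
  · rintro ⟨d⟩ ⟨d'⟩ h
    exact Quotient.sound (HalfADHM.gaugeEquiv_of_dual (Quotient.exact h))
  · rintro ⟨e⟩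
    obtain ⟨d, rfl⟩ := e.exists_dual_eq
    exact ⟨dClass d, rfl⟩

/-! ### The pairing between a lump and its dual -/

section Pairing

variable {q : ModuliMatrix n} {d : HalfADHM n k}
  {J : ∀ i : Fin L, Matrix (ColorIdx n i.castSucc) (Fin (k i)) ℂ[X]}
  {q' : ModuliMatrix (rev n)}
  {J' : ∀ i : Fin L, Matrix (ColorIdx (rev n) i.castSucc) (Fin (rev k i)) ℂ[X]}

/-- The moduli matrices of dual data annihilate each other. -/
theorem CorrVia.xi_mul_transpose_eq_zero (h : CorrVia q d J) (h' : CorrVia q' d.dual J')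
    (i : Fin L) :
    xi q' i.castSucc * ((xi q i.rev.castSucc).submatrix id flavorRev)ᵀ = 0 := by
  -- Up to reindexing, both products equal `𝔍' (X - Zᵀ) 𝔍ᵀ`, once through `Ψ' = Ψ̃ᵀ` and once, with
  -- opposite sign, through `Ψ̃' = -Ψᵀ`.
  have h1 : Dmat q' i * ((Dtil q i.rev).submatrix id (colorRev i))ᵀ =
      J' i * ((d.Z i.rev).charmatrixᵀ * (J i.rev)ᵀ) := by
    have : ((Dtil q i.rev).submatrix id (colorRev i))ᵀ =
        (d.dual.Ψ i).map Polynomial.C * (J i.rev)ᵀ := by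
      rw [h.til, d.dual_Ψ]
      exact Matrix.transpose_mul (J i.rev)
        (((d.Ψt i.rev).map Polynomial.C).submatrix id (colorRev i))
    rw [this, ← Matrix.mul_assoc, (h'.realizes i).eq, Matrix.mul_assoc,
      ← Matrix.charmatrix_transpose]
    rfl
  have h2 : Dtil q' i * ((Dmat q i.rev).submatrix id (coColorRev i))ᵀ =
      -(J' i * ((d.Z i.rev).charmatrixᵀ * (J i.rev)ᵀ)) := by
    have : (d.dual.Ψt i).map Polynomial.C =
        -(((d.Ψ i.rev).map Polynomial.C)ᵀ.submatrix id (coColorRev i)) := by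
      rw [d.dual_Ψt]
      ext1 s t
      exact Polynomial.C_neg
    rw [h'.til, this, Matrix.mul_assoc, Matrix.neg_mul, Matrix.transpose_submatrix,
      ← Matrix.submatrix_mul _ _ _ _ _ (coColorRev_bijective i), Matrix.submatrix_id_id,
      ← Matrix.transpose_mul, (h.realizes i.rev).eq, Matrix.transpose_mul, Matrix.mul_neg]
  have h3 : xi q' i.castSucc * ((xi q i.rev.castSucc).submatrix id flavorRev)ᵀ =
      Dmat q' i * ((Dtil q i.rev).submatrix id (colorRev i))ᵀ +
        Dtil q' i * ((Dmat q i.rev).submatrix id (coColorRev i))ᵀ := by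
    ext1 s t
    exact sum_flavorIdx i.castSucc _
  rw [h3, h1, h2, add_neg_cancel]

/-- Non-singularity of `q'` is the tilde condition for the dual data, that is, observability of `(Ψ,
Z)` for `d`, which every realization has. -/
theorem CorrVia.nonsingularAt_dual (h : CorrVia q d J) (h' : CorrVia q' d.dual J') (i : Fin L) :
    NonsingularAt q' i := by
  rw [h'.nonsingularAt_iff, ← HalfADHM.freeΨt_iff, HalfADHM.dual_freeΨt_iff, HalfADHM.freeΨ_iff]
  exact (h.realizes i.rev).observable

/-- The rows of `dualG G` are the basis dual to the rows of `G`, up to reversal. Expand a vector of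
the flag of `q'` in it: coefficients past the node are pairings with rows of `G` in the flag of `q`
at the reversed node, and vanish. Equal dimensions give equality. -/
theorem CorrVia.flagOf_dualG_eq (h : CorrVia q d J) (h' : CorrVia q' d.dual J') {z : ℂ}
    {G : GL (FlavorIdx n) ℂ} (hG : flagOf G.val = lumpFlag q z) :
    flagOf (dualG G.val) = lumpFlag q' z := by
  have hGd := dualG_mul G.isUnit
  have hpair : ∀ (i : Fin L) (w) (_ : w ∈ lumpFlag q' z i) (y) (_ : y ∈ lumpFlag q z i.rev),
      ∑ t, w t * y (flavorRev t) = 0 := by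
    intro i w hw y hy
    obtain ⟨u, rfl⟩ := mem_lumpFlag.1 hw
    obtain ⟨v, rfl⟩ := mem_lumpFlag.1 hy
    have h0 := congrArg (evalAt · z) (h.xi_mul_transpose_eq_zero h' i)
    simp only [evalAt_mul] at h0
    have h1 : evalAt (((xi q i.rev.castSucc).submatrix id flavorRev)ᵀ) z *ᵥ v =
        fun t => (v ᵥ* evalAt (xi q i.rev.castSucc) z) (flavorRev t) := by
      rw [← Matrix.vecMul_transpose]
      rfl
    change (u ᵥ* evalAt (xi q' i.castSucc) z) ⬝ᵥ
      (fun t => (v ᵥ* evalAt (xi q i.rev.castSucc) z) (flavorRev t)) = 0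
    rw [← h1, Matrix.dotProduct_mulVec, Matrix.vecMul_vecMul, h0]
    simp [evalAt]
  funext i
  refine (Submodule.eq_of_le_of_finrank_eq (fun w hw => ?_) ?_).symm
  · have hw' : w = (w ᵥ* (G.valᵀ).submatrix flavorRev flavorRev) ᵥ* dualG G.val := by
      rw [Matrix.vecMul_vecMul, hGd, Matrix.vecMul_one]
    rw [hw', Matrix.vecMul_eq_sum]
    refine Submodule.sum_mem _ fun s _ => ?_
    by_cases hs : s.1 ≤ i.castSucc
    · exact Submodule.smul_mem _ _ (Submodule.subset_span ⟨⟨s, hs⟩, rfl⟩)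
    · have hrow : G.val (flavorRev s) ∈ lumpFlag q z i.rev := by
        rw [← hG]
        exact Submodule.subset_span ⟨coColorRev i ⟨s, not_le.1 hs⟩, rfl⟩
      have : (w ᵥ* (G.valᵀ).submatrix flavorRev flavorRev) s = 0 := hpair i w hw _ hrow
      rw [this, zero_smul]
      exact Submodule.zero_mem _
  · rw [finrank_flagOf (IsUnit.of_mul_eq_one_right _ hGd),
      finrank_lumpFlag ((FlagLump.nonsingularAt_iff q' i).1 (h.nonsingularAt_dual h' i) z)]

end Pairing

end Duality

/-! ### Bijections between the moduli spaces -/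

section ModuliSpaces

variable {L : ℕ} {n : Fin (L + 1) → ℕ} {k : Fin L → ℕ}

theorem CorrVia.freeΨ {q : ModuliMatrix n} {d : HalfADHM n k}
    {J : ∀ i : Fin L, Matrix (ColorIdx n i.castSucc) (Fin (k i)) ℂ[X]} (h : CorrVia q d J)
    (i : Fin L) : d.FreeΨ i :=
  (d.freeΨ_iff i).2 (h.realizes i).observable

theorem CorrVia.nonsingularAt_iff_freeΨt {q : ModuliMatrix n} {d : HalfADHM n k}
    {J : ∀ i : Fin L, Matrix (ColorIdx n i.castSucc) (Fin (k i)) ℂ[X]} (h : CorrVia q d J)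
    (i : Fin L) : NonsingularAt q i ↔ d.FreeΨt i :=
  (h.nonsingularAt_iff i).trans (d.freeΨt_iff i).symm

theorem HalfADHM.exists_corrVia {d : HalfADHM n k} (hd : ∀ i, d.FreeΨ i) :
    ∃ (q : ModuliMatrix n) (J : ∀ i : Fin L, Matrix (ColorIdx n i.castSucc) (Fin (k i)) ℂ[X]),
      CorrVia q d J :=
  exists_corrVia_of_observable fun i => (d.freeΨ_iff i).1 (hd i)

/-- Gauge-equivalent data correspond to the same moduli matrix, and any corresponding data are free.
-/
theorem HalfADHM.GaugeEquiv.freeΨ {d d' : HalfADHM n k} (h : HalfADHM.GaugeEquiv d d')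
    (hd : ∀ i, d.FreeΨ i) (i : Fin L) : d'.FreeΨ i := by
  obtain ⟨q, J, hJ⟩ := HalfADHM.exists_corrVia hd
  obtain ⟨J', hJ'⟩ := hJ.of_gaugeEquiv h
  exact hJ'.freeΨ i

theorem CorrVia.dClass_eq_iff {q q' : ModuliMatrix n} {d d' : HalfADHM n k}
    {J : ∀ i : Fin L, Matrix (ColorIdx n i.castSucc) (Fin (k i)) ℂ[X]} (h : CorrVia q d J)
    (hq : vClass q = vClass q') : dClass d = dClass d' ↔ Corresponds q' d' := by
  obtain ⟨J', hJ'⟩ := h.of_vEquiv (Quotient.exact hq)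
  constructor
  · intro hd
    obtain ⟨J'', hJ''⟩ := hJ'.of_gaugeEquiv (Quotient.exact hd)
    exact hJ''.corresponds
  · intro hd
    obtain ⟨J'', hJ''⟩ := hd.exists_corrVia hJ'.isVortex
    exact Quotient.sound (hJ'.gaugeEquiv hJ'')

theorem exists_correspondence_map (n : Fin (L + 1) → ℕ) (k : Fin L → ℕ) :
    ∃ F : Quotient (vSetoid n) → DataSpace n k, ∀ (q : ModuliMatrix n) (d : HalfADHM n k),
      IsVortex q k → (F (vClass q) = dClass d ↔ Corresponds q d) := by
  have : ∀ c : Quotient (vSetoid n), ∃ x : DataSpace n k, ∀ q, vClass q = c → IsVortex q k →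
      ∀ d, x = dClass d ↔ Corresponds q d := by
    intro c
    by_cases hc : ∃ q, vClass q = c ∧ IsVortex q k
    · obtain ⟨q, rfl, hq⟩ := hc
      obtain ⟨d, J, hJ⟩ := exists_corrVia_of_isVortex hq
      exact ⟨dClass d, fun q' hq' _ d' => hJ.dClass_eq_iff hq'.symm⟩
    -- Classes without a vortex representative get the orbit of the zero data as a junk value.
    · exact ⟨dClass ⟨fun _ => 0, fun _ _ _ => 0, fun _ _ _ => 0, fun _ _ _ => 0, by simp⟩, fun q hq hv => absurd ⟨q, hq, hv⟩ hc⟩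
  choose F hF using this
  exact ⟨F, fun q d hq => hF _ q rfl hq d⟩

theorem bijOn_vtxModuli {F : Quotient (vSetoid n) → DataSpace n k}
    (hF : ∀ (q : ModuliMatrix n) (d : HalfADHM n k), IsVortex q k →
      (F (vClass q) = dClass d ↔ Corresponds q d)) :
    Set.BijOn F (matrixVtxModuli n k) (vtxModuli n k) := by
  refine ⟨?_, ?_, ?_⟩
  · rintro _ ⟨q, hq, rfl⟩
    obtain ⟨d, J, hJ⟩ := exists_corrVia_of_isVortex hq
    exact ⟨d, hJ.freeΨ, ((hF q d hq).2 hJ.corresponds).symm⟩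
  · rintro _ ⟨q, hq, rfl⟩ _ ⟨q', hq', rfl⟩ h
    obtain ⟨d, J, hJ⟩ := exists_corrVia_of_isVortex hq
    have h1 := (hF q d hq).2 hJ.corresponds
    obtain ⟨J', hJ'⟩ := ((hF q' d hq').1 (h.symm.trans h1)).exists_corrVia hq'
    exact Quotient.sound (hJ.vEquiv hJ')
  · rintro _ ⟨d, hd, rfl⟩
    obtain ⟨q, J, hJ⟩ := HalfADHM.exists_corrVia hd
    exact ⟨vClass q, ⟨q, hJ.isVortex, rfl⟩, (hF q d hJ.isVortex).2 hJ.corresponds⟩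

theorem bijOn_lumpModuli {F : Quotient (vSetoid n) → DataSpace n k}
    (hF : ∀ (q : ModuliMatrix n) (d : HalfADHM n k), IsVortex q k →
      (F (vClass q) = dClass d ↔ Corresponds q d)) :
    Set.BijOn F (matrixLumpModuli n k) (lumpModuli n k) := by
  refine ⟨?_, (bijOn_vtxModuli hF).injOn.mono (Set.image_mono fun q hq => hq.1), ?_⟩
  · rintro _ ⟨q, hq, rfl⟩
    obtain ⟨d, J, hJ⟩ := exists_corrVia_of_isVortex hq.1
    exact ⟨d, ⟨q, hq, hJ.corresponds⟩, ((hF q d hq.1).2 hJ.corresponds).symm⟩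
  · rintro _ ⟨d, ⟨q, hq, hqd⟩, rfl⟩
    exact ⟨vClass q, ⟨q, hq, rfl⟩, (hF q d hq.1).2 hqd⟩

theorem lumpModuli_eq (n : Fin (L + 1) → ℕ) (k : Fin L → ℕ) :
    lumpModuli n k = dClass '' {d | ∀ i, d.FreeΨ i ∧ d.FreeΨt i} := by
  refine congrArg (dClass '' ·) (Set.ext fun d => ⟨?_, fun hd => ?_⟩)
  · rintro ⟨q, hq, hqd⟩ i
    obtain ⟨J, hJ⟩ := hqd.exists_corrVia hq.1
    exact ⟨hJ.freeΨ i, (hJ.nonsingularAt_iff_freeΨt i).1 (hq.2 i)⟩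
  · obtain ⟨q, J, hJ⟩ := HalfADHM.exists_corrVia fun i => (hd i).1
    exact ⟨q, ⟨hJ.isVortex, fun i => (hJ.nonsingularAt_iff_freeΨt i).2 (hd i).2⟩, hJ.corresponds⟩

theorem HalfADHM.dual_free_iff (d : HalfADHM n k) :
    (∀ i, d.dual.FreeΨ i ∧ d.dual.FreeΨt i) ↔ ∀ i, d.FreeΨ i ∧ d.FreeΨt i := by
  simp only [HalfADHM.dual_freeΨ_iff, HalfADHM.dual_freeΨt_iff]
  rw [Fin.rev_surjective.forall (p := fun i => d.FreeΨ i ∧ d.FreeΨt i)]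
  exact forall_congr' fun i => and_comm

theorem bijOn_dualMap_lumpModuli (n : Fin (L + 1) → ℕ) (k : Fin L → ℕ) :
    Set.BijOn (dualMap n k) (lumpModuli n k) (lumpModuli (rev n) (rev k)) := by
  rw [lumpModuli_eq, lumpModuli_eq]
  refine ⟨?_, dualMap_bijective.1.injOn, ?_⟩
  · rintro _ ⟨d, hd, rfl⟩
    exact ⟨d.dual, d.dual_free_iff.2 hd, rfl⟩
  · rintro _ ⟨e, he, rfl⟩
    obtain ⟨d, rfl⟩ := e.exists_dual_eq
    exact ⟨dClass d, ⟨d, d.dual_free_iff.1 he, rfl⟩, rfl⟩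

theorem lumpModuli_eq_inter (n : Fin (L + 1) → ℕ) (k : Fin L → ℕ) :
    lumpModuli n k = vtxModuli n k ∩ dualMap n k ⁻¹' vtxModuli (rev n) (rev k) := by
  rw [lumpModuli_eq]
  refine Set.Subset.antisymm ?_ ?_
  · rintro _ ⟨d, hd, rfl⟩
    exact ⟨⟨d, fun i => (hd i).1, rfl⟩, d.dual, fun i => (d.dual_freeΨ_iff i).2 (hd _).2, rfl⟩
  · rintro _ ⟨⟨d, hd, rfl⟩, e, he, hde⟩
    -- The free representative `e` of the dual orbit need not be `d.dual` itself, so freeness is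
    -- transported along the gauge equivalence.
    have h1 := HalfADHM.GaugeEquiv.freeΨ (Quotient.exact hde) he
    refine ⟨d, fun i => ⟨hd i, ?_⟩, rfl⟩
    obtain ⟨i, rfl⟩ := Fin.rev_surjective i
    exact (d.dual_freeΨ_iff i).1 (h1 i)

end ModuliSpaces

end FlagLump

/-! ### Assembly of the theorem -/

open FlagLump

theorem mainTheorem4 {L : ℕ} (n : Fin (L + 1) → ℕ) (hn : ∀ a, 0 < n a) (k : Fin L → ℕ) :
    -- moduli matrices and half-ADHM data: the mapping relation is a bijection of moduli spaces,
    -- under which non-singular lumps correspond to the lump moduli space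
    (∃ F : Quotient (vSetoid n) → DataSpace n k,
      Set.BijOn F (matrixVtxModuli n k) (vtxModuli n k) ∧
      Set.BijOn F (matrixLumpModuli n k) (lumpModuli n k) ∧
      ∀ (q : ModuliMatrix n) (d : HalfADHM n k), IsVortex q k →
        (F (vClass q) = dClass d ↔ Corresponds q d)) ∧
    -- a lump is determined, as a map to the flag manifold, by its class and conversely
    (∀ q q' : ModuliMatrix n, IsLump q k → IsLump q' k →
      (vClass q = vClass q' ↔ ∀ z, lumpFlag q z = lumpFlag q' z)) ∧
    -- non-singularity is freeness of both actions
    (∀ (q : ModuliMatrix n) (d : HalfADHM n k), IsVortex q k → Corresponds q d →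
      ∀ i, NonsingularAt q i ↔ d.FreeΨ i ∧ d.FreeΨt i) ∧
    lumpModuli n k = dClass '' {d | ∀ i, d.FreeΨ i ∧ d.FreeΨt i} ∧
    -- the freeness conditions in terms of vectors
    (∀ (d : HalfADHM n k) (i : Fin L),
      (d.FreeΨ i ↔ ∀ v : Fin (k i) → ℂ,
        (∀ z, (d.res i z).det ≠ 0 → (d.Ψ i * (d.res i z)⁻¹) *ᵥ v = 0) → v = 0) ∧
      (d.FreeΨt i ↔ ∀ v : Fin (k i) → ℂ,
        (∀ z, (d.res i z).det ≠ 0 → v ᵥ* ((d.res i z)⁻¹ * d.Ψt i) = 0) → v = 0)) ∧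
    -- the inhomogeneous coordinates of the solution
    (∀ (q : ModuliMatrix n) (d : HalfADHM n k), IsVortex q k → Corresponds q d → ∀ z : ℂ,
      (∀ i, (evalAt (Dmat q i) z).det ≠ 0 ↔ (d.res i z).det ≠ 0) ∧
      ((∀ i, (evalAt (Dmat q i) z).det ≠ 0) →
        ∀ f : Blocks n, flagOf (unitriangular f) = lumpFlag q z ↔ f = d.φ z)) ∧
    -- the duality map is a bijection, exchanges the two conditions and acts on the coordinates as
    -- the duality of flag manifolds
    Function.Bijective (dualMap n k) ∧
    (∀ (d : HalfADHM n k) (i : Fin L),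
      (d.dual.FreeΨ i ↔ d.FreeΨt i.rev) ∧ (d.dual.FreeΨt i ↔ d.FreeΨ i.rev)) ∧
    (∀ (d : HalfADHM n k) (z : ℂ), (∀ i, (d.res i z).det ≠ 0) →
      unitriangular (d.dual.φ z) = dualG (unitriangular (d.φ z))) ∧
    -- dual data of a non-singular lump are the data of the same non-singular lump in the dual
    -- description
    (∀ (q : ModuliMatrix n) (d : HalfADHM n k), IsLump q k → Corresponds q d →
      (∃ q' : ModuliMatrix (rev n), IsVortex q' (rev k) ∧ Corresponds q' d.dual) ∧
      ∀ q' : ModuliMatrix (rev n), IsVortex q' (rev k) → Corresponds q' d.dual →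
        IsLump q' (rev k) ∧
        ∀ z : ℂ, (∃ G : GL (FlavorIdx n) ℂ, flagOf G.val = lumpFlag q z) ∧
          ∀ G : GL (FlavorIdx n) ℂ, flagOf G.val = lumpFlag q z →
            flagOf (dualG G.val) = lumpFlag q' z) ∧
    Set.BijOn (dualMap n k) (lumpModuli n k) (lumpModuli (rev n) (rev k)) ∧
    -- the lump moduli space is the intersection of the vortex and the dual vortex moduli spaces
    lumpModuli n k = vtxModuli n k ∩ dualMap n k ⁻¹' vtxModuli (rev n) (rev k) := by
  obtain ⟨F, hF⟩ := exists_correspondence_map n k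
  refine ⟨⟨F, bijOn_vtxModuli hF, bijOn_lumpModuli hF, hF⟩, ?_, ?_, lumpModuli_eq n k,
    fun d i => ⟨d.freeΨ_iff_resolvent i, d.freeΨt_iff_resolvent i⟩, ?_, dualMap_bijective,
    fun d i => ⟨d.dual_freeΨ_iff i, d.dual_freeΨt_iff i⟩, fun d z => d.unitriangular_dual_φ z, ?_,
    bijOn_dualMap_lumpModuli n k, lumpModuli_eq_inter n k⟩
  · intro q q' hq hq'
    exact ⟨fun h => lumpFlag_eq_of_vEquiv (Quotient.exact h),
      fun h => Quotient.sound (vEquiv_of_lumpFlag_eq hq hq' h)⟩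
  · intro q d hq hqd i
    obtain ⟨J, hJ⟩ := hqd.exists_corrVia hq
    exact (hJ.nonsingularAt_iff_freeΨt i).trans (and_iff_right (hJ.freeΨ i)).symm
  · intro q d hq hqd z
    obtain ⟨J, hJ⟩ := hqd.exists_corrVia hq
    exact ⟨fun i => (hJ.realizes i).det_evalAt_ne_zero_iff z,
      fun hz f => hJ.flagOf_unitriangular_eq_iff hz f⟩
  · intro q d hq hqd
    obtain ⟨J, hJ⟩ := hqd.exists_corrVia hq.1
    refine ⟨?_, fun q' hq' hqd' => ?_⟩
    · obtain ⟨q', J', hJ'⟩ := HalfADHM.exists_corrVia (d := d.dual) fun i =>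
        (d.dual_freeΨ_iff i).2 ((hJ.nonsingularAt_iff_freeΨt _).1 (hq.2 _))
      exact ⟨q', hJ'.isVortex, hJ'.corresponds⟩
    · obtain ⟨J', hJ'⟩ := hqd'.exists_corrVia hq'
      exact ⟨⟨hq', hJ.nonsingularAt_dual hJ'⟩, fun z =>
        ⟨exists_flagOf_eq fun i => (nonsingularAt_iff q i).1 (hq.2 i) z,
          fun G hG => hJ.flagOf_dualG_eq hJ' hG⟩⟩
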